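/- A discounted turn-based two-player zero-sum stochastic game $\mathcal G=(\mathcal S_{\min},\mathcal S_{\max},\mathcal A,\boldsymbol P,\boldsymbol r,\gamma)$ consists of disjoint finite sets $\mathcal S_{\min},\mathcal S_{\max}$ of states with non-empty union $\mathcal S$, a finite non-empty set $\mathcal A$ of actions, transition probabilities $\boldsymbol P(\cdot\mid s,a)$ on $\mathcal S$, rewards $\boldsymbol r:\mathcal S\times\mathcal A\to[0,1]$ and a discount factor $\gamma\in(0,1)$. A strategy is a pair $\sigma=(\pi_{\min},\pi_{\max})$ of maps $\pi_{\min}:\mathcal S_{\min}\to\mathcal A$, $\pi_{\max}:\mathcal S_{\max}\to\mathcal A$; its value is $\boldsymbol v^\sigma(s)=\mathbb E\big[\sum_{t\ge 0}\gamma^t\boldsymbol r(s^t,\sigma(s^t))\mid s^0=s\big]$, where $s^{t+1}\sim\boldsymbol P(\cdot\mid s^t,\sigma(s^t))$. The strategy $\sigma$ is $\epsilon$-optimal if, at every state, $$\max_{\pi'_{\max}}\boldsymbol v^{(\pi_{\min},\pi'_{\max})}-\epsilon\;\le\;\boldsymbol v^{\sigma}\;\le\;\min_{\pi'_{\min}}\boldsymbol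 v^{(\pi'_{\min},\pi_{\max})}+\epsilon .$$ A generative model returns, on a query $(s,a)$, an independent sample from $\boldsymbol P(\cdot\mid s,a)$. Theorem. There is a single algorithm (a program for a unit-cost real RAM with arithmetic operations, square roots and comparisons of real numbers, on which a query to the generative model takes one step, and whose program text is independent of the game, of $\epsilon$ and of $\delta$) and absolute constants $C,\kappa$ such that the following holds for every such game and all $\epsilon,\delta\in(0,1)$. Given $\mathcal S_{\min},\mathcal S_{\max},\mathcal A,\boldsymbol r,\gamma,\epsilon,\delta$, and access to $\boldsymbol P$ only through the generative model, the algorithm always halts and outputs, with probability at least $1-\delta$, an $\epsilon$-optimal strategy. The number $Z$ of samples that it queries satisfies $$Z\le C\,\frac{|\mathcal S||\mathcal A|}{(1-\gamma)^{3}\epsilon^{2}}\Big(1+\log\frac{|\mathcal S||\mathcal A|}{(1-\gamma)\epsilon\delta}\Big)^{\kappa},$$ its running time is at most $C\,Z$, and it uses at most $C\,|\mathcal S||\mathcal A|$ memory cells. -/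

import Mathlib

open MeasureTheory ProbabilityTheory

/-! ### Discounted turn-based two-player zero-sum stochastic games -/

/-- The two players: one minimizes, the other maximizes the discounted reward. -/
inductive Player where
  | min
  | max

/-- A discounted turn-based two-player zero-sum stochastic game with states `Fin n` and actions
`Fin m`. The states of the min-player are those with owner `Player.min`, the states of the
max-player are those with owner `Player.max`. -/
structure Game (n m : ℕ) where
  /-- the player who controls a state -/
  owner : Fin n → Player
  /-- the transition probabilities `P(· | s, a)` -/
  trans : Fin n → Fin m → PMF (Fin n)
  /-- the reward function -/
  reward : Fin n → Fin m → ℝ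
  reward_mem : ∀ s a, reward s a ∈ Set.Icc (0 : ℝ) 1
  /-- the discount factor `γ` -/
  discount : ℝ
  discount_mem : discount ∈ Set.Ioo (0 : ℝ) 1

namespace Game

variable {n m : ℕ} (G : Game n m)

/-- Pure stationary strategies of the min-player. -/
abbrev MinStrategy : Type := {s : Fin n // G.owner s = Player.min} → Fin m

/-- Pure stationary strategies of the max-player. -/
abbrev MaxStrategy : Type := {s : Fin n // G.owner s = Player.max} → Fin m

/-- The map `σ : S → A` given by a strategy `σ = (π_min, π_max)`. -/
def combine (π : G.MinStrategy) (τ : G.MaxStrategy) (s : Fin n) : Fin m :=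
  match h : G.owner s with
  | Player.min => π ⟨s, h⟩
  | Player.max => τ ⟨s, h⟩

/-- The transition kernel of the Markov chain of states under `σ`. -/
noncomputable def stepKernel (σ : Fin n → Fin m) : Kernel (Fin n) (Fin n) :=
  Kernel.ofFunOfCountable fun s => (G.trans s (σ s)).toMeasure

instance (σ : Fin n → Fin m) : IsMarkovKernel (G.stepKernel σ) :=
  ⟨fun s => by
    change IsProbabilityMeasure (G.trans s (σ s)).toMeasure
    infer_instance⟩

/-- The law of the random state sequence `s⁰, s¹, s², …` with `s⁰ = s` under `σ`: given
`s⁰, …, sᵗ`, the next state is distributed according to `P(· | sᵗ, σ(sᵗ))`. -/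
noncomputable def pathLaw (σ : Fin n → Fin m) (s : Fin n) : Measure (ℕ → Fin n) :=
  Kernel.traj (X := fun _ => Fin n)
    (fun t => (G.stepKernel σ).comap
      (fun h : (i : Finset.Iic t) → Fin n => h ⟨t, Finset.mem_Iic.2 le_rfl⟩)
      (measurable_pi_apply _))
    0 (fun _ => s)

/-- The value function: the expected discounted cumulative reward
`v^σ(s) = E[∑ₜ γᵗ r(sᵗ, σ(sᵗ)) | s⁰ = s]`. -/
noncomputable def value (σ : Fin n → Fin m) (s : Fin n) : ℝ :=
  ∫ x, ∑' t : ℕ, G.discount ^ t * G.reward (x t) (σ (x t)) ∂(G.pathLaw σ s)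

/-- The strategy `(π, τ)` is `ε`-optimal: up to an additive `ε` at every state, no player gains by
switching to another strategy. -/
def IsEpsOptimal (ε : ℝ) (π : G.MinStrategy) (τ : G.MaxStrategy) : Prop :=
  (∀ (τ' : G.MaxStrategy) (s : Fin n),
    G.value (G.combine π τ') s ≤ G.value (G.combine π τ) s + ε) ∧
  (∀ (π' : G.MinStrategy) (s : Fin n),
    G.value (G.combine π τ) s ≤ G.value (G.combine π' τ) s + ε)

/-- The answers of the generative model: `ω (t, s, a)` is the state that is returned if the query
number `t` (counted from `0` over the whole run) is made at the state-action pair `(s, a)`. -/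
abbrev Samples (n m : ℕ) : Type := ℕ × Fin n × Fin m → Fin n

/-- The law of the answers: they are independent, and an answer to a query at `(s, a)` has the
law `P(· | s, a)`. -/
noncomputable def sampleLaw : Measure (Samples n m) :=
  Measure.infinitePi fun q : ℕ × Fin n × Fin m => (G.trans q.2.1 q.2.2).toMeasure

end Game

/-! ### The machine model: a unit-cost real RAM with access to a generative model

A program works on `k` arrays of natural numbers and `k` arrays of real numbers, where `k` is fixed
by the program. Natural numbers can only be written down, copied, increased by one, compared and
used as addresses, so that all of them stay below a constant plus `n + m` plus the number of steps.
Real numbers can be added, subtracted, multiplied, divided, compared, and one can take square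
roots. The number of states and actions, the owner of a state, the rewards, the discount factor,
the accuracy `ε` and the failure probability `δ` are read-only inputs. The transition probabilities
are accessible only through samples. -/

/-- What is given to a program. The transition probabilities of the game are not readable. -/
structure Input (n m : ℕ) where
  game : Game n m
  eps : ℝ
  delta : ℝ

/-- Expressions for natural numbers. -/
inductive NExpr (k : ℕ) where
  | lit (c : ℕ)
  | numStates
  | numActions
  | get (x : Fin k) (i : NExpr k)
  | succ (e : NExpr k)

/-- Expressions for real numbers. -/
inductive RExpr (k : ℕ) where
  | ofNat (e : NExpr k)
  | discount
  | eps
  | delta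
  | reward (s a : NExpr k)
  | get (x : Fin k) (i : NExpr k)
  | add (e f : RExpr k)
  | sub (e f : RExpr k)
  | mul (e f : RExpr k)
  | div (e f : RExpr k)
  | sqrt (e : RExpr k)

/-- Tests. -/
inductive BExpr (k : ℕ) where
  | ltN (e f : NExpr k)
  | ltR (e f : RExpr k)
  | isMin (s : NExpr k)
  | neg (b : BExpr k)
  | and (b c : BExpr k)

/-- Commands. `sample x i s a` queries the generative model at the state-action pair `(s, a)` and
stores the answer in cell `i` of the `x`-th array of natural numbers. -/
inductive Cmd (k : ℕ) where
  | skip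
  | setN (x : Fin k) (i e : NExpr k)
  | setR (x : Fin k) (i : NExpr k) (e : RExpr k)
  | sample (x : Fin k) (i s a : NExpr k)
  | seq (c d : Cmd k)
  | ite (b : BExpr k) (c d : Cmd k)
  | loop (b : BExpr k) (c : Cmd k)

/-- The memory of the machine, with counters for the time used, for the number of queries, and for
the length of the arrays (one plus the largest index at which an array has been accessed). -/
structure State (k : ℕ) where
  nat : Fin k → ℕ → ℕ
  real : Fin k → ℕ → ℝ
  time : ℕ
  queries : ℕ
  length : ℕ

/-- The initial state. -/
def State.init (k : ℕ) : State k := ⟨fun _ _ => 0, fun _ _ => 0, 0, 0, 0⟩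

/-- The number of memory cells that are used: `k` arrays of natural numbers and `k` arrays of real
numbers. -/
def State.space {k : ℕ} (st : State k) : ℕ := 2 * k * st.length

/-- Record `t` units of time and accesses to cells with index below `l`. -/
def State.charge {k : ℕ} (st : State k) (t l : ℕ) : State k :=
  { st with time := st.time + t, length := max st.length l }

/-- Write a natural number into a cell. -/
def State.writeN {k : ℕ} (st : State k) (x : Fin k) (i v : ℕ) : State k :=
  { st with nat := Function.update st.nat x (Function.update (st.nat x) i v) }

/-- Write a real number into a cell. -/
def State.writeR {k : ℕ} (st : State k) (x : Fin k) (i : ℕ) (v : ℝ) : State k :=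
  { st with real := Function.update st.real x (Function.update (st.real x) i v) }

/-- Record a query. -/
def State.query {k : ℕ} (st : State k) : State k := { st with queries := st.queries + 1 }

namespace NExpr

variable {k : ℕ}

/-- The value of an expression. -/
def eval (n m : ℕ) (st : State k) : NExpr k → ℕ
  | lit c => c
  | numStates => n
  | numActions => m
  | get x i => st.nat x (i.eval n m st)
  | succ e => e.eval n m st + 1

/-- The number of operations in an expression. -/
def cost : NExpr k → ℕ
  | lit _ => 1
  | numStates => 1
  | numActions => 1
  | get _ i => i.cost + 1
  | succ e => e.cost + 1

/-- One plus the largest index at which an array is read. -/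
def reach (n m : ℕ) (st : State k) : NExpr k → ℕ
  | lit _ => 0
  | numStates => 0
  | numActions => 0
  | get _ i => max (i.reach n m st) (i.eval n m st + 1)
  | succ e => e.reach n m st

end NExpr

namespace RExpr

variable {k n m : ℕ}

/-- The value of an expression. -/
noncomputable def eval (I : Input n m) (st : State k) : RExpr k → ℝ
  | ofNat e => (e.eval n m st : ℝ)
  | discount => I.game.discount
  | eps => I.eps
  | delta => I.delta
  | reward s a =>
      if h : s.eval n m st < n ∧ a.eval n m st < m then
        I.game.reward ⟨s.eval n m st, h.1⟩ ⟨a.eval n m st, h.2⟩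
      else 0
  | get x i => st.real x (i.eval n m st)
  | add e f => e.eval I st + f.eval I st
  | sub e f => e.eval I st - f.eval I st
  | mul e f => e.eval I st * f.eval I st
  | div e f => e.eval I st / f.eval I st
  | sqrt e => Real.sqrt (e.eval I st)

/-- The number of operations in an expression. -/
def cost : RExpr k → ℕ
  | ofNat e => e.cost + 1
  | discount => 1
  | eps => 1
  | delta => 1
  | reward s a => s.cost + a.cost + 1
  | get _ i => i.cost + 1
  | add e f => e.cost + f.cost + 1
  | sub e f => e.cost + f.cost + 1
  | mul e f => e.cost + f.cost + 1
  | div e f => e.cost + f.cost + 1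
  | sqrt e => e.cost + 1

/-- One plus the largest index at which an array is read. -/
def reach (n m : ℕ) (st : State k) : RExpr k → ℕ
  | ofNat e => e.reach n m st
  | discount => 0
  | eps => 0
  | delta => 0
  | reward s a => max (s.reach n m st) (a.reach n m st)
  | get _ i => max (i.reach n m st) (i.eval n m st + 1)
  | add e f => max (e.reach n m st) (f.reach n m st)
  | sub e f => max (e.reach n m st) (f.reach n m st)
  | mul e f => max (e.reach n m st) (f.reach n m st)
  | div e f => max (e.reach n m st) (f.reach n m st)
  | sqrt e => e.reach n m st

end RExpr

namespace BExpr

variable {k n m : ℕ}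

/-- Whether a test succeeds. -/
def holds (I : Input n m) (st : State k) : BExpr k → Prop
  | ltN e f => e.eval n m st < f.eval n m st
  | ltR e f => e.eval I st < f.eval I st
  | isMin s => ∃ h : s.eval n m st < n, I.game.owner ⟨s.eval n m st, h⟩ = Player.min
  | neg b => ¬ b.holds I st
  | and b c => b.holds I st ∧ c.holds I st

/-- The number of operations in a test. -/
def cost : BExpr k → ℕ
  | ltN e f => e.cost + f.cost + 1
  | ltR e f => e.cost + f.cost + 1
  | isMin s => s.cost + 1
  | neg b => b.cost + 1
  | and b c => b.cost + c.cost + 1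

/-- One plus the largest index at which an array is read. -/
def reach (n m : ℕ) (st : State k) : BExpr k → ℕ
  | ltN e f => max (e.reach n m st) (f.reach n m st)
  | ltR e f => max (e.reach n m st) (f.reach n m st)
  | isMin s => s.reach n m st
  | neg b => b.reach n m st
  | and b c => max (b.reach n m st) (c.reach n m st)

end BExpr

/-- `Exec I ω c st st'`: started in the state `st`, with answers `ω` of the generative model, the
command `c` halts in the state `st'`. A query outside the range of the state-action pairs has no
rule, so that the machine gets stuck there. -/
inductive Exec {n m k : ℕ} (I : Input n m) (ω : Game.Samples n m) :
    Cmd k → State k → State k → Prop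
  | skip (st : State k) : Exec I ω Cmd.skip st (st.charge 1 0)
  | setN (st : State k) (x : Fin k) (i e : NExpr k) :
      Exec I ω (Cmd.setN x i e) st
        ((st.charge (i.cost + e.cost + 1)
            (max (i.eval n m st + 1) (max (i.reach n m st) (e.reach n m st)))).writeN
          x (i.eval n m st) (e.eval n m st))
  | setR (st : State k) (x : Fin k) (i : NExpr k) (e : RExpr k) :
      Exec I ω (Cmd.setR x i e) st
        ((st.charge (i.cost + e.cost + 1)
            (max (i.eval n m st + 1) (max (i.reach n m st) (e.reach n m st)))).writeR
          x (i.eval n m st) (e.eval I st))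
  | sample (st : State k) (x : Fin k) (i s a : NExpr k)
      (hs : s.eval n m st < n) (ha : a.eval n m st < m) :
      Exec I ω (Cmd.sample x i s a) st
        (((st.charge (i.cost + s.cost + a.cost + 1)
            (max (i.eval n m st + 1)
              (max (i.reach n m st) (max (s.reach n m st) (a.reach n m st))))).writeN
          x (i.eval n m st)
          (ω (st.queries, ⟨s.eval n m st, hs⟩, ⟨a.eval n m st, ha⟩) : ℕ)).query)
  | seq {c d : Cmd k} {st st₁ st₂ : State k} (hc : Exec I ω c st st₁) (hd : Exec I ω d st₁ st₂) :
      Exec I ω (Cmd.seq c d) st st₂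
  | iteTrue {b : BExpr k} {c d : Cmd k} {st st' : State k} (hb : b.holds I st)
      (hc : Exec I ω c (st.charge (b.cost + 1) (b.reach n m st)) st') :
      Exec I ω (Cmd.ite b c d) st st'
  | iteFalse {b : BExpr k} {c d : Cmd k} {st st' : State k} (hb : ¬ b.holds I st)
      (hd : Exec I ω d (st.charge (b.cost + 1) (b.reach n m st)) st') :
      Exec I ω (Cmd.ite b c d) st st'
  | loopTrue {b : BExpr k} {c : Cmd k} {st st₁ st₂ : State k} (hb : b.holds I st)
      (hc : Exec I ω c (st.charge (b.cost + 1) (b.reach n m st)) st₁)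
      (hl : Exec I ω (Cmd.loop b c) st₁ st₂) :
      Exec I ω (Cmd.loop b c) st st₂
  | loopFalse {b : BExpr k} {c : Cmd k} {st : State k} (hb : ¬ b.holds I st) :
      Exec I ω (Cmd.loop b c) st (st.charge (b.cost + 1) (b.reach n m st))

/-- The machine is deterministic once the answers of the generative model are given. -/
theorem Exec.deterministic {n m k : ℕ} {I : Input n m} {ω : Game.Samples n m} {c : Cmd k}
    {st st₁ st₂ : State k} (h₁ : Exec I ω c st st₁) (h₂ : Exec I ω c st st₂) : st₁ = st₂ := by
  induction h₁ generalizing st₂ with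
  | skip => cases h₂; rfl
  | setN => cases h₂; rfl
  | setR => cases h₂; rfl
  | sample => cases h₂; rfl
  | seq _ _ ih₁ ih₂ =>
    cases h₂ with
    | seq hc hd => obtain rfl := ih₁ hc; exact ih₂ hd
  | iteTrue hb _ ih =>
    cases h₂ with
    | iteTrue _ hc => exact ih hc
    | iteFalse hb' _ => exact absurd hb hb'
  | iteFalse hb _ ih =>
    cases h₂ with
    | iteTrue hb' _ => exact absurd hb' hb
    | iteFalse _ hd => exact ih hd
  | loopTrue hb _ _ ih₁ ih₂ =>
    cases h₂ with
    | loopTrue _ hc hl => obtain rfl := ih₁ hc; exact ih₂ hl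
    | loopFalse hb' => exact absurd hb hb'
  | loopFalse hb =>
    cases h₂ with
    | loopTrue hb' _ _ => exact absurd hb' hb
    | loopFalse _ => rfl

/-- A program: the number of its arrays, its body, and the name of the array of natural numbers
that holds the output. -/
structure Program where
  k : ℕ
  body : Cmd k
  out : Fin k

namespace Program

variable {n m : ℕ} (p : Program)

/-- On the input `I` and with answers `ω` of the generative model, `p` halts in the state `st`. -/
def HaltsIn (I : Input n m) (ω : Game.Samples n m) (st : State p.k) : Prop :=
  Exec I ω p.body (State.init p.k) st

/-- In the state `st`, the output of `p` is the strategy `(π, τ)`, as the table of its actions. -/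
def Outputs (G : Game n m) (st : State p.k) (π : G.MinStrategy) (τ : G.MaxStrategy) : Prop :=
  ∀ s : Fin n, st.nat p.out s = (G.combine π τ s : ℕ)

end Program

/-!
The algorithm is variance-reduced value iteration, run twice: once to find a strategy of the
max-player, and once on the reflected game (players exchanged, rewards `1 - r`), which yields a
strategy of the min-player. Let `H = 1 / (1 - γ)` be the horizon and `w` the solution of the Bellman
equation.

*Certificates.* Each run maintains a lower bound `v` together with a strategy `τ` of the max-player
that guarantees `v`: the bound `v` is at most its one-step lookahead under `τ`, whatever the other
player does (`Game.Guarantees`). Both the bound and the certificate survive an update step in which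
the estimates of the one-step lookahead err only downwards (`Game.Guarantees.improve`), because the
strategy is changed only where the bound increases. So the output need not be evaluated: two
guarantees that are `ε / 2`-close to `w` and to `H - w` make an `ε`-optimal strategy
(`Game.isEpsOptimal_of_guarantees`).

*Phases.* A phase halves a bound `u` on `w - v`, so that `O(log (H / ε))` phases suffice. At its
start `v₀ := v`, and the values `r + γ P v₀` of all state-action pairs are estimated from
`O(L H³ / ε²)` samples each, where `L` is a confidence parameter. Then `O(H)` update steps estimate
only the corrections `γ P (v - v₀)`, whose range is at most `u`, from `O(L H²)` fresh samples each.

*Variance.* The error of the first estimate has to be charged to the variance of `v₀` at the next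
state. The program cannot read this variance, and instead it subtracts from each sampled return a
multiple of its squared temporal difference, which makes the sample mean a lower estimate with an
exponential moment bound (`Game.concentrates_penalized`) and costs at most a multiple of the mean
squared temporal difference. For `w` the latter is at most `γ P w² - w² + 2 H`
(`Game.IsBellman.sqDiff_le`), for every action that an optimal play of either player may use.
Therefore the potential `(w - v) + 16 η w²` contracts by `γ` in an update step, up to an error of
order `u / H` (`Game.Improves.potential_le`). This is the usual total-variance argument in
differential form, and it is what makes `H³` rather than `H⁴` samples sufficient.

*The machine.* `Runs` is a total-correctness judgement with exact query counts and bounds on time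
and on addresses. `Likely` bounds the probability that a command fails to reach a postcondition. Its
rule for sequential composition (`Likely.seq`) adds up failure probabilities: a run depends only on
the answers that it reads (`Exec.congr_samples`), and those that are read later are independent of
the state at which the later command starts (`Game.sampleLaw_exists_and_mem_le`). The Chernoff bound
for sample means then enters only through the two kinds of estimates in a phase.
-/

/-! ### Expectations over the next state -/

namespace Game

variable {n m : ℕ} (G : Game n m)

/-- The expectation of `f` at the next state, if the action `a` is played at the state `s`. -/
noncomputable def expect (s : Fin n) (a : Fin m) (f : Fin n → ℝ) : ℝ :=
  ∑ s', (G.trans s a s').toReal * f s'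

theorem sum_trans (s : Fin n) (a : Fin m) : ∑ s', (G.trans s a s').toReal = 1 := by
  have h := (G.trans s a).tsum_coe
  rw [tsum_fintype] at h
  rw [← ENNReal.toReal_sum (fun s' _ => (G.trans s a).apply_ne_top s'), h, ENNReal.toReal_one]

theorem integral_trans (s : Fin n) (a : Fin m) (f : Fin n → ℝ) :
    ∫ x, f x ∂(G.trans s a).toMeasure = G.expect s a f := by
  rw [PMF.integral_eq_sum]; rfl

theorem expect_const (s : Fin n) (a : Fin m) (c : ℝ) : G.expect s a (fun _ => c) = c := by
  rw [expect, ← Finset.sum_mul, sum_trans, one_mul]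

theorem expect_add (s : Fin n) (a : Fin m) (f g : Fin n → ℝ) :
    G.expect s a (fun x => f x + g x) = G.expect s a f + G.expect s a g := by
  simp only [expect, mul_add, Finset.sum_add_distrib]

theorem expect_sub (s : Fin n) (a : Fin m) (f g : Fin n → ℝ) :
    G.expect s a (fun x => f x - g x) = G.expect s a f - G.expect s a g := by
  simp only [expect, mul_sub, Finset.sum_sub_distrib]

theorem expect_mul (s : Fin n) (a : Fin m) (c : ℝ) (f : Fin n → ℝ) :
    G.expect s a (fun x => c * f x) = c * G.expect s a f := by
  simp only [expect, Finset.mul_sum]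
  exact Finset.sum_congr rfl fun _ _ => by ring

theorem expect_mono (s : Fin n) (a : Fin m) {f g : Fin n → ℝ} (h : ∀ x, f x ≤ g x) :
    G.expect s a f ≤ G.expect s a g :=
  Finset.sum_le_sum fun x _ => mul_le_mul_of_nonneg_left (h x) ENNReal.toReal_nonneg

theorem expect_le (s : Fin n) (a : Fin m) {f : Fin n → ℝ} {c : ℝ} (h : ∀ x, f x ≤ c) :
    G.expect s a f ≤ c := by
  simpa only [expect_const] using G.expect_mono s a (g := fun _ => c) h

theorem le_expect (s : Fin n) (a : Fin m) {f : Fin n → ℝ} {c : ℝ} (h : ∀ x, c ≤ f x) :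
    c ≤ G.expect s a f := by
  simpa only [expect_const] using G.expect_mono s a (f := fun _ => c) h

theorem discount_pos : 0 < G.discount := G.discount_mem.1

theorem discount_lt_one : G.discount < 1 := G.discount_mem.2

/-- A discounted maximum principle. -/
theorem nonpos_of_le_discount_expect {d : Fin n → ℝ} (σ : Fin n → Fin m)
    (h : ∀ s, d s ≤ G.discount * G.expect s (σ s) d) (s : Fin n) : d s ≤ 0 := by
  obtain ⟨z, -, hz⟩ := Finset.exists_max_image Finset.univ d ⟨s, Finset.mem_univ s⟩
  have h1 : G.expect z (σ z) d ≤ d z := G.expect_le _ _ fun x => hz x (Finset.mem_univ x)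
  have h2 := h z
  have h3 := mul_le_mul_of_nonneg_left h1 G.discount_pos.le
  have h4 : d z ≤ 0 := by
    have := G.discount_lt_one
    by_contra hc
    push Not at hc
    nlinarith
  exact (hz s (Finset.mem_univ s)).trans h4

/-! ### The value of a strategy satisfies its Bellman equation -/

/-- The action of the transition matrix of `σ` on functions. -/
noncomputable def next (σ : Fin n → Fin m) (f : Fin n → ℝ) (s : Fin n) : ℝ := G.expect s (σ s) f

instance (σ : Fin n → Fin m) (s : Fin n) : IsProbabilityMeasure (G.pathLaw σ s) := by
  unfold pathLaw; infer_instance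

theorem integrable_of_forall_abs_le {α : Type*} [MeasurableSpace α] {μ : Measure α}
    [IsFiniteMeasure μ] {f : α → ℝ} (hf : Measurable f) (C : ℝ) (h : ∀ x, |f x| ≤ C) :
    Integrable f μ :=
  Integrable.of_bound hf.aestronglyMeasurable C (Filter.Eventually.of_forall h)

theorem integrable_path (σ : Fin n → Fin m) (s : Fin n) (f : Fin n → ℝ) (t : ℕ) :
    Integrable (fun x : ℕ → Fin n => f (x t)) (G.pathLaw σ s) := by
  refine integrable_of_forall_abs_le ((measurable_of_finite f).comp (measurable_pi_apply t))
    (∑ y, |f y|) fun x => ?_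
  exact Finset.single_le_sum (f := fun y => |f y|) (fun y _ => abs_nonneg _) (Finset.mem_univ (x t))

theorem integral_path_succ (σ : Fin n → Fin m) (s : Fin n) (f : Fin n → ℝ) (t : ℕ) :
    ∫ x, f (x (t + 1)) ∂(G.pathLaw σ s) = ∫ x, G.next σ f (x t) ∂(G.pathLaw σ s) := by
  have hi := G.integrable_path σ s f (t + 1)
  unfold pathLaw at hi ⊢
  set κ : (t : ℕ) → Kernel ((i : Finset.Iic t) → Fin n) (Fin n) := fun t =>
    (G.stepKernel σ).comap (fun h : (i : Finset.Iic t) → Fin n => h ⟨t, Finset.mem_Iic.2 le_rfl⟩)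
      (measurable_pi_apply _) with hκ
  have h1 := Kernel.integral_traj_partialTraj (X := fun _ => Fin n) (κ := κ) (Nat.zero_le t) hi
  rw [← h1]
  have h2 : ∀ y : (i : Finset.Iic t) → Fin n,
      ∫ x, f (x (t + 1)) ∂(Kernel.traj (X := fun _ => Fin n) κ t y)
        = G.next σ f (y ⟨t, Finset.mem_Iic.2 le_rfl⟩) := by
    intro y
    have h3 : (Kernel.traj (X := fun _ => Fin n) κ t).map (fun x => x (t + 1)) = κ t :=
      Kernel.map_traj_succ_self
    have h4 : ∫ x, f (x (t + 1)) ∂(Kernel.traj (X := fun _ => Fin n) κ t y)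
        = ∫ z, f z ∂(κ t y) := by
      have hm : Measurable fun x : ℕ → Fin n => x (t + 1) := measurable_pi_apply _
      rw [← h3, Kernel.map_apply _ hm, integral_map hm.aemeasurable
        (measurable_of_finite f).aestronglyMeasurable]
    rw [h4]
    exact G.integral_trans _ _ f
  simp_rw [h2]
  rw [← Kernel.traj_map_frestrictLe_apply, integral_map (by fun_prop)]
  · rfl
  · exact (measurable_of_finite _).aestronglyMeasurable

theorem integral_path_zero (σ : Fin n → Fin m) (s : Fin n) (f : Fin n → ℝ) :
    ∫ x, f (x 0) ∂(G.pathLaw σ s) = f s := by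
  unfold pathLaw
  rw [Kernel.integral_traj (X := fun _ => Fin n)]
  · simp [Function.updateFinset]
  · exact ((measurable_of_finite f).comp (measurable_pi_apply 0)).aestronglyMeasurable

theorem integral_path (σ : Fin n → Fin m) (s : Fin n) (f : Fin n → ℝ) (t : ℕ) :
    ∫ x, f (x t) ∂(G.pathLaw σ s) = (G.next σ)^[t] f s := by
  induction t generalizing f with
  | zero => exact G.integral_path_zero σ s f
  | succ t ih => rw [integral_path_succ, ih, Function.iterate_succ_apply]

theorem value_eq_tsum (σ : Fin n → Fin m) (s : Fin n) :
    G.value σ s = ∑' t, G.discount ^ t * (G.next σ)^[t] (fun x => G.reward x (σ x)) s := by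
  have hr : ∀ x, |G.reward x (σ x)| ≤ 1 := fun x => by
    have := G.reward_mem x (σ x)
    rw [abs_of_nonneg this.1]; exact this.2
  have hint : ∀ t : ℕ, Integrable (fun x : ℕ → Fin n =>
      G.discount ^ t * G.reward (x t) (σ (x t))) (G.pathLaw σ s) := fun t =>
    (G.integrable_path σ s (fun x => G.reward x (σ x)) t).const_mul _
  unfold value
  rw [← integral_tsum_of_summable_integral_norm hint]
  · refine tsum_congr fun t => ?_
    rw [integral_const_mul, G.integral_path σ s (fun x => G.reward x (σ x)) t]
  · refine Summable.of_nonneg_of_le (fun t => integral_nonneg fun _ => norm_nonneg _) (fun t => ?_)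
      (summable_geometric_of_lt_one G.discount_pos.le G.discount_lt_one)
    calc ∫ x, ‖G.discount ^ t * G.reward (x t) (σ (x t))‖ ∂(G.pathLaw σ s)
        ≤ ∫ _, G.discount ^ t ∂(G.pathLaw σ s) := by
          refine integral_mono (hint t).norm (integrable_const _) fun x => ?_
          rw [norm_mul, Real.norm_of_nonneg (pow_nonneg G.discount_pos.le t), Real.norm_eq_abs]
          exact mul_le_of_le_one_right (pow_nonneg G.discount_pos.le t) (hr _)
      _ = G.discount ^ t := by simp

theorem abs_iterate_next_le (σ : Fin n → Fin m) {f : Fin n → ℝ} (hf : ∀ s, |f s| ≤ 1) (t : ℕ) :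
    ∀ s, |(G.next σ)^[t] f s| ≤ 1 := by
  induction t with
  | zero => exact hf
  | succ t ih =>
    intro s
    rw [Function.iterate_succ_apply', abs_le]
    exact ⟨G.le_expect _ _ fun x => (abs_le.1 (ih x)).1,
      G.expect_le _ _ fun x => (abs_le.1 (ih x)).2⟩

theorem value_eq (σ : Fin n → Fin m) (s : Fin n) :
    G.value σ s = G.reward s (σ s) + G.discount * G.expect s (σ s) (G.value σ) := by
  have hr : ∀ x, |G.reward x (σ x)| ≤ 1 := fun x => by
    have := G.reward_mem x (σ x)
    rw [abs_of_nonneg this.1]; exact this.2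
  have hs : ∀ s, Summable fun t =>
      G.discount ^ t * (G.next σ)^[t] (fun x => G.reward x (σ x)) s := fun s => by
    refine Summable.of_norm_bounded
      (summable_geometric_of_lt_one G.discount_pos.le G.discount_lt_one) fun t => ?_
    rw [norm_mul, Real.norm_of_nonneg (pow_nonneg G.discount_pos.le t), Real.norm_eq_abs]
    exact mul_le_of_le_one_right (pow_nonneg G.discount_pos.le t) (G.abs_iterate_next_le σ hr t s)
  rw [value_eq_tsum, (hs s).tsum_eq_zero_add]
  simp only [pow_zero, Function.iterate_zero, id_eq, one_mul]
  congr 1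
  have h1 : ∀ s', G.value σ s'
      = ∑' t, G.discount ^ t * (G.next σ)^[t] (fun x => G.reward x (σ x)) s' :=
    G.value_eq_tsum σ
  unfold expect
  simp_rw [h1, ← tsum_mul_left]
  rw [← Summable.tsum_finsetSum fun s' _ => (hs s').mul_left _, ← tsum_mul_left]
  refine tsum_congr fun t => ?_
  rw [Function.iterate_succ_apply']
  simp only [next, expect, Finset.mul_sum]
  exact Finset.sum_congr rfl fun s' _ => by ring

theorem le_value (σ : Fin n → Fin m) {v : Fin n → ℝ}
    (h : ∀ s, v s ≤ G.reward s (σ s) + G.discount * G.expect s (σ s) v) (s : Fin n) :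
    v s ≤ G.value σ s := by
  have := G.nonpos_of_le_discount_expect (d := fun s => v s - G.value σ s) σ (fun s => by
    rw [expect_sub, mul_sub]
    have h1 := h s
    have h2 := G.value_eq σ s
    linarith) s
  linarith

theorem eq_value (σ : Fin n → Fin m) {v : Fin n → ℝ}
    (h : ∀ s, v s = G.reward s (σ s) + G.discount * G.expect s (σ s) v) (s : Fin n) :
    v s = G.value σ s := by
  refine le_antisymm (G.le_value σ (fun s => (h s).le) s) ?_
  have := G.nonpos_of_le_discount_expect (d := fun s => G.value σ s - v s) σ (fun s => by
    rw [expect_sub, mul_sub]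
    have h1 := h s
    have h2 := G.value_eq σ s
    linarith) s
  linarith

/-! ### The optimal value and the reflected game -/

/-- The value of playing `a` at `s` if the continuation is worth `v`. -/
noncomputable def qvalue (v : Fin n → ℝ) (s : Fin n) (a : Fin m) : ℝ :=
  G.reward s a + G.discount * G.expect s a v

theorem qvalue_mono {v w : Fin n → ℝ} (h : ∀ s, v s ≤ w s) (s : Fin n) (a : Fin m) :
    G.qvalue v s a ≤ G.qvalue w s a := by
  unfold qvalue
  have := mul_le_mul_of_nonneg_left (G.expect_mono s a h) G.discount_pos.le
  linarith

/-- `v` solves the Bellman equation of the game. -/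
structure IsBellman (v : Fin n → ℝ) : Prop where
  le_of_max : ∀ s, G.owner s = Player.max → ∀ a, G.qvalue v s a ≤ v s
  ge_of_min : ∀ s, G.owner s = Player.min → ∀ a, v s ≤ G.qvalue v s a
  exists_eq : ∀ s, ∃ a, v s = G.qvalue v s a

/-- The horizon `1 / (1 - γ)`. -/
noncomputable def horizon : ℝ := (1 - G.discount)⁻¹

theorem one_lt_horizon : 1 < G.horizon := by
  have h1 := G.discount_pos
  have h2 := G.discount_lt_one
  exact (one_lt_inv₀ (by linarith)).2 (by linarith)

theorem horizon_eq : G.horizon = 1 + G.discount * G.horizon := by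
  have h2 := G.discount_lt_one
  have : (1 - G.discount) * G.horizon = 1 := mul_inv_cancel₀ (by linarith)
  linarith

open Classical in
/-- The Bellman operator of the game. -/
noncomputable def bellman [NeZero m] (v : Fin n → ℝ) (s : Fin n) : ℝ :=
  if G.owner s = Player.max then Finset.univ.sup' Finset.univ_nonempty (G.qvalue v s)
  else Finset.univ.inf' Finset.univ_nonempty (G.qvalue v s)

theorem bellman_le_add [NeZero m] {v w : Fin n → ℝ} {c : ℝ} (h : ∀ s, v s ≤ w s + c) (s : Fin n) :
    G.bellman v s ≤ G.bellman w s + G.discount * c := by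
  have hq : ∀ a, G.qvalue v s a ≤ G.qvalue w s a + G.discount * c := fun a => by
    have := mul_le_mul_of_nonneg_left (G.expect_mono s a h) G.discount_pos.le
    rw [expect_add, expect_const, mul_add] at this
    unfold qvalue
    linarith
  unfold bellman
  split_ifs
  · refine Finset.sup'_le _ _ fun a ha => (hq a).trans ?_
    gcongr
    exact Finset.le_sup' (G.qvalue w s) ha
  · rw [← sub_le_iff_le_add]
    refine Finset.le_inf' _ _ fun a ha => ?_
    rw [sub_le_iff_le_add]
    exact (Finset.inf'_le (G.qvalue v s) ha).trans (hq a)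

theorem exists_isBellman (hm : 0 < m) : ∃ v, G.IsBellman v := by
  have : NeZero m := ⟨hm.ne'⟩
  have hc : ContractingWith ⟨G.discount, G.discount_pos.le⟩ (G.bellman) := by
    refine ⟨G.discount_lt_one, LipschitzWith.of_dist_le_mul fun v w => ?_⟩
    have h1 : ∀ v w : Fin n → ℝ, ∀ s, v s ≤ w s + dist v w := fun v w s => by
      have := dist_le_pi_dist v w s
      rw [Real.dist_eq] at this
      linarith [le_abs_self (v s - w s)]
    refine (dist_pi_le_iff (mul_nonneg G.discount_pos.le dist_nonneg)).2 fun s => ?_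
    rw [Real.dist_eq, abs_le]
    have h2 := G.bellman_le_add (h1 v w) s
    have h3 := G.bellman_le_add (h1 w v) s
    rw [dist_comm] at h3
    change -(G.discount * dist v w) ≤ _ ∧ _ ≤ G.discount * dist v w
    constructor <;> linarith
  have hf := hc.fixedPoint_isFixedPt
  set v := ContractingWith.fixedPoint _ hc
  have hv : ∀ s, v s = G.bellman v s := fun s => (congrFun hf s).symm
  refine ⟨v, fun s hs a => ?_, fun s hs a => ?_, fun s => ?_⟩
  · rw [hv s, bellman, if_pos hs]
    exact Finset.le_sup' (G.qvalue v s) (Finset.mem_univ a)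
  · rw [hv s, bellman, if_neg (by simp [hs])]
    exact Finset.inf'_le (G.qvalue v s) (Finset.mem_univ a)
  · rw [hv s, bellman]
    split_ifs
    · obtain ⟨a, -, ha⟩ := Finset.exists_mem_eq_sup' Finset.univ_nonempty (G.qvalue v s)
      exact ⟨a, ha⟩
    · obtain ⟨a, -, ha⟩ := Finset.exists_mem_eq_inf' Finset.univ_nonempty (G.qvalue v s)
      exact ⟨a, ha⟩

/-- The other player. -/
def _root_.Player.other : Player → Player
  | Player.min => Player.max
  | Player.max => Player.min

/-- The game with the roles of the players exchanged and with the rewards `1 - r`. -/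
def reflect : Game n m where
  owner s := (G.owner s).other
  trans := G.trans
  reward s a := 1 - G.reward s a
  reward_mem s a := by
    have := G.reward_mem s a
    exact ⟨by linarith [this.2], by linarith [this.1]⟩
  discount := G.discount
  discount_mem := G.discount_mem

theorem qvalue_reflect (v : Fin n → ℝ) (s : Fin n) (a : Fin m) :
    G.reflect.qvalue (fun x => G.horizon - v x) s a = G.horizon - G.qvalue v s a := by
  have h1 : G.reflect.expect s a (fun x => G.horizon - v x) = G.horizon - G.expect s a v := by
    change G.expect s a (fun x => G.horizon - v x) = _
    rw [expect_sub, expect_const]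
  have h2 := G.horizon_eq
  unfold qvalue
  rw [h1]
  change 1 - G.reward s a + G.discount * _ = _
  linarith

/-- The value under `σ` is reflected at the horizon, as rewards `1` throughout are worth `H`. -/
theorem value_reflect (σ : Fin n → Fin m) (s : Fin n) :
    G.reflect.value σ s = G.horizon - G.value σ s := by
  refine (G.reflect.eq_value σ (v := fun x => G.horizon - G.value σ x) (fun x => ?_) s).symm
  have h := G.qvalue_reflect (G.value σ) x (σ x)
  unfold qvalue at h
  rw [h, ← G.value_eq]

theorem IsBellman.reflect {G : Game n m} {v : Fin n → ℝ} (h : G.IsBellman v) :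
    G.reflect.IsBellman fun s => G.horizon - v s := by
  refine ⟨fun s hs a => ?_, fun s hs a => ?_, fun s => ?_⟩
  · rw [qvalue_reflect]
    have : G.owner s = Player.min := by
      change (G.owner s).other = _ at hs
      cases hG : G.owner s <;> simp_all [Player.other]
    linarith [h.ge_of_min s this a]
  · rw [qvalue_reflect]
    have : G.owner s = Player.max := by
      change (G.owner s).other = _ at hs
      cases hG : G.owner s <;> simp_all [Player.other]
    linarith [h.le_of_max s this a]
  · obtain ⟨a, ha⟩ := h.exists_eq s
    exact ⟨a, by rw [qvalue_reflect, ← ha]⟩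

theorem IsBellman.exists_eq_value {G : Game n m} {v : Fin n → ℝ} (h : G.IsBellman v) :
    ∃ σ : Fin n → Fin m, ∀ s, v s = G.qvalue v s (σ s) :=
  ⟨fun s => (h.exists_eq s).choose, fun s => (h.exists_eq s).choose_spec⟩

theorem IsBellman.nonneg {G : Game n m} {v : Fin n → ℝ} (h : G.IsBellman v) (s : Fin n) :
    0 ≤ v s := by
  obtain ⟨σ, hσ⟩ := h.exists_eq_value
  have := G.nonpos_of_le_discount_expect (d := fun s => (-1) * v s) σ (fun s => by
    rw [expect_mul]
    have h1 := hσ s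
    have h2 := (G.reward_mem s (σ s)).1
    unfold qvalue at h1
    linarith) s
  linarith

theorem IsBellman.le_horizon {G : Game n m} {v : Fin n → ℝ} (h : G.IsBellman v) (s : Fin n) :
    v s ≤ G.horizon := by
  linarith [h.reflect.nonneg s]

/-- `v` is a value that the max-player can guarantee by playing `τ` at his states: it is at most
the one-step lookahead at `v` under `τ`, whatever the min-player does. -/
structure Guarantees (τ : Fin n → Fin m) (v : Fin n → ℝ) : Prop where
  of_max : ∀ s, G.owner s = Player.max → v s ≤ G.qvalue v s (τ s)
  of_min : ∀ s, G.owner s = Player.min → ∀ a, v s ≤ G.qvalue v s a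

theorem Guarantees.le_value {G : Game n m} {τ : Fin n → Fin m} {v : Fin n → ℝ}
    (h : G.Guarantees τ v) {σ : Fin n → Fin m} (hσ : ∀ s, G.owner s = Player.max → σ s = τ s)
    (s : Fin n) : v s ≤ G.value σ s := by
  refine G.le_value σ (fun s => ?_) s
  cases hs : G.owner s with
  | min => exact h.of_min s hs (σ s)
  | max => rw [hσ s hs]; exact h.of_max s hs

theorem Guarantees.le_bellman {G : Game n m} {τ : Fin n → Fin m} {v w : Fin n → ℝ}
    (h : G.Guarantees τ v) (hw : G.IsBellman w) (s : Fin n) : v s ≤ w s := by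
  have key : ∀ s, ∃ a, v s ≤ G.qvalue v s a ∧ G.qvalue w s a ≤ w s := fun s => by
    cases hs : G.owner s with
    | max => exact ⟨τ s, h.of_max s hs, hw.le_of_max s hs _⟩
    | min =>
      obtain ⟨a, ha⟩ := hw.exists_eq s
      exact ⟨a, h.of_min s hs a, ha.ge⟩
  choose σ h1 h2 using key
  have := G.nonpos_of_le_discount_expect (d := fun s => v s - w s) σ (fun s => by
    rw [expect_sub, mul_sub]
    have h1 := h1 s
    have h2 := h2 s
    unfold qvalue at h1 h2
    linarith) s
  linarith

/-- Near-optimal guarantees of both players make up an `ε`-optimal strategy. -/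
theorem isEpsOptimal_of_guarantees {ε : ℝ} {w v v' : Fin n → ℝ} {τ : Fin n → Fin m}
    (h : G.Guarantees τ v) (h' : G.reflect.Guarantees τ v')
    (hv : ∀ s, w s ≤ v s + ε / 2) (hv' : ∀ s, G.horizon - w s ≤ v' s + ε / 2) :
    G.IsEpsOptimal ε (fun s => τ s) (fun s => τ s) := by
  have hmax : ∀ (π : G.MinStrategy) (τ' : G.MaxStrategy) (s : Fin n) (hs : G.owner s = Player.max),
      G.combine π τ' s = τ' ⟨s, hs⟩ := fun π τ' s hs => by
    unfold combine
    split
    · rename_i h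
      rw [hs] at h
      cases h
    · rfl
  have hmin : ∀ (π : G.MinStrategy) (τ' : G.MaxStrategy) (s : Fin n) (hs : G.owner s = Player.min),
      G.combine π τ' s = π ⟨s, hs⟩ := fun π τ' s hs => by
    unfold combine
    split
    · rfl
    · rename_i h
      rw [hs] at h
      cases h
  have low : ∀ (π : G.MinStrategy) s, w s ≤ G.value (G.combine π fun s => τ s) s + ε / 2 :=
    fun π s => by
      have := h.le_value (σ := G.combine π fun s => τ s) (fun s hs => hmax _ _ s hs) s
      linarith [hv s]
  have up : ∀ (τ' : G.MaxStrategy) s, G.value (G.combine (fun s => τ s) τ') s ≤ w s + ε / 2 :=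
    fun τ' s => by
      have := h'.le_value (σ := G.combine (fun s => τ s) τ') (fun s hs => by
        refine hmin _ _ s ?_
        change (G.owner s).other = _ at hs
        cases hG : G.owner s <;> simp_all [Player.other]) s
      rw [value_reflect] at this
      linarith [hv' s]
  exact ⟨fun τ' s => by linarith [low (fun s => τ s) s, up τ' s],
    fun π' s => by linarith [low π' s, up (fun s => τ s) s]⟩

end Game

namespace Game

variable {n m : ℕ} (G : Game n m)

/-! ### One phase of variance-reduced value iteration -/

/-- The mean squared temporal difference of `v` at the state-action pair `(s, a)`. It replaces the
variance of `v` at the next state, which it dominates. -/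
noncomputable def sqDiff (v : Fin n → ℝ) (s : Fin n) (a : Fin m) : ℝ :=
  G.expect s a fun s' => (G.reward s a + G.discount * v s' - v s) ^ 2

/-- The squared temporal differences of the optimal value are dominated by the decrease of the
potential `w²` along the chain. This is the total-variance bound in differential form: it holds for
all actions at which `w` is a subsolution, so that it copes with a min-player whose
action changes over time. -/
theorem IsBellman.sqDiff_le {G : Game n m} {w : Fin n → ℝ} (hw : G.IsBellman w) {s : Fin n}
    {a : Fin m} (ha : w s ≤ G.qvalue w s a) :
    G.sqDiff w s a ≤ G.discount * G.expect s a (fun x => w x ^ 2) - w s ^ 2 + 2 * G.horizon := by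
  have h0 := G.discount_pos
  have h1 := G.discount_lt_one
  have hr := G.reward_mem s a
  set r := G.reward s a
  set g := G.discount
  have e : G.sqDiff w s a = g ^ 2 * G.expect s a (fun x => w x ^ 2)
      + 2 * g * (r - w s) * G.expect s a w + (r - w s) ^ 2 := by
    unfold sqDiff
    rw [← expect_mul, ← expect_mul, ← G.expect_const s a ((r - w s) ^ 2), ← expect_add,
      ← expect_add]
    congr 1
    funext x
    ring
  have hE : 0 ≤ G.expect s a (fun x => w x ^ 2) := G.le_expect _ _ fun x => sq_nonneg _
  have hE1 : 0 ≤ G.expect s a w := G.le_expect _ _ hw.nonneg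
  have hE2 : G.expect s a w ≤ G.horizon := G.expect_le _ _ hw.le_horizon
  have hg : g ^ 2 * G.expect s a (fun x => w x ^ 2) ≤ g * G.expect s a (fun x => w x ^ 2) := by
    refine mul_le_mul_of_nonneg_right ?_ hE
    nlinarith
  have hB := G.horizon_eq
  have hws := hw.nonneg s
  unfold qvalue at ha
  rw [e]
  have h2 : r * (r + g * G.expect s a w) ≤ G.horizon := by
    have h3 : r + g * G.expect s a w ≤ G.horizon := by
      have := mul_le_mul_of_nonneg_left hE2 h0.le
      linarith [hr.2]
    have h4 : 0 ≤ r + g * G.expect s a w := by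
      have := mul_nonneg h0.le hE1
      linarith [hr.1]
    calc _ ≤ 1 * (r + g * G.expect s a w) := mul_le_mul_of_nonneg_right hr.2 h4
      _ ≤ _ := by linarith
  have h5 : w s * w s ≤ w s * (r + g * G.expect s a w) := mul_le_mul_of_nonneg_left ha hws
  nlinarith [sq_nonneg r]

theorem sqDiff_le_of_close {v w : Fin n → ℝ} {u : ℝ} (h1 : ∀ s, v s ≤ w s)
    (h2 : ∀ s, w s ≤ v s + u) (s : Fin n) (a : Fin m) :
    G.sqDiff v s a ≤ 2 * G.sqDiff w s a + 2 * u ^ 2 := by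
  unfold sqDiff
  rw [← expect_mul, ← G.expect_const s a (2 * u ^ 2), ← expect_add]
  refine G.expect_mono s a fun x => ?_
  have h0 := G.discount_pos
  have h3 := G.discount_lt_one
  set A := G.reward s a + G.discount * w x - w s
  set e := G.discount * (w x - v x) - (w s - v s) with he
  have hA : G.reward s a + G.discount * v x - v s = A - e := by simp only [A, e]; ring
  rw [hA]
  have p1 : 0 ≤ G.discount * (w x - v x) := mul_nonneg h0.le (by linarith [h1 x])
  have p2 : G.discount * (w x - v x) ≤ 1 * (w x - v x) :=
    mul_le_mul_of_nonneg_right h3.le (by linarith [h1 x])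
  have hu1 : e ≤ u := by linarith [h2 x, h1 s]
  have hu2 : -u ≤ e := by linarith [h2 s]
  have : e ^ 2 ≤ u ^ 2 := sq_le_sq' hu2 hu1
  nlinarith [sq_nonneg (A + e)]

/-- `(τ', v')` arises from `(τ, v)` by an update step with the estimates `q` of the values of the
state-action pairs: the value never decreases, the max-player takes a maximum and changes his
strategy only where the value increases, and the min-player takes a minimum. -/
structure Improves (q : Fin n → Fin m → ℝ) (τ : Fin n → Fin m) (v : Fin n → ℝ)
    (τ' : Fin n → Fin m) (v' : Fin n → ℝ) : Prop where
  mono : ∀ s, v s ≤ v' s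
  of_max : ∀ s, G.owner s = Player.max → (∀ a, q s a ≤ v' s) ∧
    ((v' s = v s ∧ τ' s = τ s) ∨ v' s = q s (τ' s))
  of_min : ∀ s, G.owner s = Player.min → (v' s = v s ∨ ∀ a, v' s ≤ q s a) ∧
    ((∃ a, q s a ≤ v' s) ∨ G.horizon ≤ v' s)

variable {G}

theorem Guarantees.improve {q : Fin n → Fin m → ℝ} {τ τ' : Fin n → Fin m} {v v' : Fin n → ℝ}
    (h : G.Guarantees τ v) (hq : ∀ s a, q s a ≤ G.qvalue v s a) (hi : G.Improves q τ v τ' v') :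
    G.Guarantees τ' v' := by
  have hm := G.qvalue_mono hi.mono
  refine ⟨fun s hs => ?_, fun s hs a => ?_⟩
  · rcases (hi.of_max s hs).2 with ⟨h1, h2⟩ | h1
    · rw [h1, h2]
      exact (h.of_max s hs).trans (hm _ _)
    · rw [h1]
      exact (hq _ _).trans (hm _ _)
  · rcases (hi.of_min s hs).1 with h1 | h1
    · rw [h1]
      exact (h.of_min s hs a).trans (hm _ _)
    · exact (h1 a).trans ((hq _ _).trans (hm _ _))

/-- One update step contracts the potential `(w - v) + 16 η w²` up to an additive error. -/
theorem Improves.potential_le {q : Fin n → Fin m → ℝ} {τ τ' : Fin n → Fin m}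
    {w v₀ v v' : Fin n → ℝ} {u η e M : ℝ} (hm : 0 < m) (hw : G.IsBellman w) (hη : 0 ≤ η)
    (h1 : ∀ s, v₀ s ≤ w s) (h2 : ∀ s, w s ≤ v₀ s + u)
    (hv : G.Guarantees τ v) (hq : ∀ s a, q s a ≤ G.qvalue v s a)
    (hq' : ∀ s a, G.qvalue v s a ≤ q s a + 8 * η * G.sqDiff v₀ s a + e)
    (hi : G.Improves q τ v τ' v')
    (hM : ∀ s, w s - v s + 16 * η * w s ^ 2 ≤ M) (s : Fin n) :
    w s - v' s + 16 * η * w s ^ 2 ≤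
      G.discount * M + (32 * η * G.horizon + 16 * η * u ^ 2 + e) := by
  have hvw := hv.le_bellman hw
  have key : ∃ a, q s a ≤ v' s ∧ w s ≤ G.qvalue w s a := by
    cases hs : G.owner s with
    | max =>
      obtain ⟨a, ha⟩ := hw.exists_eq s
      exact ⟨a, (hi.of_max s hs).1 a, ha.le⟩
    | min =>
      rcases (hi.of_min s hs).2 with ⟨a, ha⟩ | h
      · exact ⟨a, ha, hw.ge_of_min s hs a⟩
      · refine ⟨⟨0, hm⟩, (hq _ _).trans (le_trans ?_ h), hw.ge_of_min s hs _⟩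
        have h3 : G.expect s ⟨0, hm⟩ v ≤ G.horizon :=
          G.expect_le _ _ fun x => (hvw x).trans (hw.le_horizon x)
        have h4 := mul_le_mul_of_nonneg_left h3 G.discount_pos.le
        have h5 := G.horizon_eq
        have h6 := (G.reward_mem s ⟨0, hm⟩).2
        unfold qvalue
        linarith
  obtain ⟨a, ha, hwa⟩ := key
  have e1 := hw.sqDiff_le hwa
  have e2 := G.sqDiff_le_of_close h1 h2 s a
  have e3 := hq' s a
  have e4 : 8 * η * G.sqDiff v₀ s a ≤ 8 * η *
      (2 * (G.discount * G.expect s a (fun x => w x ^ 2) - w s ^ 2 + 2 * G.horizon) + 2 * u ^ 2) :=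
    mul_le_mul_of_nonneg_left (by linarith) (by linarith)
  have e5 := mul_le_mul_of_nonneg_left (G.expect_le s a hM) G.discount_pos.le
  rw [expect_add, expect_sub, expect_mul] at e5
  unfold qvalue at hwa e3
  -- The penalty `16 η (γ P w² - w² + 2 H)` telescopes against the term `16 η w²` of the potential.
  nlinarith

variable (G)

theorem discount_pow_le {R : ℕ} (hR : 3 * G.horizon ≤ R) : G.discount ^ R ≤ 1 / 16 := by
  have h1 : G.discount ≤ Real.exp (-(1 - G.discount)) := by
    have := Real.add_one_le_exp (-(1 - G.discount))
    linarith
  have h2 : 3 ≤ R * (1 - G.discount) := by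
    have h3 : (0 : ℝ) < 1 - G.discount := by linarith [G.discount_lt_one]
    have := mul_le_mul_of_nonneg_right hR h3.le
    rwa [mul_assoc, horizon, inv_mul_cancel₀ h3.ne', mul_one] at this
  have h4 : (16 : ℝ) ≤ Real.exp 3 := by
    have h5 := Real.exp_one_gt_d9
    have h6 : Real.exp 3 = Real.exp 1 ^ 3 := by rw [← Real.exp_nat_mul]; norm_num
    rw [h6]
    calc (16 : ℝ) ≤ 2.7 ^ 3 := by norm_num
      _ ≤ _ := pow_le_pow_left₀ (by norm_num) (by linarith) 3
  calc G.discount ^ R ≤ Real.exp (-(1 - G.discount)) ^ R :=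
        pow_le_pow_left₀ G.discount_pos.le h1 R
    _ = Real.exp (-(R * (1 - G.discount))) := by rw [← Real.exp_nat_mul]; congr 1; ring
    _ ≤ Real.exp (-3) := Real.exp_le_exp.2 (by linarith)
    _ ≤ 1 / 16 := by
      rw [Real.exp_neg, one_div]
      exact inv_anti₀ (by norm_num) h4

/-- The step size of the exponential moment bounds for accuracy `ε`. With `η = O(ε / H²)` the term
`16 η w²` of the potential is `O(ε)`, and so is the error `32 η H` of an update step, summed over
the horizon. -/
noncomputable def stepSize (ε : ℝ) : ℝ := ε / (1024 * G.horizon ^ 2)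

/-- The error that is admitted in the estimates at the start of a phase. -/
noncomputable def slack₁ (ε : ℝ) : ℝ := ε / (64 * G.horizon)

/-- The error that is admitted in the estimates of the corrections, at scale `u`. -/
noncomputable def slack₂ (u : ℝ) : ℝ := u / (32 * G.horizon)

/-- The error of one update step, at scale `u`. -/
noncomputable def stepError (ε u : ℝ) : ℝ :=
  32 * G.stepSize ε * G.horizon + 16 * G.stepSize ε * u ^ 2
    + (2 * G.slack₁ ε + 2 * G.slack₂ u)

theorem stepSize_nonneg {ε : ℝ} (hε : 0 ≤ ε) : 0 ≤ G.stepSize ε := by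
  unfold stepSize; positivity

theorem stepError_mul_le {ε u : ℝ} (hε : 0 < ε) (hε1 : ε < 1) (hu : ε < 2 * u)
    (huB : u ≤ G.horizon) : G.stepError ε u * G.horizon ≤ 13 / 64 * u := by
  have hB := G.one_lt_horizon
  set B := G.horizon with hBdef
  have hB0 : 0 < B := by linarith
  have e : G.stepError ε u * B = ε / 32 + ε * u * (u / B) / 64 + ε / 32 + u / 16 := by
    unfold stepError stepSize slack₁ slack₂
    rw [← hBdef]
    field_simp
    ring
  have h1 : u / B ≤ 1 := (div_le_one hB0).2 huB
  have hu0 : 0 < u := by linarith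
  have h2 : ε * u * (u / B) ≤ 1 * u * 1 := by gcongr
  rw [e]
  linarith

theorem potential_init_le {ε u : ℝ} {w v : Fin n → ℝ} (hw : G.IsBellman w) (hε : 0 < ε)
    (hu : ε < 2 * u) (h : ∀ s, w s ≤ v s + u) (s : Fin n) :
    w s - v s + 16 * G.stepSize ε * w s ^ 2 ≤ 2 * u := by
  have hB := G.one_lt_horizon
  have hB0 : 0 < G.horizon := by linarith
  have h1 : w s ^ 2 ≤ G.horizon ^ 2 := pow_le_pow_left₀ (hw.nonneg s) (hw.le_horizon s) 2
  have h2 : 16 * G.stepSize ε * w s ^ 2 ≤ 16 * G.stepSize ε * G.horizon ^ 2 :=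
    mul_le_mul_of_nonneg_left h1 (by linarith [G.stepSize_nonneg hε.le])
  have h3 : 16 * G.stepSize ε * G.horizon ^ 2 = ε / 64 := by
    unfold stepSize
    field_simp
    norm_num
  linarith [h s]

theorem potential_final_le {ε u : ℝ} {R : ℕ} (hε : 0 < ε) (hε1 : ε < 1) (hu : ε < 2 * u)
    (huB : u ≤ G.horizon) (hR : 3 * G.horizon ≤ R) :
    G.discount ^ R * (2 * u) + G.stepError ε u * G.horizon ≤ u / 2 := by
  have h1 := G.stepError_mul_le hε hε1 hu huB
  have h2 := mul_le_mul_of_nonneg_right (G.discount_pow_le hR) (by linarith : 0 ≤ 2 * u)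
  linarith

/-- The invariant of the update steps within a phase. -/
structure PhaseInv (w v₀ : Fin n → ℝ) (ε u : ℝ) (i : ℕ) (τ : Fin n → Fin m) (v : Fin n → ℝ) :
    Prop where
  guarantees : G.Guarantees τ v
  mono : ∀ s, v₀ s ≤ v s
  potential : ∀ s, w s - v s + 16 * G.stepSize ε * w s ^ 2 ≤
    G.discount ^ i * (2 * u) + G.stepError ε u * G.horizon

variable {G}

theorem PhaseInv.step {q : Fin n → Fin m → ℝ} {τ τ' : Fin n → Fin m} {w v₀ v v' : Fin n → ℝ}
    {ε u : ℝ} {i : ℕ} (hm : 0 < m) (hw : G.IsBellman w) (hε : 0 ≤ ε)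
    (h1 : ∀ s, v₀ s ≤ w s) (h2 : ∀ s, w s ≤ v₀ s + u)
    (h : G.PhaseInv w v₀ ε u i τ v) (hq : ∀ s a, q s a ≤ G.qvalue v s a)
    (hq' : ∀ s a, G.qvalue v s a ≤ q s a + 8 * G.stepSize ε * G.sqDiff v₀ s a
      + (2 * G.slack₁ ε + 2 * G.slack₂ u))
    (hi : G.Improves q τ v τ' v') : G.PhaseInv w v₀ ε u (i + 1) τ' v' := by
  refine ⟨h.guarantees.improve hq hi, fun s => (h.mono s).trans (hi.mono s), fun s => ?_⟩
  refine (hi.potential_le hm hw (G.stepSize_nonneg hε) h1 h2 h.guarantees hq hq'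
    h.potential s).trans (le_of_eq ?_)
  change _ + G.stepError ε u = _
  have hB := G.horizon_eq
  rw [pow_succ]
  linear_combination (-G.stepError ε u) * hB

theorem PhaseInv.zero {τ : Fin n → Fin m} {w v : Fin n → ℝ} {ε u : ℝ} (hw : G.IsBellman w)
    (hε : 0 < ε) (hε1 : ε < 1) (hu : ε < 2 * u) (h : ∀ s, w s ≤ v s + u)
    (hv : G.Guarantees τ v) : G.PhaseInv w v ε u 0 τ v := by
  refine ⟨hv, fun s => le_rfl, fun s => ?_⟩
  have hB := G.one_lt_horizon
  have hB0 : 0 < G.horizon := by linarith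
  have hu0 : 0 < u := by linarith
  have : 0 ≤ G.stepError ε u * G.horizon := by
    unfold stepError stepSize slack₁ slack₂
    positivity
  linarith [G.potential_init_le hw hε hu h s]

/-- At the end of a phase the distance to the optimal value is halved. -/
theorem PhaseInv.final {τ : Fin n → Fin m} {w v₀ v : Fin n → ℝ} {ε u : ℝ} {R : ℕ}
    (h : G.PhaseInv w v₀ ε u R τ v) (hε : 0 < ε) (hε1 : ε < 1) (hu : ε < 2 * u)
    (huB : u ≤ G.horizon) (hR : 3 * G.horizon ≤ R) (s : Fin n) : w s ≤ v s + u / 2 := by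
  have h1 := h.potential s
  have h2 := G.potential_final_le hε hε1 hu huB hR
  have h3 : 0 ≤ 16 * G.stepSize ε * w s ^ 2 :=
    mul_nonneg (by linarith [G.stepSize_nonneg hε.le]) (sq_nonneg _)
  linarith

end Game

namespace Game

variable {n m : ℕ} (G : Game n m)

/-! ### Exponential moments of a single answer -/

theorem expect_exp_le (s : Fin n) (a : Fin m) {f : Fin n → ℝ} (hf : ∀ x, |f x| ≤ 1) :
    G.expect s a (fun x => Real.exp (f x)) ≤
      1 + G.expect s a f + G.expect s a (fun x => f x ^ 2) := by
  rw [← G.expect_const s a 1, ← expect_add, ← expect_add]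
  refine G.expect_mono s a fun x => ?_
  have := (abs_le.1 (Real.abs_exp_sub_one_sub_id_le (hf x))).2
  linarith

/-- One answer `x` at `(s, a)` gives an estimate `φ x` that is subexponentially
concentrated in the interval `[lo, hi]` at the scale `η`. -/
structure Concentrates (s : Fin n) (a : Fin m) (η lo hi : ℝ) (φ : Fin n → ℝ) : Prop where
  upper : G.expect s a (fun x => Real.exp (η * (φ x - hi))) ≤ 1
  lower : G.expect s a (fun x => Real.exp (η * (lo - φ x))) ≤ 1

theorem expect_sq_sub_le (s : Fin n) (a : Fin m) (X : Fin n → ℝ) (c : ℝ) :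
    G.expect s a (fun x => (X x - G.expect s a X) ^ 2) ≤ G.expect s a fun x => (X x - c) ^ 2 := by
  set μ := G.expect s a X with hμ
  have e : G.expect s a (fun x => (X x - c) ^ 2) = G.expect s a (fun x => (X x - μ) ^ 2)
      + 2 * (μ - c) * (G.expect s a X - μ) + (μ - c) ^ 2 := by
    have h1 : G.expect s a X - μ = G.expect s a (fun x => X x - μ) := by
      rw [expect_sub, expect_const]
    rw [h1, ← expect_mul, ← G.expect_const s a ((μ - c) ^ 2), ← expect_add, ← expect_add]
    congr 1
    funext x
    ring
  rw [e, ← hμ, sub_self, mul_zero]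
  nlinarith [sq_nonneg (μ - c)]

/-- Subtracting a multiple of the squared deviation from any fixed number `c` turns a bounded
variable `X` into a lower estimate of its mean; the price is a multiple of the mean squared
deviation. -/
theorem concentrates_penalized {s : Fin n} {a : Fin m} {X : Fin n → ℝ} {B c η : ℝ}
    (hX : ∀ x, X x ∈ Set.Icc 0 B) (hc : c ∈ Set.Icc 0 B) (hη : 0 < η) (hηB : η * B ≤ 1 / 4) :
    G.Concentrates s a η
      (G.expect s a X - 8 * η * G.expect s a (fun x => (X x - c) ^ 2)) (G.expect s a X)
      (fun x => X x - 4 * η * (X x - c) ^ 2) := by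
  set μ := G.expect s a X with hμ
  set S := G.expect s a (fun x => (X x - c) ^ 2) with hS
  have hμ0 : 0 ≤ μ := G.le_expect _ _ fun x => (hX x).1
  have hμB : μ ≤ B := G.expect_le _ _ fun x => (hX x).2
  have hV := G.expect_sq_sub_le s a X c
  rw [← hμ, ← hS] at hV
  set f : Fin n → ℝ := fun x => η * (X x - μ) - 4 * η ^ 2 * (X x - c) ^ 2 with hf
  have hdev : ∀ x, η ^ 2 * (X x - c) ^ 2 ≤ 1 / 16 := fun x => by
    have h1 : |η * (X x - c)| ≤ 1 / 4 := by
      rw [abs_mul, abs_of_pos hη]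
      refine le_trans (mul_le_mul_of_nonneg_left ?_ hη.le) hηB
      rw [abs_le]
      constructor <;> linarith [(hX x).1, (hX x).2, hc.1, hc.2]
    have h2 := sq_le_sq' (abs_le.1 h1).1 (abs_le.1 h1).2
    rw [mul_pow] at h2
    linarith
  have hf1 : ∀ x, |f x| ≤ 1 := fun x => by
    have h1 : |η * (X x - μ)| ≤ 1 / 4 := by
      rw [abs_mul, abs_of_pos hη]
      refine le_trans (mul_le_mul_of_nonneg_left ?_ hη.le) hηB
      rw [abs_le]
      constructor <;> linarith [(hX x).1, (hX x).2]
    have h2 := hdev x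
    have h3 : 0 ≤ η ^ 2 * (X x - c) ^ 2 := by positivity
    simp only [hf]
    rw [abs_le] at h1 ⊢
    constructor <;> nlinarith [h1.1, h1.2]
  have hEf : G.expect s a f = -(4 * η ^ 2 * S) := by
    simp only [hf]
    rw [expect_sub, expect_mul, expect_mul, expect_sub, expect_const, ← hμ, ← hS]
    ring
  have hEf2 : G.expect s a (fun x => f x ^ 2) ≤ 4 * η ^ 2 * S := by
    have h1 : G.expect s a (fun x => f x ^ 2) ≤
        G.expect s a (fun x => 2 * η ^ 2 * (X x - μ) ^ 2 + 2 * η ^ 2 * (X x - c) ^ 2) := by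
      refine G.expect_mono s a fun x => ?_
      have h2 := hdev x
      have h3 : 0 ≤ η ^ 2 * (X x - c) ^ 2 := by positivity
      have h4 : f x ^ 2 ≤ 2 * (η * (X x - μ)) ^ 2 + 2 * (4 * η ^ 2 * (X x - c) ^ 2) ^ 2 := by
        simp only [hf]
        nlinarith [sq_nonneg (η * (X x - μ) + 4 * η ^ 2 * (X x - c) ^ 2)]
      nlinarith [mul_le_mul_of_nonneg_left h2 h3]
    rw [expect_add, expect_mul, expect_mul, ← hS] at h1
    nlinarith [mul_le_mul_of_nonneg_left hV (sq_nonneg η)]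
  constructor
  · have h1 := G.expect_exp_le s a hf1
    have h2 : (fun x => Real.exp (η * (X x - 4 * η * (X x - c) ^ 2 - μ))) =
        fun x => Real.exp (f x) := by
      funext x
      congr 1
      simp only [hf]
      ring
    rw [h2]
    linarith
  · have h1 := G.expect_exp_le s a (f := fun x => -f x) fun x => by rw [abs_neg]; exact hf1 x
    have h2 : (fun x => Real.exp (η * (μ - 8 * η * S - (X x - 4 * η * (X x - c) ^ 2)))) =
        fun x => Real.exp (-(8 * η ^ 2 * S)) * Real.exp (-f x) := by
      funext x
      rw [← Real.exp_add]
      congr 1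
      simp only [hf]
      ring
    have h3 : G.expect s a (fun x => -f x) = 4 * η ^ 2 * S := by
      have : (fun x => -f x) = fun x => (-1) * f x := by funext x; ring
      rw [this, expect_mul, hEf]
      ring
    simp only [neg_sq] at h1
    rw [h2, expect_mul]
    have h4 : G.expect s a (fun x => Real.exp (-f x)) ≤ Real.exp (8 * η ^ 2 * S) := by
      have := Real.add_one_le_exp (8 * η ^ 2 * S)
      linarith
    calc _ ≤ Real.exp (-(8 * η ^ 2 * S)) * Real.exp (8 * η ^ 2 * S) :=
          mul_le_mul_of_nonneg_left h4 (Real.exp_pos _).le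
      _ = 1 := by rw [← Real.exp_add]; simp

theorem concentrates_bounded {s : Fin n} {a : Fin m} {X : Fin n → ℝ} {u θ : ℝ}
    (hX : ∀ x, X x ∈ Set.Icc 0 u) (hθ : 0 < θ) (hθu : θ * u ≤ 1) :
    G.Concentrates s a θ (G.expect s a X - θ * u ^ 2) (G.expect s a X + θ * u ^ 2) X := by
  set μ := G.expect s a X with hμ
  have hμ0 : 0 ≤ μ := G.le_expect _ _ fun x => (hX x).1
  have hμB : μ ≤ u := G.expect_le _ _ fun x => (hX x).2
  have hdev : ∀ x, |X x - μ| ≤ u := fun x => by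
    rw [abs_le]
    constructor <;> linarith [(hX x).1, (hX x).2]
  have key : ∀ k : ℝ, k ^ 2 = 1 → G.expect s a (fun x => Real.exp (k * (θ * (X x - μ)))) ≤
      Real.exp (θ ^ 2 * u ^ 2) := fun k hk => by
    have hk1 : |k| = 1 := by
      rw [← sq_abs] at hk
      nlinarith [abs_nonneg k]
    have h0 : ∀ x, |k * (θ * (X x - μ))| ≤ θ * u := fun x => by
      rw [abs_mul, hk1, one_mul, abs_mul, abs_of_pos hθ]
      exact mul_le_mul_of_nonneg_left (hdev x) hθ.le
    have h1 := G.expect_exp_le s a (f := fun x => k * (θ * (X x - μ)))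
      fun x => (h0 x).trans hθu
    rw [expect_mul, expect_mul, expect_sub, expect_const, ← hμ, sub_self, mul_zero, mul_zero] at h1
    have h2 : G.expect s a (fun x => (k * (θ * (X x - μ))) ^ 2) ≤ θ ^ 2 * u ^ 2 :=
      G.expect_le _ _ fun x => by
        rw [← mul_pow]
        exact sq_le_sq' (abs_le.1 (h0 x)).1 (abs_le.1 (h0 x)).2
    have h3 := Real.add_one_le_exp (θ ^ 2 * u ^ 2)
    linarith
  have fin : ∀ k : ℝ, k ^ 2 = 1 → G.expect s a
      (fun x => Real.exp (-(θ ^ 2 * u ^ 2)) * Real.exp (k * (θ * (X x - μ)))) ≤ 1 := fun k hk => by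
    rw [expect_mul]
    calc _ ≤ Real.exp (-(θ ^ 2 * u ^ 2)) * Real.exp (θ ^ 2 * u ^ 2) :=
          mul_le_mul_of_nonneg_left (key k hk) (Real.exp_pos _).le
      _ = 1 := by rw [← Real.exp_add]; simp
  constructor
  · convert! fin 1 (by norm_num) using 2
    funext x
    rw [← Real.exp_add]
    congr 1
    ring
  · convert! fin (-1) (by norm_num) using 2
    funext x
    rw [← Real.exp_add]
    congr 1
    ring

/-! ### The law of the answers of the generative model -/

instance : IsProbabilityMeasure G.sampleLaw := by
  unfold sampleLaw; infer_instance

theorem iIndepFun_sampleLaw :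
    iIndepFun (fun (q : ℕ × Fin n × Fin m) (ω : Samples n m) => ω q) G.sampleLaw :=
  iIndepFun_infinitePi (P := fun q : ℕ × Fin n × Fin m => (G.trans q.2.1 q.2.2).toMeasure)
    (X := fun _ x => x) fun _ => measurable_id

theorem map_eval_sampleLaw (q : ℕ × Fin n × Fin m) :
    G.sampleLaw.map (fun ω => ω q) = (G.trans q.2.1 q.2.2).toMeasure :=
  Measure.infinitePi_map_eval _ q

/-- The exponential Chernoff bound for consecutive answers at one state-action pair. -/
theorem sampleLaw_lt_sum_le (s : Fin n) (a : Fin m) {ψ : Fin n → ℝ}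
    (hψ : G.expect s a (fun x => Real.exp (ψ x)) ≤ 1) (t N : ℕ) (L : ℝ) :
    G.sampleLaw {ω | L < ∑ j ∈ Finset.range N, ψ (ω (t + j, s, a))} ≤
      ENNReal.ofReal (Real.exp (-L)) := by
  set X : ℕ → Samples n m → ℝ := fun j ω => ψ (ω (t + j, s, a)) with hX
  have hmeas : ∀ j, Measurable (X j) := fun j =>
    (measurable_of_finite ψ).comp (measurable_pi_apply _)
  have hind : iIndepFun X G.sampleLaw := by
    have h1 := G.iIndepFun_sampleLaw.precomp (g := fun j : ℕ => (t + j, s, a))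
      fun i j h => by simpa using h
    exact h1.comp (fun _ => ψ) fun _ => measurable_of_finite ψ
  have hmgf : ∀ j, mgf (X j) G.sampleLaw 1 ≤ 1 := fun j => by
    have : mgf (X j) G.sampleLaw 1 = G.expect s a (fun x => Real.exp (ψ x)) := by
      unfold mgf
      rw [← integral_trans, ← G.map_eval_sampleLaw (t + j, s, a),
        integral_map (measurable_pi_apply _).aemeasurable
          (measurable_of_finite _).aestronglyMeasurable]
      simp [hX]
    rw [this]
    exact hψ
  have hsum : mgf (∑ j ∈ Finset.range N, X j) G.sampleLaw 1 ≤ 1 := by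
    rw [hind.mgf_sum hmeas]
    exact Finset.prod_le_one (fun _ _ => mgf_nonneg) fun j _ => hmgf j
  have hint : Integrable (fun ω => Real.exp (1 * (∑ j ∈ Finset.range N, X j) ω)) G.sampleLaw := by
    refine integrable_of_forall_abs_le (C := Real.exp (∑ _j ∈ Finset.range N, ∑ x, |ψ x|)) ?_ ?_
    · have : Measurable fun ω => (∑ j ∈ Finset.range N, X j) ω := by
        simp only [Finset.sum_apply]
        exact Finset.measurable_sum _ fun j _ => hmeas j
      fun_prop
    · intro ω
      rw [abs_of_pos (Real.exp_pos _), Real.exp_le_exp, one_mul, Finset.sum_apply]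
      refine Finset.sum_le_sum fun j _ => (le_abs_self _).trans ?_
      exact Finset.single_le_sum (f := fun y => |ψ y|) (fun y _ => abs_nonneg _)
        (Finset.mem_univ (ω (t + j, s, a)))
  have h := measure_ge_le_exp_mul_mgf L zero_le_one hint
  have h2 : G.sampleLaw.real {ω | L ≤ (∑ j ∈ Finset.range N, X j) ω} ≤ Real.exp (-L) := by
    refine h.trans ?_
    calc _ ≤ Real.exp (-1 * L) * 1 := mul_le_mul_of_nonneg_left hsum (Real.exp_pos _).le
      _ = _ := by simp
  calc G.sampleLaw {ω | L < ∑ j ∈ Finset.range N, ψ (ω (t + j, s, a))}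
      ≤ G.sampleLaw {ω | L ≤ (∑ j ∈ Finset.range N, X j) ω} := by
        refine measure_mono fun ω hω => ?_
        simp only [Set.mem_ofPred_eq, Finset.sum_apply] at hω ⊢
        exact hω.le
    _ = ENNReal.ofReal (G.sampleLaw.real {ω | L ≤ (∑ j ∈ Finset.range N, X j) ω}) := by
        rw [measureReal_def, ENNReal.ofReal_toReal (measure_ne_top _ _)]
    _ ≤ _ := ENNReal.ofReal_le_ofReal h2

/-- The mean of `φ` over `N` consecutive answers at `(s, a)`, from the query number `t` on. -/
noncomputable def sampleMean (φ : Fin n → ℝ) (ω : Samples n m) (t N : ℕ) (s : Fin n) (a : Fin m) :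
    ℝ :=
  (∑ j ∈ Finset.range N, φ (ω (t + j, s, a))) / N

theorem sampleLaw_sampleMean_notMem_le {s : Fin n} {a : Fin m} {η lo hi : ℝ} {φ : Fin n → ℝ}
    (h : G.Concentrates s a η lo hi φ) (t : ℕ) {N : ℕ} {L o : ℝ} (hN : 0 < N) (hη : 0 < η)
    (ho : L ≤ o * (η * N)) :
    G.sampleLaw {ω | sampleMean φ ω t N s a ∉ Set.Icc (lo - o) (hi + o)} ≤
      ENNReal.ofReal (2 * Real.exp (-L)) := by
  have hN' : (0 : ℝ) < N := by exact_mod_cast hN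
  have h1 := G.sampleLaw_lt_sum_le s a h.upper t N L
  have h2 := G.sampleLaw_lt_sum_le s a h.lower t N L
  have hsub : {ω : Samples n m | sampleMean φ ω t N s a ∉ Set.Icc (lo - o) (hi + o)} ⊆
      {ω | L < ∑ j ∈ Finset.range N, η * (φ (ω (t + j, s, a)) - hi)} ∪
      {ω | L < ∑ j ∈ Finset.range N, η * (lo - φ (ω (t + j, s, a)))} := by
    intro ω hω
    simp only [Set.mem_ofPred_eq, Set.mem_Icc, not_and_or, not_le, sampleMean] at hω
    rw [div_lt_iff₀ hN', lt_div_iff₀ hN'] at hω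
    simp only [Set.mem_union, Set.mem_ofPred_eq, ← Finset.mul_sum, Finset.sum_sub_distrib,
      Finset.sum_const, Finset.card_range, nsmul_eq_mul]
    rcases hω with hω | hω
    · right
      nlinarith [mul_lt_mul_of_pos_left hω hη]
    · left
      nlinarith [mul_lt_mul_of_pos_left hω hη]
  refine (measure_mono hsub).trans ((measure_union_le _ _).trans ((add_le_add h1 h2).trans ?_))
  rw [← ENNReal.ofReal_add (Real.exp_pos _).le (Real.exp_pos _).le, two_mul]

/-- The union bound over all state-action pairs, each with its own block of answers. -/
theorem sampleLaw_exists_sampleMean_notMem_le {η lo hi : Fin n → Fin m → ℝ} {o L : ℝ}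
    {φ : Fin n → Fin m → Fin n → ℝ}
    (h : ∀ s a, G.Concentrates s a (η s a) (lo s a) (hi s a) (φ s a))
    (t : Fin n → Fin m → ℕ) {N : ℕ} (hN : 0 < N) (hη : ∀ s a, 0 < η s a)
    (ho : ∀ s a, L ≤ o * (η s a * N)) :
    G.sampleLaw {ω | ∃ s a, sampleMean (φ s a) ω (t s a) N s a ∉
        Set.Icc (lo s a - o) (hi s a + o)} ≤
      ENNReal.ofReal (n * m * (2 * Real.exp (-L))) := by
  have : {ω : Samples n m | ∃ s a, sampleMean (φ s a) ω (t s a) N s a ∉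
        Set.Icc (lo s a - o) (hi s a + o)} =
      ⋃ p : Fin n × Fin m, {ω | sampleMean (φ p.1 p.2) ω (t p.1 p.2) N p.1 p.2 ∉
        Set.Icc (lo p.1 p.2 - o) (hi p.1 p.2 + o)} := by
    ext ω
    simp
  rw [this]
  refine (measure_iUnion_fintype_le _ _).trans ?_
  refine (Finset.sum_le_sum fun p _ =>
    G.sampleLaw_sampleMean_notMem_le (h p.1 p.2) (t p.1 p.2) hN (hη _ _) (ho _ _)).trans ?_
  rw [Finset.sum_const, Finset.card_univ, Fintype.card_prod, Fintype.card_fin, Fintype.card_fin,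
    nsmul_eq_mul, ENNReal.ofReal_mul (p := (n : ℝ) * m) (by positivity), ← Nat.cast_mul,
    ENNReal.ofReal_natCast]

/-- `ω` and `ω'` agree on the queries with numbers in `[t, t')`. -/
def AgreeOn (t t' : ℕ) (ω ω' : Samples n m) : Prop :=
  ∀ i, t ≤ i → i < t' → ∀ s a, ω (i, s, a) = ω' (i, s, a)

/-- The queries with numbers in `[t, t')`. -/
def window (n m t t' : ℕ) : Finset (ℕ × Fin n × Fin m) := Finset.Ico t t' ×ˢ Finset.univ

/-- Fresh answers: if `R` reads only the queries with numbers in `[r, t)`, then an event that is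
chosen by `R` and reads only the queries with numbers in `[t, t')` is as unlikely as all events
that may be chosen. Measurability is not needed, as `R` and the events factor through finitely many
answers. -/
theorem sampleLaw_exists_and_mem_le {α : Type*} {r t t' : ℕ} {R : Samples n m → α → Prop}
    (hR : ∀ ω ω' a, AgreeOn r t ω ω' → R ω a → R ω' a)
    (hdet : ∀ ω a b, R ω a → R ω b → a = b) {F : α → Set (Samples n m)}
    (hF : ∀ ω₀ a, R ω₀ a → ∀ ω ω', AgreeOn t t' ω ω' → ω ∈ F a → ω' ∈ F a) {p : ENNReal}
    (hp : ∀ ω a, R ω a → G.sampleLaw (F a) ≤ p) :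
    G.sampleLaw {ω | ∃ a, R ω a ∧ ω ∈ F a} ≤ p := by
  classical
  set S := window n m r t
  set T := window n m t t'
  have hST : Disjoint S T := by
    rw [Finset.disjoint_left]
    intro q h1 h2
    simp only [S, T, window, Finset.mem_product, Finset.mem_Ico] at h1 h2
    omega
  set f : Samples n m → (S → Fin n) := fun ω i => ω i
  set g : Samples n m → (T → Fin n) := fun ω i => ω i
  have hfg : IndepFun f g G.sampleLaw :=
    G.iIndepFun_sampleLaw.indepFun_finset S T hST fun i => measurable_pi_apply i
  have hfm : Measurable f := by fun_prop
  have hagree : ∀ {ω ω' : Samples n m}, f ω = f ω' → AgreeOn r t ω ω' := by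
    intro ω ω' h i h1 h2 s a
    exact congrFun h ⟨(i, s, a), by simp [S, window, h1, h2]⟩
  have hagree' : ∀ {ω ω' : Samples n m}, g ω = g ω' → AgreeOn t t' ω ω' := by
    intro ω ω' h i h1 h2 s a
    exact congrFun h ⟨(i, s, a), by simp [T, window, h1, h2]⟩
  set F' : (S → Fin n) → Set (Samples n m) := fun h =>
    {ω | ∃ ω₀ a, f ω₀ = h ∧ R ω₀ a ∧ ω ∈ F a} with hF'
  have hF'p : ∀ h, G.sampleLaw (F' h) ≤ p := by
    intro h
    by_cases hex : ∃ ω₀ a, f ω₀ = h ∧ R ω₀ a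
    · obtain ⟨ω₀, a, h1, h2⟩ := hex
      refine (measure_mono ?_).trans (hp ω₀ a h2)
      rintro ω ⟨ω₁, b, h3, h4, h5⟩
      rwa [hdet ω₀ a b h2 (hR _ _ _ (hagree (h3.trans h1.symm)) h4)]
    · have : F' h = ∅ := by
        ext ω
        simp only [hF', Set.mem_ofPred_eq, Set.mem_empty_iff_false, iff_false]
        rintro ⟨ω₀, a, h1, h2, -⟩
        exact hex ⟨ω₀, a, h1, h2⟩
      rw [this, measure_empty]
      exact zero_le
  have hF'g : ∀ h, F' h = g ⁻¹' (g '' F' h) := by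
    intro h
    refine Set.Subset.antisymm (Set.subset_preimage_image _ _) ?_
    rintro ω ⟨ω', ⟨ω₀, a, h1, h2, h3⟩, h4⟩
    exact ⟨ω₀, a, h1, h2, hF ω₀ a h2 ω' ω (hagree' h4) h3⟩
  have hinter : ∀ h, G.sampleLaw (f ⁻¹' {h} ∩ F' h) ≤ G.sampleLaw (f ⁻¹' {h}) * p := by
    intro h
    rw [hF'g h, hfg.measure_inter_preimage_eq_mul _ _ (measurableSet_singleton h)
      (Set.toFinite _).measurableSet, ← hF'g h]
    gcongr
    exact hF'p h
  calc G.sampleLaw {ω | ∃ a, R ω a ∧ ω ∈ F a}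
      ≤ G.sampleLaw (⋃ h, f ⁻¹' {h} ∩ F' h) := by
        refine measure_mono ?_
        rintro ω ⟨a, h1, h2⟩
        exact Set.mem_iUnion.2 ⟨f ω, rfl, ω, a, rfl, h1, h2⟩
    _ ≤ ∑ h, G.sampleLaw (f ⁻¹' {h} ∩ F' h) := measure_iUnion_fintype_le _ _
    _ ≤ ∑ h, G.sampleLaw (f ⁻¹' {h}) * p := Finset.sum_le_sum fun h _ => hinter h
    _ = p := by
        rw [← Finset.sum_mul, sum_measure_preimage_singleton _
          fun h _ => hfm (measurableSet_singleton h)]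
        simp

end Game

/-! ### Reasoning about runs of the machine -/

namespace Exec

variable {n m k : ℕ} {I : Input n m} {ω ω' : Game.Samples n m} {c : Cmd k} {st st' : State k}

theorem queries_le (h : Exec I ω c st st') : st.queries ≤ st'.queries := by
  induction h with
  | skip => exact le_rfl
  | setN => exact le_rfl
  | setR => exact le_rfl
  | sample => exact Nat.le_succ _
  | seq _ _ h1 h2 => exact h1.trans h2
  | iteTrue _ _ h => exact h
  | iteFalse _ _ h => exact h
  | loopTrue _ _ _ h1 h2 => exact h1.trans h2
  | loopFalse => exact le_rfl

/-- A run depends only on the answers to the queries that are made in it. -/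
theorem congr_samples (h : Exec I ω c st st')
    (hω : Game.AgreeOn st.queries st'.queries ω ω') : Exec I ω' c st st' := by
  induction h with
  | skip => exact .skip _
  | setN => exact .setN _ _ _ _
  | setR => exact .setR _ _ _ _
  | sample st x i s a hs ha =>
    rw [hω st.queries le_rfl (Nat.lt_succ_self _)]
    exact .sample st x i s a hs ha
  | seq hc hd h1 h2 =>
    exact .seq (h1 fun i hi hi' => hω i hi (hi'.trans_le hd.queries_le))
      (h2 fun i hi hi' => hω i (hc.queries_le.trans hi) hi')
  | iteTrue hb _ h => exact .iteTrue hb (h hω)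
  | iteFalse hb _ h => exact .iteFalse hb (h hω)
  | loopTrue hb hc hd h1 h2 =>
    exact .loopTrue hb (h1 fun i hi hi' => hω i hi (hi'.trans_le hd.queries_le))
      (h2 fun i hi hi' => hω i (hc.queries_le.trans hi) hi')
  | loopFalse hb => exact .loopFalse hb

end Exec

namespace State

variable {k : ℕ}

@[simp] theorem charge_nat (st : State k) (t l : ℕ) : (st.charge t l).nat = st.nat := rfl
@[simp] theorem charge_real (st : State k) (t l : ℕ) : (st.charge t l).real = st.real := rfl
@[simp] theorem charge_queries (st : State k) (t l : ℕ) :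
    (st.charge t l).queries = st.queries := rfl
@[simp] theorem writeN_queries (st : State k) (x : Fin k) (i v : ℕ) :
    (st.writeN x i v).queries = st.queries := rfl
@[simp] theorem writeR_nat (st : State k) (x : Fin k) (i : ℕ) (v : ℝ) :
    (st.writeR x i v).nat = st.nat := rfl
@[simp] theorem query_nat (st : State k) : st.query.nat = st.nat := rfl

theorem writeN_nat (st : State k) (x : Fin k) (i v : ℕ) (y : Fin k) (j : ℕ) :
    (st.writeN x i v).nat y j = if y = x ∧ j = i then v else st.nat y j := by
  by_cases h : y = x
  · subst h
    simp [writeN, Function.update_apply]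
  · simp [writeN, h]

theorem writeR_real (st : State k) (x : Fin k) (i : ℕ) (v : ℝ) (y : Fin k) (j : ℕ) :
    (st.writeR x i v).real y j = if y = x ∧ j = i then v else st.real y j := by
  by_cases h : y = x
  · subst h
    simp [writeR, Function.update_apply]
  · simp [writeR, h]

/-- `st'` has the same memory as `st`, except for the arrays in `N` and `R`. -/
structure SameExcept (N R : Finset (Fin k)) (st st' : State k) : Prop where
  nat : ∀ x ∉ N, st'.nat x = st.nat x
  real : ∀ x ∉ R, st'.real x = st.real x

namespace SameExcept

variable {N N' R R' : Finset (Fin k)} {st st₁ st₂ : State k}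

theorem refl (N R : Finset (Fin k)) (st : State k) : SameExcept N R st st :=
  ⟨fun _ _ => rfl, fun _ _ => rfl⟩

theorem trans (h₁ : SameExcept N R st st₁) (h₂ : SameExcept N' R' st₁ st₂)
    (hN : N' ⊆ N := by decide) (hR : R' ⊆ R := by decide) : SameExcept N R st st₂ :=
  ⟨fun x hx => (h₂.nat x fun h => hx (hN h)).trans (h₁.nat x hx),
    fun x hx => (h₂.real x fun h => hx (hR h)).trans (h₁.real x hx)⟩

theorem charge (h : SameExcept N R st st₁) {t l : ℕ} : SameExcept N R st (st₁.charge t l) :=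
  ⟨h.nat, h.real⟩

theorem writeN (h : SameExcept N R st st₁) {x : Fin k} {i v : ℕ} (hx : x ∈ N := by decide) :
    SameExcept N R st (st₁.writeN x i v) :=
  ⟨fun y hy => by
    rw [← h.nat y hy]
    funext j
    rw [writeN_nat, if_neg]
    rintro ⟨rfl, -⟩
    exact hy hx, h.real⟩

theorem writeR (h : SameExcept N R st st₁) {x : Fin k} {i : ℕ} {v : ℝ} (hx : x ∈ R := by decide) :
    SameExcept N R st (st₁.writeR x i v) :=
  ⟨h.nat, fun y hy => by
    rw [← h.real y hy]
    funext j
    rw [writeR_real, if_neg]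
    rintro ⟨rfl, -⟩
    exact hy hx⟩

end SameExcept

end State

section Runs

variable {n m k : ℕ}

/-- The command `c` halts from the state `st` on the answers `ω`, in time at most `T`, after
exactly `q` queries, without accessing a cell with index `n * m` or more, and in a state with the
property `Q`. -/
def Runs (I : Input n m) (ω : Game.Samples n m) (c : Cmd k) (st : State k) (T q : ℕ)
    (Q : State k → Prop) : Prop :=
  ∃ st', Exec I ω c st st' ∧ st'.time ≤ st.time + T ∧ st'.queries = st.queries + q ∧
    st'.length ≤ max st.length (n * m) ∧ Q st'

variable {I : Input n m} {ω : Game.Samples n m} {c d : Cmd k} {st : State k} {T T' q q' : ℕ}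
  {Q Q' : State k → Prop}

namespace Runs

theorem weaken (h : Runs I ω c st T q Q) (hT : T ≤ T') (hq : q = q') (hQ : ∀ st', Q st' → Q' st') :
    Runs I ω c st T' q' Q' := by
  obtain ⟨st', h1, h2, h3, h4, h5⟩ := h
  exact ⟨st', h1, h2.trans (by omega), hq ▸ h3, h4, hQ _ h5⟩

theorem imp (h : Runs I ω c st T q Q) (hQ : ∀ st', Q st' → Q' st') : Runs I ω c st T q Q' :=
  h.weaken le_rfl rfl hQ

theorem with_queries (h : Runs I ω c st T q Q) :
    Runs I ω c st T q fun st' => st'.queries = st.queries + q ∧ Q st' := by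
  obtain ⟨st', h1, h2, h3, h4, h5⟩ := h
  exact ⟨st', h1, h2, h3, h4, h3, h5⟩

theorem skip (hQ : Q (st.charge 1 0)) : Runs I ω Cmd.skip st 1 0 Q :=
  ⟨_, .skip st, le_rfl, rfl, by simp [State.charge], hQ⟩

theorem setN {x : Fin k} {i e : NExpr k} (hi : i.eval n m st < n * m) (hi' : i.reach n m st ≤ n * m)
    (he : e.reach n m st ≤ n * m)
    (hQ : ∀ t l, Q ((st.charge t l).writeN x (i.eval n m st) (e.eval n m st)))
    (hT : i.cost + e.cost + 1 ≤ T) : Runs I ω (Cmd.setN x i e) st T 0 Q :=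
  ⟨_, .setN st x i e, Nat.add_le_add_left hT _, rfl, by
    simp only [State.charge, State.writeN]
    omega, hQ _ _⟩

theorem setR {x : Fin k} {i : NExpr k} {e : RExpr k} (hi : i.eval n m st < n * m)
    (hi' : i.reach n m st ≤ n * m) (he : e.reach n m st ≤ n * m)
    (hQ : ∀ t l, Q ((st.charge t l).writeR x (i.eval n m st) (e.eval I st)))
    (hT : i.cost + e.cost + 1 ≤ T) : Runs I ω (Cmd.setR x i e) st T 0 Q :=
  ⟨_, .setR st x i e, Nat.add_le_add_left hT _, rfl, by
    simp only [State.charge, State.writeR]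
    omega, hQ _ _⟩

theorem sample {x : Fin k} {i s a : NExpr k} (hi : i.eval n m st < n * m)
    (hi' : i.reach n m st ≤ n * m) (hs' : s.reach n m st ≤ n * m) (ha' : a.reach n m st ≤ n * m)
    (hs : s.eval n m st < n) (ha : a.eval n m st < m)
    (hQ : ∀ t l, Q (((st.charge t l).writeN x (i.eval n m st)
      (ω (st.queries, ⟨s.eval n m st, hs⟩, ⟨a.eval n m st, ha⟩) : ℕ)).query))
    (hT : i.cost + s.cost + a.cost + 1 ≤ T) : Runs I ω (Cmd.sample x i s a) st T 1 Q :=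
  ⟨_, .sample st x i s a hs ha, Nat.add_le_add_left hT _, rfl, by
    simp only [State.charge, State.writeN, State.query]
    omega, hQ _ _⟩

theorem seq (h : Runs I ω c st T q fun st₁ => Runs I ω d st₁ T' q' Q) :
    Runs I ω (Cmd.seq c d) st (T + T') (q + q') Q := by
  obtain ⟨st₁, h1, h2, h3, h4, st₂, h5, h6, h7, h8, h9⟩ := h
  exact ⟨st₂, .seq h1 h5, by omega, by omega, by omega, h9⟩

theorem ite {b : BExpr k} (hb : b.reach n m st ≤ n * m)
    (hc : b.holds I st → ∀ t l, Runs I ω c (st.charge t l) T q Q)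
    (hd : ¬ b.holds I st → ∀ t l, Runs I ω d (st.charge t l) T q Q) :
    Runs I ω (Cmd.ite b c d) st (b.cost + 1 + T) q Q := by
  by_cases h : b.holds I st
  · obtain ⟨st₁, h1, h2, h3, h4, h5⟩ := hc h (b.cost + 1) (b.reach n m st)
    simp only [State.charge] at h2 h3 h4
    exact ⟨st₁, .iteTrue h h1, by omega, h3, by omega, h5⟩
  · obtain ⟨st₁, h1, h2, h3, h4, h5⟩ := hd h (b.cost + 1) (b.reach n m st)
    simp only [State.charge] at h2 h3 h4
    exact ⟨st₁, .iteFalse h h1, by omega, h3, by omega, h5⟩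

/-- A loop that makes `N` rounds, with the invariant `J i` before the round number `i`. -/
theorem loop {b : BExpr k} {N : ℕ} {J : ℕ → State k → Prop}
    (hb : ∀ i st, J i st → b.reach n m st ≤ n * m)
    (hc : ∀ i < N, ∀ st, J i st → b.holds I st ∧ ∀ t l, Runs I ω c (st.charge t l) T q (J (i + 1)))
    (hN : ∀ st, J N st → ¬ b.holds I st) (h0 : J 0 st) :
    Runs I ω (Cmd.loop b c) st (N * (b.cost + 1 + T) + (b.cost + 1)) (N * q)
      fun st' => ∃ st'' t l, J N st'' ∧ st' = st''.charge t l := by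
  have key : ∀ j i, i + j = N → ∀ st, J i st →
      Runs I ω (Cmd.loop b c) st (j * (b.cost + 1 + T) + (b.cost + 1)) (j * q)
        fun st' => ∃ st'' t l, J N st'' ∧ st' = st''.charge t l := by
    intro j
    induction j with
    | zero =>
      intro i hi st hJ
      obtain rfl : i = N := by omega
      have := hb i st hJ
      refine ⟨_, .loopFalse (hN st hJ), ?_, ?_, ?_, st, _, _, hJ, rfl⟩
      · simp [State.charge]
      · simp [State.charge]
      · simp only [State.charge]
        omega
    | succ j ih =>
      intro i hi st hJ
      obtain ⟨h1, h2⟩ := hc i (by omega) st hJ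
      have hr := hb i st hJ
      obtain ⟨st₁, e1, e2, e3, e4, e5⟩ := h2 (b.cost + 1) (b.reach n m st)
      obtain ⟨st₂, f1, f2, f3, f4, f5⟩ := ih (i + 1) (by omega) st₁ e5
      simp only [State.charge] at e2 e3 e4
      refine ⟨st₂, .loopTrue h1 e1 f1, ?_, ?_, by omega, f5⟩
      · rw [Nat.succ_mul]; omega
      · rw [Nat.succ_mul]; omega
  exact key N 0 (by omega) st h0

end Runs

/-! ### Counting loops -/

/-- The variable with the name `x`: the first cell of its array. -/
abbrev NExpr.var (x : Fin k) : NExpr k := .get x (.lit 0)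

/-- The variable with the name `x`: the first cell of its array. -/
abbrev RExpr.var (x : Fin k) : RExpr k := .get x (.lit 0)

/-- The command `x := x + 1`. -/
def Cmd.incr (x : Fin k) : Cmd k := .setN x (.lit 0) (.succ (.var x))

/-- The loop `for (x := 0; b; x := x + 1) c`. -/
def Cmd.count (x : Fin k) (b : BExpr k) (c : Cmd k) : Cmd k :=
  .seq (.setN x (.lit 0) (.lit 0)) (.loop b (.seq c (.incr x)))

theorem Runs.incr {x : Fin k} (hnm : 0 < n * m)
    (hQ : ∀ t l, Q ((st.charge t l).writeN x 0 (st.nat x 0 + 1))) :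
    Runs I ω (Cmd.incr x) st 5 0 Q :=
  Runs.setN hnm (Nat.zero_le _) (by change max 0 1 ≤ n * m; omega) hQ le_rfl

/-- `st'` has the same memory and query counter as `st`, except for the variable `x`. -/
def State.SameBut (x : Fin k) (st st' : State k) : Prop :=
  (∀ y, y ≠ x → st'.nat y = st.nat y) ∧ st'.real = st.real ∧ st'.queries = st.queries

theorem State.SameBut.sameExcept {x : Fin k} {N R : Finset (Fin k)} {st st₁ st₂ : State k}
    (h : st₁.SameBut x st₂) (h₁ : SameExcept N R st st₁) (hx : x ∈ N := by decide) :
    SameExcept N R st st₂ :=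
  ⟨fun y hy => (h.1 y fun e => hy (e ▸ hx)).trans (h₁.nat y hy),
    fun y hy => (congrFun h.2.1 y).trans (h₁.real y hy)⟩

/-- A counting loop that makes `N` rounds, with the invariant `J i` before the round number `i`. The
invariant must not involve the loop variable, so that it survives the increment. -/
theorem Runs.count {x : Fin k} {b : BExpr k} {N : ℕ} {J : ℕ → State k → Prop} (hnm : 0 < n * m)
    (hJ : ∀ i st st', st.SameBut x st' → J i st → J i st')
    (hb : ∀ i st, J i st → st.nat x 0 = i → (b.holds I st ↔ i < N) ∧ b.reach n m st ≤ n * m)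
    (hc : ∀ i < N, ∀ st, J i st → st.nat x 0 = i →
      Runs I ω c st T q fun st' => st'.nat x 0 = i ∧ J (i + 1) st')
    (h0 : J 0 st) :
    Runs I ω (Cmd.count x b c) st (N * (b.cost + 6 + T) + (b.cost + 4)) (N * q)
      fun st' => st'.nat x 0 = N ∧ J N st' := by
  have hcharge : ∀ i (st : State k) t l, J i st → J i (st.charge t l) := fun i st t l h =>
    hJ i st _ ⟨fun _ _ => rfl, rfl, rfl⟩ h
  have hwrite : ∀ i (st : State k) t l v, J i st → J i ((st.charge t l).writeN x 0 v) :=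
    fun i st t l v h => hJ i st _ ⟨fun y hy => by
      funext j; rw [State.writeN_nat, if_neg (fun e => hy e.1)]; rfl, rfl, rfl⟩ h
  have h1 : ∀ t l, Runs I ω (Cmd.loop b (.seq c (.incr x))) ((st.charge t l).writeN x 0 0)
      (N * (b.cost + 1 + (T + 5)) + (b.cost + 1)) (N * (q + 0))
      fun st' => st'.nat x 0 = N ∧ J N st' := fun t l => by
    refine (Runs.loop (J := fun i st => st.nat x 0 = i ∧ J i st) ?_ ?_ ?_ ?_).imp ?_
    · exact fun i st h => (hb i st h.2 h.1).2
    · intro i hi st h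
      refine ⟨(hb i st h.2 h.1).1.2 hi, fun t l => Runs.seq ?_⟩
      refine (hc i hi _ (hcharge i st t l h.2) h.1).imp fun st' h' => Runs.incr hnm fun t l => ?_
      exact ⟨by simp [State.writeN_nat, h'.1], hwrite _ _ _ _ _ h'.2⟩
    · exact fun st h hh => lt_irrefl _ ((hb N st h.2 h.1).1.1 hh)
    · exact ⟨by simp [State.writeN_nat], hwrite _ _ _ _ _ h0⟩
    · rintro st' ⟨st'', t, l, h, rfl⟩
      exact ⟨h.1, hcharge _ _ _ _ h.2⟩
  have h2 : Runs I ω (Cmd.count x b c) st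
      (3 + (N * (b.cost + 1 + (T + 5)) + (b.cost + 1))) (0 + N * (q + 0))
      fun st' => st'.nat x 0 = N ∧ J N st' :=
    Runs.seq (Runs.setN hnm (Nat.zero_le _) (Nat.zero_le _) h1 le_rfl)
  refine h2.weaken (le_of_eq ?_) (by simp) fun _ h => h
  ring

end Runs

/-! ### Runs that succeed with high probability -/

/-- With probability at least `1 - p`, the command `c` halts from the state `st` after exactly `q`
queries and in a state with the property `E`. -/
def Likely {n m k : ℕ} (I : Input n m) (c : Cmd k) (st : State k) (q : ℕ) (p : ENNReal)
    (E : State k → Prop) : Prop :=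
  I.game.sampleLaw {ω | ¬ ∃ st', Exec I ω c st st' ∧ st'.queries = st.queries + q ∧ E st'} ≤ p

namespace Likely

variable {n m k : ℕ} {I : Input n m} {c d : Cmd k} {st : State k} {q q' : ℕ} {p p' : ENNReal}
  {E E' : State k → Prop}

theorem weaken (h : Likely I c st q p E) (hp : p ≤ p') (hE : ∀ st', E st' → E' st') :
    Likely I c st q p' E' := by
  refine (measure_mono ?_).trans (h.trans hp)
  rintro ω hω ⟨st', h1, h2, h3⟩
  exact hω ⟨st', h1, h2, hE _ h3⟩

/-- A command that always halts fails to reach `E` only on the bad answers `B`. -/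
theorem of_runs {T : ℕ} {Q : Game.Samples n m → State k → Prop}
    (h : ∀ ω, Runs I ω c st T q (Q ω)) {B : Set (Game.Samples n m)} (hB : I.game.sampleLaw B ≤ p)
    (hE : ∀ ω ∉ B, ∀ st', Q ω st' → E st') : Likely I c st q p E := by
  refine (measure_mono ?_).trans hB
  intro ω hω
  by_contra hB
  obtain ⟨st', h1, -, h2, -, h3⟩ := h ω
  exact hω ⟨st', h1, h2, hE ω hB st' h3⟩

theorem of_forall_runs {T : ℕ} (h : ∀ ω, Runs I ω c st T q E) : Likely I c st q 0 E :=
  of_runs h (B := ∅) (by simp) fun _ _ _ h => h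

/-- The failure probabilities of consecutive commands add up, because the later one reads
fresh answers. -/
theorem seq (hc : Likely I c st q p E) (hd : ∀ st₁, E st₁ → Likely I d st₁ q' p' E') :
    Likely I (Cmd.seq c d) st (q + q') (p + p') E' := by
  have key := I.game.sampleLaw_exists_and_mem_le (r := st.queries) (t := st.queries + q)
    (t' := st.queries + q + q') (p := p')
    (R := fun ω (st₁ : State k) => Exec I ω c st st₁ ∧ st₁.queries = st.queries + q ∧ E st₁)
    (F := fun st₁ => {ω | ¬ ∃ st', Exec I ω d st₁ st' ∧ st'.queries = st₁.queries + q' ∧ E' st'})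
    (fun ω ω' st₁ h h1 => ⟨h1.1.congr_samples (by rw [h1.2.1]; exact h), h1.2⟩)
    (fun ω a b h1 h2 => h1.1.deterministic h2.1)
    (fun ω₀ st₁ h0 ω ω' h h1 => by
      rintro ⟨st', h2, h3, h4⟩
      refine h1 ⟨st', h2.congr_samples fun i hi hi' s a => (h i ?_ ?_ s a).symm, h3, h4⟩
      · rw [← h0.2.1]; exact hi
      · rw [← h0.2.1, ← h3]; exact hi')
    (fun ω st₁ h => hd st₁ h.2.2)
  refine (measure_mono (t := _ ∪ _) ?_).trans ((measure_union_le _ _).trans (add_le_add hc key))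
  intro ω hω
  by_contra hno
  rw [Set.mem_union, not_or] at hno
  obtain ⟨h1, h2⟩ := hno
  simp only [Set.mem_ofPred_eq, not_not] at h1
  obtain ⟨st₁, e1, e2, e3⟩ := h1
  have h3 : ∃ st', Exec I ω d st₁ st' ∧ st'.queries = st₁.queries + q' ∧ E' st' := by
    by_contra h3
    exact h2 ⟨st₁, ⟨e1, e2, e3⟩, h3⟩
  obtain ⟨st₂, f1, f2, f3⟩ := h3
  exact hω ⟨st₂, .seq e1 f1, by omega, f3⟩

theorem loop {b : BExpr k} {N : ℕ} {J : ℕ → State k → Prop}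
    (hc : ∀ i < N, ∀ st, J i st → b.holds I st ∧ ∀ t l, Likely I c (st.charge t l) q p (J (i + 1)))
    (hN : ∀ st, J N st → ¬ b.holds I st) (h0 : J 0 st) :
    Likely I (Cmd.loop b c) st (N * q) (N * p)
      fun st' => ∃ st'' t l, J N st'' ∧ st' = st''.charge t l := by
  have key : ∀ j i, i + j = N → ∀ st, J i st → Likely I (Cmd.loop b c) st (j * q) (j * p)
      fun st' => ∃ st'' t l, J N st'' ∧ st' = st''.charge t l := by
    intro j
    induction j with
    | zero =>
      intro i hi st hJ
      obtain rfl : i = N := by omega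
      refine (measure_mono_null (t := ∅) ?_ measure_empty).le.trans (by simp)
      intro ω hω
      exact hω ⟨_, .loopFalse (hN st hJ), by simp, st, _, _, hJ, rfl⟩
    | succ j ih =>
      intro i hi st hJ
      obtain ⟨h1, h2⟩ := hc i (by omega) st hJ
      have h3 := (h2 (b.cost + 1) (b.reach n m st)).seq (ih (i + 1) (by omega))
      refine (measure_mono ?_).trans (h3.trans (le_of_eq ?_))
      · rintro ω hω ⟨st', e1, e2, e3⟩
        cases e1 with
        | seq e4 e5 =>
          refine hω ⟨st', .loopTrue h1 e4 e5, ?_, e3⟩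
          rw [e2, State.charge_queries, Nat.succ_mul]
          omega
      · push_cast
        ring
  exact key N 0 (by omega) st h0

theorem count {x : Fin k} {b : BExpr k} {N : ℕ} {J : ℕ → State k → Prop} (hnm : 0 < n * m)
    (hJ : ∀ i st st', st.SameBut x st' → J i st → J i st')
    (hb : ∀ i st, J i st → st.nat x 0 = i → (b.holds I st ↔ i < N))
    (hc : ∀ i < N, ∀ st, J i st → st.nat x 0 = i →
      Likely I c st q p fun st' => st'.nat x 0 = i ∧ J (i + 1) st')
    (h0 : J 0 st) : Likely I (Cmd.count x b c) st (N * q) (N * p) (J N) := by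
  have hcharge : ∀ i (st : State k) t l, J i st → J i (st.charge t l) := fun i st t l h =>
    hJ i st _ ⟨fun _ _ => rfl, rfl, rfl⟩ h
  have hwrite : ∀ i (st : State k) t l v, J i st → J i ((st.charge t l).writeN x 0 v) :=
    fun i st t l v h => hJ i st _ ⟨fun y hy => by
      funext j; rw [State.writeN_nat, if_neg (fun e => hy e.1)]; rfl, rfl, rfl⟩ h
  have h1 : ∀ st, st.nat x 0 = 0 ∧ J 0 st →
      Likely I (Cmd.loop b (.seq c (.incr x))) st (N * (q + 0)) (N * (p + 0)) (J N) :=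
      fun st h => by
    refine (Likely.loop (J := fun i st => st.nat x 0 = i ∧ J i st) ?_ ?_ h).weaken le_rfl ?_
    · intro i hi st h
      refine ⟨(hb i st h.2 h.1).2 hi, fun t l => Likely.seq (hc i hi _ (hcharge i st t l h.2) h.1)
        fun st' h' => of_forall_runs fun ω => Runs.incr hnm fun t l => ?_⟩
      exact ⟨by simp [State.writeN_nat, h'.1], hwrite _ _ _ _ _ h'.2⟩
    · exact fun st h hh => lt_irrefl _ ((hb N st h.2 h.1).1 hh)
    · rintro st' ⟨st'', t, l, h, rfl⟩
      exact hcharge _ _ _ _ h.2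
  have h2 : Likely I (.setN x (.lit 0) (.lit 0)) st 0 0 fun st => st.nat x 0 = 0 ∧ J 0 st :=
    of_forall_runs fun ω => Runs.setN hnm (Nat.zero_le _) (Nat.zero_le _)
      (fun t l => ⟨by simp [State.writeN_nat, NExpr.eval], hwrite _ _ _ _ _ h0⟩) le_rfl
  have h3 := h2.seq h1
  simp only [zero_add, add_zero] at h3
  exact h3

end Likely

/-! ### The program -/

namespace Solver

/-- Variable: the current state. -/
abbrev rS : Fin 8 := 0
/-- Variable: the current action. -/
abbrev rA : Fin 8 := 1
/-- Variable: the number of samples drawn so far at the current state-action pair. -/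
abbrev rJ : Fin 8 := 2
/-- Variable: the address `s * m + a` of the current state-action pair. -/
abbrev rIdx : Fin 8 := 3
/-- Variable: the last answer of the generative model. -/
abbrev rSmp : Fin 8 := 4
/-- Variable: the number of update steps so far in the current phase. -/
abbrev rI : Fin 8 := 5
/-- Array: the strategy. -/
abbrev rOut : Fin 8 := 6
/-- Array: the current lower bound `v` on the optimal value. -/
abbrev rV : Fin 8 := 0
/-- Array: the lower bound `v₀` at the start of the current phase. -/
abbrev rV₀ : Fin 8 := 1
/-- Array: the estimates of the values of the state-action pairs with respect to `v₀`. -/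
abbrev rX : Fin 8 := 2
/-- Array: the estimates of the corrections `γ P (v - v₀)`. -/
abbrev rY : Fin 8 := 3
/-- Variable: an accumulator. -/
abbrev rAcc : Fin 8 := 4
/-- Variable: the best estimate so far among the actions at the current state. -/
abbrev rBest : Fin 8 := 5
/-- Variable: the bound `u` on the distance of `v₀` to the optimal value. -/
abbrev rU : Fin 8 := 6
/-- Variable: the confidence parameter. -/
abbrev rL : Fin 8 := 7

/-- A numerical constant. -/
abbrev num (c : ℕ) : RExpr 8 := .ofNat (.lit c)

/-- The horizon `1 / (1 - γ)`. -/
abbrev horizonE : RExpr 8 := .div (num 1) (.sub (num 1) .discount)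

/-- The number of samples for the estimates at the start of a phase, before rounding up. -/
def bound₁E : RExpr 8 :=
  .div (.mul (.mul (num 65536) (.var rL)) (.mul horizonE (.mul horizonE horizonE)))
    (.mul .eps .eps)

/-- The number of samples for the estimates of a correction, before rounding up. -/
def bound₂E : RExpr 8 := .mul (.mul (num 4096) (.var rL)) (.mul horizonE horizonE)

/-- The number of update steps in a phase, before rounding up. -/
def boundE : RExpr 8 := .mul (num 3) horizonE

/-- The reward in the game (`b = false`) or in the reflected game (`b = true`). -/
def rewardE (b : Bool) (s a : NExpr 8) : RExpr 8 :=
  bif b then .sub (num 1) (.reward s a) else .reward s a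

/-- Whether the maximizing player of the game (`b = false`) or of the reflected game (`b = true`)
controls `s`. For `b = false` the test is meaningful for actual states only. -/
def isMaxE (b : Bool) (s : NExpr 8) : BExpr 8 := bif b then .isMin s else .neg (.isMin s)

/-- The one-step return `r(s, a) + γ v₀(s')` for the sampled state `s'`. -/
def returnE (b : Bool) : RExpr 8 :=
  .add (rewardE b (.var rS) (.var rA)) (.mul .discount (.get rV₀ (.var rSmp)))

/-- The temporal difference `r(s, a) + γ v₀(s') - v₀(s)`. -/
def diffE (b : Bool) : RExpr 8 := .sub (returnE b) (.get rV₀ (.var rS))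

/-- The one-step return, with a penalty for its squared temporal difference. -/
def penalizedE (b : Bool) : RExpr 8 :=
  .sub (returnE b) (.mul (.mul (num 4) (.div .eps (.mul (num 1024) (.mul horizonE horizonE))))
    (.mul (diffE b) (diffE b)))

/-- The correction `γ (v(s') - v₀(s'))` for the sampled state `s'`. -/
def correctionE : RExpr 8 :=
  .mul .discount (.sub (.get rV (.var rSmp)) (.get rV₀ (.var rSmp)))

/-- The lower estimate of the value of the current state-action pair. -/
def qE : RExpr 8 :=
  .sub (.add (.get rX (.var rIdx)) (.get rY (.var rIdx)))
    (.add (.div .eps (.mul (num 64) horizonE)) (.div (.var rU) (.mul (num 32) horizonE)))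

/-- Draw samples at the current state-action pair while their number is below `bound`, and sum up
the values of `e` at them. -/
def draw (e bound : RExpr 8) : Cmd 8 :=
  .count rJ (.ltR (.ofNat (.var rJ)) bound)
    (.seq (.sample rSmp (.lit 0) (.var rS) (.var rA)) (.setR rAcc (.lit 0) (.add (.var rAcc) e)))

/-- Fill the table `x`, indexed by the state-action pairs, with sample means of `e`. -/
def estimate (x : Fin 8) (e bound : RExpr 8) : Cmd 8 :=
  .seq (.setN rIdx (.lit 0) (.lit 0))
    (.count rS (.ltN (.var rS) .numStates)
      (.count rA (.ltN (.var rA) .numActions)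
        (.seq (.setR rAcc (.lit 0) (num 0))
          (.seq (draw e bound)
            (.seq (.setR x (.var rIdx) (.div (.var rAcc) (.ofNat (.var rJ)))) (.incr rIdx))))))

/-- Compute the best estimate among the actions at the current state. At the states of the
maximizing player the current bound `v` competes, and the strategy is changed on the way. -/
def scanRow (b : Bool) : Cmd 8 :=
  .seq (.ite (isMaxE b (.var rS)) (.setR rBest (.lit 0) (.get rV (.var rS)))
      (.setR rBest (.lit 0) horizonE))
    (.count rA (.ltN (.var rA) .numActions)
      (.seq (.ite (isMaxE b (.var rS))
          (.ite (.ltR (.var rBest) qE)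
            (.seq (.setR rBest (.lit 0) qE) (.setN rOut (.var rS) (.var rA))) .skip)
          (.ite (.ltR qE (.var rBest)) (.setR rBest (.lit 0) qE) .skip))
        (.incr rIdx)))

/-- One update step at all states. -/
def update (b : Bool) : Cmd 8 :=
  .seq (.setN rIdx (.lit 0) (.lit 0))
    (.count rS (.ltN (.var rS) .numStates)
      (.seq (scanRow b)
        (.ite (.ltR (.get rV (.var rS)) (.var rBest)) (.setR rV (.var rS) (.var rBest)) .skip)))

/-- Set `x[s] := e` for all states `s`. -/
def fill (x : Fin 8) (e : RExpr 8) : Cmd 8 :=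
  .count rS (.ltN (.var rS) .numStates) (.setR x (.var rS) e)

/-- One phase, which halves `u`. -/
def phase (b : Bool) : Cmd 8 :=
  .seq (fill rV₀ (.get rV (.var rS)))
    (.seq (estimate rX (penalizedE b) bound₁E)
      (.seq (.count rI (.ltR (.ofNat (.var rI)) boundE)
          (.seq (estimate rY correctionE bound₂E) (update b)))
        (.setR rU (.lit 0) (.div (.var rU) (num 2)))))

/-- Compute a strategy of the maximizing player of the game (`b = false`) or of the reflected game
(`b = true`). -/
def side (b : Bool) : Cmd 8 :=
  .seq (.setR rU (.lit 0) horizonE)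
    (.seq (fill rV (num 0)) (.loop (.ltR .eps (.add (.var rU) (.var rU))) (phase b)))

/-- Compute the confidence parameter, by repeated doubling. -/
def calibrate : Cmd 8 :=
  .seq (.setR rAcc (.lit 0) (num 1))
    (.seq (.setR rL (.lit 0) (num 5))
      (.loop (.ltR (.var rAcc) (.div (.mul (.ofNat .numStates) (.ofNat .numActions))
          (.mul (.mul (.sub (num 1) .discount) .eps) .delta)))
        (.seq (.setR rAcc (.lit 0) (.add (.var rAcc) (.var rAcc)))
          (.setR rL (.lit 0) (.add (.var rL) (num 2))))))

/-- The solver. -/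
def program : Program := ⟨8, .seq calibrate (.seq (side false) (side true)), rOut⟩

/-! ### Drawing samples -/

open State

variable {n m : ℕ} {I : Input n m} {ω : Game.Samples n m}

theorem addr_lt {n m s a : ℕ} (hs : s < n) (ha : a < m) : s * m + a < n * m :=
  calc s * m + a < s * m + m := by omega
    _ = (s + 1) * m := by ring
    _ ≤ n * m := Nat.mul_le_mul_right m hs

theorem addr_inj {m s s' a a' : ℕ} (ha : a < m) (ha' : a' < m) (h : s * m + a = s' * m + a') :
    s = s' ∧ a = a' := by
  have h1 : (s * m + a) / m = s := by
    rw [mul_comm, Nat.mul_add_div (by omega), Nat.div_eq_of_lt ha, add_zero]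
  have h2 : (s' * m + a') / m = s' := by
    rw [mul_comm, Nat.mul_add_div (by omega), Nat.div_eq_of_lt ha', add_zero]
  have h3 : s = s' := by rw [← h1, ← h2, h]
  subst h3
  exact ⟨rfl, by omega⟩

theorem lt_addr_bound {n m i : ℕ} (hm : 0 < m) (hi : i < n) : i < n * m :=
  lt_of_lt_of_le hi (Nat.le_mul_of_pos_right n hm)

/-- In the states with the same real arrays as `st₀`, up to the array `x` and the accumulator, the
value of `e` at the state-action pair `(s, a)` and the answer `s'` is `φ s a s'`. -/
def Represents (I : Input n m) (st₀ : State 8) (x : Fin 8) (e : RExpr 8)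
    (φ : Fin n → Fin m → Fin n → ℝ) : Prop :=
  ∀ st : State 8, (∀ y, y ≠ x → y ≠ rAcc → st.real y = st₀.real y) →
    ∀ (s : Fin n) (a : Fin m) (s' : Fin n), st.nat rS 0 = s → st.nat rA 0 = a →
      st.nat rSmp 0 = s' → e.eval I st = φ s a s' ∧ e.reach n m st ≤ n * m

/-- In the states with the same real arrays as `st₀`, up to the array `x` and the accumulator, the
value of `e` is `r`. -/
def Evaluates (I : Input n m) (st₀ : State 8) (x : Fin 8) (e : RExpr 8) (r : ℝ) : Prop :=
  ∀ st : State 8, (∀ y, y ≠ x → y ≠ rAcc → st.real y = st₀.real y) →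
    e.eval I st = r ∧ e.reach n m st ≤ n * m

theorem runs_draw (hnm : 0 < n * m) {st₀ st : State 8} {x : Fin 8} {e bound : RExpr 8}
    {φ : Fin n → Fin m → Fin n → ℝ} {r : ℝ} (he : Represents I st₀ x e φ)
    (hr : Evaluates I st₀ x bound r)
    (hst : ∀ y, y ≠ x → y ≠ rAcc → st.real y = st₀.real y) {s : Fin n} {a : Fin m}
    (hs : st.nat rS 0 = s) (ha : st.nat rA 0 = a) (hacc : st.real rAcc 0 = 0) :
    Runs I ω (draw e bound) st (⌈r⌉₊ * (bound.cost + e.cost + 25) + (bound.cost + 8)) ⌈r⌉₊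
      fun st' => SameExcept {rJ, rSmp} {rAcc} st st' ∧ st'.nat rJ 0 = ⌈r⌉₊ ∧
        st'.real rAcc 0 = ∑ j ∈ Finset.range ⌈r⌉₊, φ s a (ω (st.queries + j, s, a)) := by
  refine (Runs.count (N := ⌈r⌉₊) (q := 1) (T := e.cost + 15) (J := fun i st' =>
    SameExcept {rJ, rSmp} {rAcc} st st' ∧ st'.queries = st.queries + i ∧
      st'.real rAcc 0 = ∑ j ∈ Finset.range i, φ s a (ω (st.queries + j, s, a)))
    hnm ?_ ?_ ?_ ?_).weaken ?_ ?_ ?_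
  · rintro i st₁ st₂ h ⟨h1, h2, h3⟩
    exact ⟨h.sameExcept h1, h.2.2.trans h2, by rw [h.2.1, h3]⟩
  · rintro i st₁ ⟨h1, h2, h3⟩ hi
    have h4 := hr st₁ fun y hy hy' => (h1.real y (by simpa using hy')).trans (hst y hy hy')
    refine ⟨?_, ?_⟩
    · change ((st₁.nat rJ 0 : ℕ) : ℝ) < bound.eval I st₁ ↔ _
      rw [hi, h4.1, Nat.lt_ceil]
    · change max (max 0 1) (bound.reach n m st₁) ≤ n * m
      omega
  · rintro i hi st₁ ⟨h1, h2, h3⟩ hji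
    have hs1 : st₁.nat rS 0 = s := by rw [h1.nat rS (by decide), hs]
    have ha1 : st₁.nat rA 0 = a := by rw [h1.nat rA (by decide), ha]
    refine (Runs.seq (T' := e.cost + 5) (q' := 0) (Runs.sample hnm (Nat.zero_le _) ?_ ?_
      (by change st₁.nat rS 0 < n; rw [hs1]; exact s.2)
      (by change st₁.nat rA 0 < m; rw [ha1]; exact a.2) (fun t l => ?_) le_rfl)).weaken
      (T := 6 + (e.cost + 5)) (q := 1) (by omega) rfl fun _ h => h
    · change max 0 1 ≤ n * m
      omega
    · change max 0 1 ≤ n * m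
      omega
    · set x' := ω (st₁.queries, s, a) with hx'
      have hω : ω (st₁.queries, ⟨NExpr.eval n m st₁ (.var rS),
          by change st₁.nat rS 0 < n; rw [hs1]; exact s.2⟩, ⟨NExpr.eval n m st₁ (.var rA),
          by change st₁.nat rA 0 < m; rw [ha1]; exact a.2⟩) = x' := by
        have e1 : (⟨NExpr.eval n m st₁ (.var rS),
          by change st₁.nat rS 0 < n; rw [hs1]; exact s.2⟩ : Fin n) = s := Fin.ext hs1
        have e2 : (⟨NExpr.eval n m st₁ (.var rA),
          by change st₁.nat rA 0 < m; rw [ha1]; exact a.2⟩ : Fin m) = a := Fin.ext ha1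
        rw [e1, e2]
      rw [hω]
      set st₂ := ((st₁.charge t l).writeN rSmp (NExpr.eval n m st₁ (.lit 0)) x').query with hst₂
      have hJ2 : ∀ y i, y ≠ rSmp → st₂.nat y i = st₁.nat y i := fun y i hy => by
        simp only [hst₂, query_nat, writeN_nat]
        rw [if_neg (fun h => hy h.1)]
        rfl
      have hs2 : st₂.nat rS 0 = s := by rw [hJ2 _ _ (by decide), hs1]
      have ha2 : st₂.nat rA 0 = a := by rw [hJ2 _ _ (by decide), ha1]
      have hx2 : st₂.nat rSmp 0 = x' := by simp [hst₂, writeN_nat, NExpr.eval]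
      have hr2 : st₂.real = st₁.real := rfl
      have he2 := he st₂ (fun y hy hy' => by
        rw [hr2, h1.real y (by simpa using hy'), hst y hy hy']) s a x' hs2 ha2 hx2
      have hframe : SameExcept {rJ, rSmp} {rAcc} st st₂ := by
        have : SameExcept {rJ, rSmp} {rAcc} st (st₁.charge t l) := ⟨h1.nat, h1.real⟩
        have h5 := this.writeN (x := rSmp) (i := NExpr.eval n m st₁ (.lit 0)) (v := x')
        exact ⟨h5.nat, h5.real⟩
      refine Runs.setR hnm (Nat.zero_le _) ?_ (fun t' l' => ⟨?_, ?_, ?_, ?_⟩) ?_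
      · change max (max 0 1) (e.reach n m st₂) ≤ n * m
        omega
      · rw [writeR_nat, charge_nat, hJ2 _ _ (by decide), hji]
      · have : SameExcept {rJ, rSmp} {rAcc} st (st₂.charge t' l') := ⟨hframe.nat, hframe.real⟩
        exact this.writeR
      · change st₁.queries + 1 = _
        rw [h2, add_assoc]
      · rw [writeR_real, if_pos ⟨rfl, rfl⟩, Finset.sum_range_succ, ← h3, ← h2]
        change st₁.real rAcc 0 + e.eval I st₂ = _
        rw [he2.1]
      · change 1 + (2 + e.cost + 1) + 1 ≤ _
        omega
  · exact ⟨SameExcept.refl _ _ _, rfl, by simp [hacc]⟩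
  · refine le_of_eq ?_
    change ⌈r⌉₊ * ((2 + 1 + bound.cost + 1) + 6 + (e.cost + 15)) +
      ((2 + 1 + bound.cost + 1) + 4) = _
    ring
  · simp
  · rintro st' ⟨h1, h2, -, h3⟩
    exact ⟨h2, h1, h3⟩

end Solver

namespace Solver

open State

variable {n m : ℕ} {I : Input n m} {ω : Game.Samples n m}

/-- The entries of the table are means over disjoint blocks of consecutive answers, and the time is
proportional to the number of queries. -/
theorem runs_estimate (hn : 0 < n) (hm : 0 < m) {st₀ : State 8} {x : Fin 8} (hx : x ≠ rAcc)
    {e bound : RExpr 8} {φ : Fin n → Fin m → Fin n → ℝ} {r : ℝ} (he : Represents I st₀ x e φ)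
    (hr : Evaluates I st₀ x bound r) (hr0 : 0 < ⌈r⌉₊) :
    Runs I ω (estimate x e bound) st₀ (n * m * ⌈r⌉₊ * (2 * bound.cost + e.cost + 100))
      (n * m * ⌈r⌉₊)
      fun st' => SameExcept {rS, rA, rJ, rIdx, rSmp} {x, rAcc} st₀ st' ∧ ∀ (s : Fin n) (a : Fin m),
        st'.real x (s * m + a) =
          Game.sampleMean (φ s a) ω (st₀.queries + (s * m + a) * ⌈r⌉₊) ⌈r⌉₊ s a := by
  have hnm : 0 < n * m := Nat.mul_pos hn hm
  set N := ⌈r⌉₊ with hN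
  set Ta := 4 + (N * (bound.cost + e.cost + 25) + (bound.cost + 8) + (9 + 5)) with hTa
  set Ts := m * (4 + 6 + Ta) + (4 + 4) with hTs
  have hx' : ∀ y : Fin 8, y ∉ ({x, rAcc} : Finset (Fin 8)) ↔ y ≠ x ∧ y ≠ rAcc := by
    intro y; simp
  -- The address counter `p` of the current pair is also the number of completed table entries.
  set J : ℕ → State 8 → Prop := fun p st => SameExcept {rS, rA, rJ, rIdx, rSmp} {x, rAcc} st₀ st ∧
    st.nat rIdx 0 = p ∧ st.queries = st₀.queries + p * N ∧ ∀ (s : Fin n) (a : Fin m),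
      s * m + a < p → st.real x (s * m + a) =
        Game.sampleMean (φ s a) ω (st₀.queries + (s * m + a) * N) N s a with hJ
  have hJbut : ∀ y ∈ ({rS, rA} : Finset (Fin 8)), ∀ p st st', st.SameBut y st' → J p st →
      J p st' := by
    rintro y hy p st st' h ⟨h1, h2, h3, h4⟩
    simp only [Finset.mem_insert, Finset.mem_singleton] at hy
    refine ⟨h.sameExcept h1 (by rcases hy with rfl | rfl <;> decide), ?_, h.2.2.trans h3, ?_⟩
    · rw [h.1 rIdx (by rcases hy with rfl | rfl <;> decide), h2]
    · rw [h.2.1]; exact h4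
  have hpair : ∀ (i : Fin n) (j : Fin m) (st : State 8), J (i * m + j) st → st.nat rS 0 = i →
      st.nat rA 0 = j → Runs I ω (.seq (.setR rAcc (.lit 0) (num 0)) (.seq (draw e bound)
        (.seq (.setR x (.var rIdx) (.div (.var rAcc) (.ofNat (.var rJ)))) (.incr rIdx)))) st Ta N
        fun st' => st'.nat rA 0 = j ∧ st'.nat rS 0 = i ∧ J (i * m + j + 1) st' := by
    rintro i j st ⟨h1, h2, h3, h4⟩ hi hj
    have hlt := addr_lt i.2 j.2
    refine (Runs.seq (T' := N * (bound.cost + e.cost + 25) + (bound.cost + 8) + (9 + 5))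
      (q := 0) (q' := N + (0 + 0)) (Runs.setR hnm (Nat.zero_le _) (Nat.zero_le _) (fun t l =>
        Runs.seq ?_) le_rfl)).weaken (le_of_eq rfl) (by omega) fun _ h => h
    set st₁ := (st.charge t l).writeR rAcc (NExpr.eval n m st (.lit 0)) (RExpr.eval I st (num 0))
    have hr1 : ∀ y i, y ≠ rAcc → st₁.real y i = st.real y i := fun y i hy => by
      rw [writeR_real, if_neg (fun h => hy h.1)]
      rfl
    refine (runs_draw (st := st₁) hnm he hr (fun y hy hy' => ?_) (s := i) (a := j) hi hj
      ?_).with_queries.imp ?_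
    · funext i
      rw [hr1 y i hy', h1.real y ((hx' y).2 ⟨hy, hy'⟩)]
    · rw [writeR_real, if_pos ⟨rfl, rfl⟩]
      exact Nat.cast_zero
    rintro st₂ ⟨k0, k1, k2, k3⟩
    have hq2 : st₁.queries = st.queries := rfl
    have hidx : st₂.nat rIdx 0 = i * m + j := by rw [k1.nat rIdx (by decide)]; exact h2
    have hframe : SameExcept {rS, rA, rJ, rIdx, rSmp} {x, rAcc} st₀ st₂ := by
      have h5 : SameExcept {rS, rA, rJ, rIdx, rSmp} {x, rAcc} st₀ (st.charge t l) :=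
        ⟨h1.nat, h1.real⟩
      exact (h5.writeR (by simp)).trans k1 (by decide) (by simp)
    have hx2 : ∀ p, st₂.real x p = st.real x p := fun p => by
      rw [k1.real x (by simpa using hx), hr1 _ _ hx]
    refine Runs.seq (Runs.setR (T := 9) (by change st₂.nat rIdx 0 < _; rw [hidx]; exact hlt)
      (by change max 0 1 ≤ n * m; omega) (by change max (max 0 1) (max 0 1) ≤ n * m; omega)
      (fun t' l' => Runs.incr hnm fun t'' l'' => ?_) le_rfl)
    set st₃ := (st₂.charge t' l').writeR x (NExpr.eval n m st₂ (.var rIdx))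
      (RExpr.eval I st₂ (.div (.var rAcc) (.ofNat (.var rJ)))) with hst₃
    have hn3 : st₃.nat = st₂.nat := rfl
    have hnat : ∀ y i, y ≠ rIdx → ((st₃.charge t'' l'').writeN rIdx 0 (st₃.nat rIdx 0 + 1)).nat y i
        = st₂.nat y i := fun y i hy => by
      rw [writeN_nat, if_neg (fun h => hy h.1)]
      rfl
    refine ⟨?_, ?_, ?_, ?_, ?_, ?_⟩
    · rw [hnat _ _ (by decide), k1.nat rA (by decide)]
      exact hj
    · rw [hnat _ _ (by decide), k1.nat rS (by decide)]
      exact hi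
    · have h5 : SameExcept {rS, rA, rJ, rIdx, rSmp} {x, rAcc} st₀ (st₂.charge t' l') :=
        ⟨hframe.nat, hframe.real⟩
      have h6 : SameExcept {rS, rA, rJ, rIdx, rSmp} {x, rAcc} st₀ st₃ := h5.writeR (by simp)
      have h7 : SameExcept {rS, rA, rJ, rIdx, rSmp} {x, rAcc} st₀ (st₃.charge t'' l'') :=
        ⟨h6.nat, h6.real⟩
      exact h7.writeN
    · rw [writeN_nat, if_pos ⟨rfl, rfl⟩, hn3, hidx]
    · change st₂.queries = _
      rw [k0, hq2, h3, Nat.succ_mul]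
      omega
    · intro s a hsa
      change st₃.real x _ = _
      rw [hst₃, writeR_real]
      change (if x = x ∧ (s * m + a : ℕ) = st₂.nat rIdx 0 then
        st₂.real rAcc 0 / ((st₂.nat rJ 0 : ℕ) : ℝ) else st₂.real x _) = _
      rw [hidx]
      rcases Nat.lt_succ_iff_lt_or_eq.1 hsa with hlt | heq
      · rw [if_neg (fun h => by omega), hx2, h4 s a hlt]
      · obtain ⟨e1, e2⟩ := addr_inj a.2 j.2 heq
        obtain rfl := Fin.ext e1
        obtain rfl := Fin.ext e2
        rw [if_pos ⟨rfl, rfl⟩, k2, k3, hq2, h3]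
        rfl
  have hrow : ∀ (i : Fin n) (st : State 8), J (i * m) st → st.nat rS 0 = i →
      Runs I ω (.count rA (.ltN (.var rA) .numActions) (.seq (.setR rAcc (.lit 0) (num 0))
        (.seq (draw e bound) (.seq (.setR x (.var rIdx) (.div (.var rAcc) (.ofNat (.var rJ))))
          (.incr rIdx))))) st Ts (m * N)
        fun st' => st'.nat rS 0 = i ∧ J ((i + 1) * m) st' := by
    intro i st h1 hi
    refine (Runs.count (N := m) (T := Ta) (q := N)
      (J := fun j st => st.nat rS 0 = i ∧ J (i * m + j) st) hnm ?_ ?_ ?_ ⟨hi, h1⟩).weaken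
      (le_of_eq rfl) rfl ?_
    · rintro j st st' h ⟨h1, h2⟩
      exact ⟨by rw [h.1 rS (by decide), h1], hJbut rA (by decide) _ _ _ h h2⟩
    · rintro j st - hj
      refine ⟨?_, by change max (max 0 1) 0 ≤ n * m; omega⟩
      change st.nat rA 0 < m ↔ j < m
      rw [hj]
    · rintro j hj st ⟨h1, h2⟩ hja
      exact (hpair i ⟨j, hj⟩ st h2 h1 hja).imp fun _ h => h
    · rintro st' ⟨-, h2, h3⟩
      exact ⟨h2, by rw [Nat.succ_mul]; exact h3⟩
  have hall : Runs I ω (estimate x e bound) st₀ (3 + (n * (4 + 6 + Ts) + (4 + 4)))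
      (0 + n * (m * N)) fun st' => st'.nat rS 0 = n ∧ J (n * m) st' := by
    refine Runs.seq (Runs.setN hnm (Nat.zero_le _) (Nat.zero_le _) (fun t l => ?_) le_rfl)
    refine Runs.count (N := n) (T := Ts) (q := m * N) (J := fun i st => J (i * m) st) hnm
      (fun i st st' h h1 => hJbut rS (by decide) _ _ _ h h1) ?_ ?_ ?_
    · rintro i st - hi
      refine ⟨?_, by change max (max 0 1) 0 ≤ n * m; omega⟩
      change st.nat rS 0 < n ↔ i < n
      rw [hi]
    · rintro i hi st h1 hi'
      exact hrow ⟨i, hi⟩ st h1 hi'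
    · refine ⟨?_, ?_, ?_, fun s a h => absurd h (by simp)⟩
      · have : SameExcept {rS, rA, rJ, rIdx, rSmp} {x, rAcc} st₀ (st₀.charge t l) :=
          ⟨fun _ _ => rfl, fun _ _ => rfl⟩
        exact this.writeN
      · simp [writeN_nat, NExpr.eval]
      · simp
  refine hall.weaken ?_ (by ring) ?_
  · have h1 : 1 ≤ N := hr0
    have h2 : 1 ≤ m * N := Nat.mul_pos hm h1
    have h3 : 1 ≤ n * (m * N) := Nat.mul_pos hn h2
    have h4 : n ≤ n * (m * N) := Nat.le_mul_of_pos_right n h2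
    have h5 : n * m ≤ n * (m * N) := Nat.mul_le_mul_left n (Nat.le_mul_of_pos_right m h1)
    have h6 : n * m * (bound.cost) ≤ n * (m * N) * bound.cost := Nat.mul_le_mul_right _ h5
    have e1 : 3 + (n * (4 + 6 + Ts) + (4 + 4)) = 11 + 18 * n + 36 * (n * m)
        + n * m * bound.cost + n * (m * N) * (bound.cost + e.cost + 25) := by
      simp only [hTs, hTa]
      ring
    rw [e1]
    nlinarith
  · rintro st' ⟨-, h1, -, -, h2⟩
    exact ⟨h1, fun s a => h2 s a (addr_lt s.2 a.2)⟩

end Solver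

namespace Solver

open State

variable {n m : ℕ} {I : Input n m} {ω : Game.Samples n m}

/-! ### Deterministic parts of the program -/

/-- The game that is played from the point of view of the player whose strategy is computed. -/
noncomputable def sideGame (b : Bool) (G : Game n m) : Game n m := bif b then G.reflect else G

@[simp] theorem sideGame_discount (b : Bool) (G : Game n m) :
    (sideGame b G).discount = G.discount := by cases b <;> rfl

@[simp] theorem sideGame_horizon (b : Bool) (G : Game n m) :
    (sideGame b G).horizon = G.horizon := by cases b <;> rfl

@[simp] theorem sideGame_expect (b : Bool) (G : Game n m) :
    (sideGame b G).expect = G.expect := by cases b <;> rfl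

@[simp] theorem sideGame_sampleLaw (b : Bool) (G : Game n m) :
    (sideGame b G).sampleLaw = G.sampleLaw := by cases b <;> rfl

theorem horizonE_eval (st : State 8) : horizonE.eval I st = I.game.horizon := by
  simp [RExpr.eval, NExpr.eval, Game.horizon]

theorem rewardE_eval (b : Bool) {st : State 8} {s : Fin n} {a : Fin m} (hs : st.nat rS 0 = s)
    (ha : st.nat rA 0 = a) :
    (rewardE b (.var rS) (.var rA)).eval I st = (sideGame b I.game).reward s a := by
  have h : (RExpr.reward (.var rS) (.var rA)).eval I st = I.game.reward s a := by
    simp only [RExpr.eval, NExpr.eval, hs, ha, s.2, a.2, and_self, dif_pos]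
  cases b
  · exact h
  · change ((1 : ℕ) : ℝ) - (RExpr.reward (.var rS) (.var rA)).eval I st = 1 - I.game.reward s a
    rw [h, Nat.cast_one]

theorem rewardE_reach (b : Bool) (st : State 8) :
    (rewardE b (.var rS) (.var rA)).reach n m st ≤ 1 := by
  cases b <;> simp [rewardE, RExpr.reach, NExpr.reach, NExpr.eval]

theorem isMaxE_holds (b : Bool) {st : State 8} {s : Fin n} (hs : st.nat rS 0 = s) :
    (isMaxE b (.var rS)).holds I st ↔ (sideGame b I.game).owner s = Player.max := by
  have h : (BExpr.isMin (.var rS)).holds I st ↔ I.game.owner s = Player.min := by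
    simp only [BExpr.holds, NExpr.eval, hs]
    exact ⟨fun h => h.2, fun h => ⟨s.2, h⟩⟩
  cases b
  · change ¬ _ ↔ I.game.owner s = Player.max
    rw [h]
    cases I.game.owner s <;> simp
  · change (BExpr.isMin (.var rS)).holds I st ↔ (I.game.owner s).other = Player.max
    rw [h]
    cases I.game.owner s <;> simp [Player.other]

theorem isMaxE_cost (b : Bool) : (isMaxE b (.var rS)).cost ≤ 4 := by
  cases b <;> decide

theorem isMaxE_reach (b : Bool) (st : State 8) : (isMaxE b (.var rS)).reach n m st ≤ 1 := by
  cases b <;> simp [isMaxE, BExpr.reach, NExpr.reach, NExpr.eval]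

theorem runs_fill (hn : 0 < n) (hm : 0 < m) {st₀ : State 8} {x : Fin 8} {e : RExpr 8}
    {f : Fin n → ℝ} (he : ∀ (st : State 8) (s : Fin n), (∀ y, y ≠ x → st.real y = st₀.real y) →
      st.nat rS 0 = s → e.eval I st = f s ∧ e.reach n m st ≤ n * m) :
    Runs I ω (fill x e) st₀ (n * m * (e.cost + 30)) 0
      fun st' => SameExcept {rS} {x} st₀ st' ∧ ∀ s : Fin n, st'.real x s = f s := by
  have hnm : 0 < n * m := Nat.mul_pos hn hm
  refine (Runs.count (N := n) (q := 0) (T := e.cost + 3)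
    (J := fun i st => SameExcept {rS} {x} st₀ st ∧ ∀ s : Fin n, s < i → st.real x s = f s)
    hnm ?_ ?_ ?_ ?_).weaken ?_ (by simp) ?_
  · rintro i st st' h ⟨h1, h2⟩
    exact ⟨h.sameExcept h1, by rw [h.2.1]; exact h2⟩
  · rintro i st - hi
    refine ⟨?_, by change max (max 0 1) 0 ≤ n * m; omega⟩
    change st.nat rS 0 < n ↔ i < n
    rw [hi]
  · rintro i hi st ⟨h1, h2⟩ hs
    obtain ⟨e1, e2⟩ := he st ⟨i, hi⟩ (fun y hy => h1.real y (by simpa using hy)) hs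
    refine Runs.setR ?_ (by change max 0 1 ≤ n * m; omega) e2 (fun t l => ⟨hs, ?_, ?_⟩)
      (by change 2 + e.cost + 1 ≤ _; omega)
    · change st.nat rS 0 < n * m
      rw [hs]
      exact lt_addr_bound hm hi
    · have : SameExcept {rS} {x} st₀ (st.charge t l) := ⟨h1.nat, h1.real⟩
      exact this.writeR (by simp)
    · intro s hsi
      rw [writeR_real]
      change (if x = x ∧ (s : ℕ) = st.nat rS 0 then e.eval I st else st.real x s) = _
      rw [hs]
      rcases Nat.lt_succ_iff_lt_or_eq.1 hsi with hlt | heq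
      · rw [if_neg (fun h => by omega), h2 s hlt]
      · obtain rfl : s = ⟨i, hi⟩ := Fin.ext heq
        rw [if_pos ⟨rfl, rfl⟩, e1]
  · exact ⟨SameExcept.refl _ _ _, fun s h => absurd h (by simp)⟩
  · change n * (4 + 6 + (e.cost + 3)) + (4 + 4) ≤ _
    have h1 : n ≤ n * m := Nat.le_mul_of_pos_right n hm
    have h2 : n * e.cost ≤ n * m * e.cost := Nat.mul_le_mul_right _ h1
    nlinarith
  · rintro st' ⟨-, h1, h2⟩
    exact ⟨h1, fun s => h2 s s.2⟩

/-- The lower estimate of the value of the state-action pair with the address `p`. -/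
noncomputable def qAt (I : Input n m) (st : State 8) (p : ℕ) : ℝ :=
  st.real rX p + st.real rY p - (I.game.slack₁ I.eps + I.game.slack₂ (st.real rU 0))

theorem qE_eval {st : State 8} {p : ℕ} (hp : st.nat rIdx 0 = p) :
    qE.eval I st = qAt I st p := by
  subst hp
  have h := horizonE_eval (I := I) st
  simp only [qE, RExpr.eval, NExpr.eval, qAt, Game.slack₁, Game.slack₂] at h ⊢
  rw [h]
  push_cast
  rfl

theorem qE_reach {st : State 8} {p : ℕ} (hp : st.nat rIdx 0 = p) (hpn : p < n * m) :
    qE.reach n m st ≤ n * m := by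
  simp only [qE, RExpr.reach, NExpr.reach, NExpr.eval, hp]
  omega

theorem qAt_congr {N R : Finset (Fin 8)} {st st' : State 8} (h : SameExcept N R st st')
    (hX : rX ∉ R) (hY : rY ∉ R) (hU : rU ∉ R) : qAt I st' = qAt I st := by
  funext p
  rw [qAt, qAt, h.real _ hX, h.real _ hY, h.real _ hU]

/-- The outcome of the comparison of the estimates `q` of the first `j` actions at the state `s`,
where `v` is the current bound, `H` is the horizon, and `o` is the old action. -/
def RowInv (isMax : Prop) (q : ℕ → ℝ) (v H : ℝ) (o : ℕ) (j : ℕ) (best : ℝ) (o' : ℕ) : Prop :=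
  (isMax → v ≤ best ∧ (∀ a < j, q a ≤ best) ∧
    ((best = v ∧ o' = o) ∨ ∃ a < j, o' = a ∧ best = q a)) ∧
  (¬ isMax → o' = o ∧ (∀ a < j, best ≤ q a) ∧ (best = H ∨ ∃ a < j, best = q a))

/-- The invariant of the scan of the row of the state `s`, before the action number `j`. -/
def ScanInv (b : Bool) (I : Input n m) (st₀ : State 8) (s : Fin n) (j : ℕ) (st : State 8) : Prop :=
  SameExcept {rA, rIdx, rOut} {rBest} st₀ st ∧
    st.nat rIdx 0 = s * m + j ∧ (∀ i ≠ (s : ℕ), st.nat rOut i = st₀.nat rOut i) ∧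
    RowInv ((sideGame b I.game).owner s = Player.max) (fun a => qAt I st₀ (s * m + a))
      (st₀.real rV s) I.game.horizon (st₀.nat rOut s) j (st.real rBest 0) (st.nat rOut s)

theorem runs_scan_init (b : Bool) (hnm : 0 < n * m) (hm : 0 < m) {st₀ : State 8} (s : Fin n)
    (hs : st₀.nat rS 0 = s) (hidx : st₀.nat rIdx 0 = s * m) :
    Runs I ω (.ite (isMaxE b (.var rS)) (.setR rBest (.lit 0) (.get rV (.var rS)))
      (.setR rBest (.lit 0) horizonE)) st₀ 14 0 (ScanInv b I st₀ s 0) := by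
  have hsn : (s : ℕ) < n * m := lt_addr_bound hm s.2
  have hcost := isMaxE_cost b
  have hreach : ∀ st : State 8, (isMaxE b (.var rS)).reach n m st ≤ n * m := fun st =>
    (isMaxE_reach b st).trans hnm
  refine (Runs.ite (T := 9) (hreach _) (fun h t l => ?_) (fun h t l => ?_)).weaken
    (by omega) rfl fun _ h => h
  all_goals rw [isMaxE_holds b hs] at h
  · refine Runs.setR hnm (Nat.zero_le _) ?_ (fun t' l' => ⟨?_, hidx, fun _ _ => rfl, ?_, ?_⟩)
      (by decide)
    · change max (max 0 1) (st₀.nat rS 0 + 1) ≤ n * m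
      omega
    · have : SameExcept {rA, rIdx, rOut} {rBest} st₀ ((st₀.charge t l).charge t' l') :=
        (SameExcept.refl _ _ st₀).charge.charge
      exact this.writeR
    · intro _
      have : ((((st₀.charge t l).charge t' l').writeR rBest
          (NExpr.eval n m (st₀.charge t l) (.lit 0))
          (RExpr.eval I (st₀.charge t l) (.get rV (.var rS)))).real rBest 0) = st₀.real rV s := by
        rw [writeR_real, if_pos ⟨rfl, rfl⟩, ← hs]
        rfl
      rw [this]
      exact ⟨le_rfl, fun a ha => absurd ha (by simp), Or.inl ⟨rfl, rfl⟩⟩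
    · exact fun h' => absurd h h'
  · refine Runs.setR hnm (Nat.zero_le _) (Nat.zero_le _)
      (fun t' l' => ⟨?_, hidx, fun _ _ => rfl, ?_, ?_⟩) (by decide)
    · have : SameExcept {rA, rIdx, rOut} {rBest} st₀ ((st₀.charge t l).charge t' l') :=
        (SameExcept.refl _ _ st₀).charge.charge
      exact this.writeR
    · exact fun h' => absurd h' h
    · intro _
      rw [writeR_real, if_pos ⟨rfl, rfl⟩, horizonE_eval]
      exact ⟨rfl, fun a ha => absurd ha (by simp), Or.inl rfl⟩

theorem runs_scan_step (b : Bool) (hnm : 0 < n * m) (hm : 0 < m) {st₀ : State 8} (s : Fin n)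
    (hs : st₀.nat rS 0 = s) {j : ℕ} (hj : j < m) {st : State 8} (h : ScanInv b I st₀ s j st)
    (hja : st.nat rA 0 = j) :
    Runs I ω (.seq (.ite (isMaxE b (.var rS))
        (.ite (.ltR (.var rBest) qE)
          (.seq (.setR rBest (.lit 0) qE) (.setN rOut (.var rS) (.var rA))) .skip)
        (.ite (.ltR qE (.var rBest)) (.setR rBest (.lit 0) qE) .skip))
      (.incr rIdx)) st 89 0 fun st' => st'.nat rA 0 = j ∧ ScanInv b I st₀ s (j + 1) st' := by
  obtain ⟨h1, h2, h3, h4⟩ := h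
  have hsn : (s : ℕ) < n * m := lt_addr_bound hm s.2
  set isMax := (sideGame b I.game).owner s = Player.max with hMax
  set q : ℕ → ℝ := fun a => qAt I st₀ (s * m + a) with hq
  have hcost := isMaxE_cost b
  have hreach : ∀ st : State 8, (isMaxE b (.var rS)).reach n m st ≤ n * m := fun st =>
    (isMaxE_reach b st).trans hnm
  have hp : (s : ℕ) * m + j < n * m := addr_lt s.2 hj
  have hqst : ∀ st' : State 8, st'.real = st.real → st'.nat = st.nat →
      qE.eval I st' = q j ∧ qE.reach n m st' ≤ n * m := by
    intro st' hr hn'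
    have h5 : st'.nat rIdx 0 = s * m + j := by rw [hn', h2]
    refine ⟨?_, qE_reach h5 hp⟩
    have h6 : SameExcept {rA, rIdx, rOut} {rBest} st₀ st' :=
      ⟨fun y hy => by rw [hn', h1.nat y hy], fun y hy => by rw [hr, h1.real y hy]⟩
    rw [qE_eval h5, qAt_congr h6 (by decide) (by decide) (by decide)]
  have hss : st.nat rS 0 = s := by rw [h1.nat rS (by decide), hs]
  -- It suffices to find a middle state before the increment of the address counter.
  have hincr : ∀ st₁ : State 8, SameExcept {rA, rIdx, rOut} {rBest} st₀ st₁ →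
      st₁.nat rIdx 0 = s * m + j → st₁.nat rA 0 = j →
      (∀ i ≠ (s : ℕ), st₁.nat rOut i = st₀.nat rOut i) →
      RowInv isMax q (st₀.real rV s) I.game.horizon (st₀.nat rOut s) (j + 1)
        (st₁.real rBest 0) (st₁.nat rOut s) →
      Runs I ω (.incr rIdx) st₁ 5 0
        fun st' => st'.nat rA 0 = j ∧ ScanInv b I st₀ s (j + 1) st' := by
    intro st₁ k1 k2 k3 k4 k5
    refine Runs.incr hnm fun t l => ?_
    have hnat : ∀ y i, y ≠ rIdx → ((st₁.charge t l).writeN rIdx 0 (st₁.nat rIdx 0 + 1)).nat y i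
        = st₁.nat y i := fun y i hy => by
      rw [writeN_nat, if_neg (fun h => hy h.1)]
      rfl
    refine ⟨(hnat _ _ (by decide)).trans k3, ?_, ?_, fun i hi => ?_, ?_⟩
    · exact k1.charge.writeN
    · rw [writeN_nat, if_pos ⟨rfl, rfl⟩, k2, add_assoc]
    · rw [hnat _ _ (by decide), k4 i hi]
    · rw [hnat _ _ (by decide)]
      exact k5
  refine (Runs.seq (T := 84) (T' := 5) (q := 0) (q' := 0) ?_).weaken le_rfl rfl fun _ h => h
  refine (Runs.ite (T := 79) (hreach _) (fun h t l => ?_) (fun h t l => ?_)).weaken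
    (by omega) rfl fun _ h => h
  all_goals rw [isMaxE_holds b hss] at h
  · obtain ⟨r1, r2, r3⟩ := h4.1 h
    have hq1 := hqst (st.charge t l) rfl rfl
    refine (Runs.ite (T := 41) ?_ (fun h' t' l' => ?_) (fun h' t' l' => ?_)).weaken
      (le_of_eq rfl) rfl fun _ h => h
    · change max (max 0 1) (qE.reach n m (st.charge t l)) ≤ n * m
      omega
    · replace h' : st.real rBest 0 < q j := by
        rw [← hq1.1]
        exact h'
      have hq2 := hqst ((st.charge t l).charge t' l') rfl rfl
      refine (Runs.seq (T := 36) (T' := 5) (q := 0) (q' := 0) (Runs.setR hnm (Nat.zero_le _)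
        hq2.2 (fun t'' l'' => ?_) le_rfl)).weaken le_rfl rfl fun _ h => h
      set st₂ := (((st.charge t l).charge t' l').charge t'' l'').writeR rBest
        (NExpr.eval n m ((st.charge t l).charge t' l') (.lit 0))
        (RExpr.eval I ((st.charge t l).charge t' l') qE)
      have f2 : SameExcept {rA, rIdx, rOut} {rBest} st₀ st₂ :=
        h1.charge.charge.charge.writeR
      have hb2 : st₂.real rBest 0 = q j := by
        rw [writeR_real, if_pos ⟨rfl, rfl⟩, hq2.1]
      refine Runs.setN (by change st.nat rS 0 < n * m; rw [hss]; exact hsn)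
        (by change max 0 1 ≤ n * m; omega) (by change max 0 1 ≤ n * m; omega)
        (fun t₃ l₃ => ?_) (by decide)
      have hout : ∀ i, ((st₂.charge t₃ l₃).writeN rOut (NExpr.eval n m st₂ (.var rS))
          (NExpr.eval n m st₂ (.var rA))).nat rOut i = if i = s then j else st.nat rOut i := by
        intro i
        rw [writeN_nat]
        change (if rOut = rOut ∧ i = st.nat rS 0 then st.nat rA 0 else st.nat rOut i) = _
        rw [hss, hja]
        simp
      have hoth : ∀ y i, y ≠ rOut → ((st₂.charge t₃ l₃).writeN rOut
          (NExpr.eval n m st₂ (.var rS)) (NExpr.eval n m st₂ (.var rA))).nat y i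
          = st.nat y i := fun y i hy => by
        rw [writeN_nat, if_neg (fun h => hy h.1)]
        rfl
      refine hincr _ ?_ ?_ ?_ ?_ ?_
      · exact f2.charge.writeN
      · rw [hoth _ _ (by decide), h2]
      · rw [hoth _ _ (by decide), hja]
      · intro i hi
        rw [hout, if_neg hi, h3 i hi]
      · rw [hout, if_pos rfl]
        change RowInv isMax q (st₀.real rV s) I.game.horizon (st₀.nat rOut s) (j + 1)
          (st₂.real rBest 0) j
        rw [hb2]
        refine ⟨fun _ => ⟨r1.trans h'.le, fun a ha => ?_, Or.inr ⟨j, by omega, rfl, rfl⟩⟩,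
          fun h' => absurd h h'⟩
        rcases Nat.lt_succ_iff_lt_or_eq.1 ha with ha | rfl
        · exact (r2 a ha).trans h'.le
        · exact le_rfl
    · replace h' : ¬ st.real rBest 0 < q j := by
        rw [← hq1.1]
        exact h'
      refine (Runs.skip ?_).weaken (by decide : 1 ≤ 41) rfl fun _ h => h
      refine hincr _ ⟨h1.nat, h1.real⟩ h2 hja h3
        ⟨fun _ => ⟨r1, fun a ha => ?_, ?_⟩, fun h' => absurd h h'⟩
      · rcases Nat.lt_succ_iff_lt_or_eq.1 ha with ha | rfl
        · exact r2 a ha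
        · exact not_lt.1 h'
      · rcases r3 with h | ⟨a, ha, h⟩
        · exact Or.inl h
        · exact Or.inr ⟨a, by omega, h⟩
  · obtain ⟨r1, r2, r3⟩ := h4.2 h
    have hq1 := hqst (st.charge t l) rfl rfl
    refine (Runs.ite (T := 36) ?_ (fun h' t' l' => ?_) (fun h' t' l' => ?_)).weaken
      (by decide : 37 + 1 + 36 ≤ 79) rfl fun _ h => h
    · change max (qE.reach n m (st.charge t l)) (max 0 1) ≤ n * m
      omega
    · replace h' : q j < st.real rBest 0 := by
        rw [← hq1.1]
        exact h'
      have hq2 := hqst ((st.charge t l).charge t' l') rfl rfl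
      refine Runs.setR hnm (Nat.zero_le _) hq2.2 (fun t'' l'' => ?_) le_rfl
      refine hincr _ ?_ h2 hja h3 ?_
      · exact h1.charge.charge.charge.writeR
      · rw [writeR_real, if_pos ⟨rfl, rfl⟩, hq2.1]
        refine ⟨fun h' => absurd h' h, fun _ => ⟨r1, fun a ha => ?_,
          Or.inr ⟨j, by omega, rfl⟩⟩⟩
        rcases Nat.lt_succ_iff_lt_or_eq.1 ha with ha | rfl
        · exact h'.le.trans (r2 a ha)
        · exact le_rfl
    · replace h' : ¬ q j < st.real rBest 0 := by
        rw [← hq1.1]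
        exact h'
      refine (Runs.skip ?_).weaken (by decide : 1 ≤ 36) rfl fun _ h => h
      refine hincr _ ⟨h1.nat, h1.real⟩ h2 hja h3
        ⟨fun h' => absurd h' h, fun _ => ⟨r1, fun a ha => ?_, ?_⟩⟩
      · rcases Nat.lt_succ_iff_lt_or_eq.1 ha with ha | rfl
        · exact r2 a ha
        · exact not_lt.1 h'
      · rcases r3 with h | ⟨a, ha, h⟩
        · exact Or.inl h
        · exact Or.inr ⟨a, by omega, h⟩

theorem runs_scanRow (b : Bool) (hnm : 0 < n * m) (hm : 0 < m) {st₀ : State 8} (s : Fin n)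
    (hs : st₀.nat rS 0 = s) (hidx : st₀.nat rIdx 0 = s * m) :
    Runs I ω (scanRow b) st₀ (m * 99 + 22) 0 (ScanInv b I st₀ s m) := by
  have hloop : ∀ st₁, ScanInv b I st₀ s 0 st₁ → Runs I ω (.count rA (.ltN (.var rA) .numActions)
      (.seq (.ite (isMaxE b (.var rS))
          (.ite (.ltR (.var rBest) qE)
            (.seq (.setR rBest (.lit 0) qE) (.setN rOut (.var rS) (.var rA))) .skip)
          (.ite (.ltR qE (.var rBest)) (.setR rBest (.lit 0) qE) .skip))
        (.incr rIdx))) st₁ (m * 99 + 8) 0 (ScanInv b I st₀ s m) := by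
    intro st₁ h
    refine (Runs.count (N := m) (T := 89) (q := 0) (J := ScanInv b I st₀ s) hnm ?_ ?_
      (fun j hj st h hja => runs_scan_step b hnm hm s hs hj h hja) h).weaken ?_ (Nat.mul_zero m)
      fun _ h => h.2
    · rintro j st st' h ⟨h1, h2, h3, h4⟩
      refine ⟨h.sameExcept h1, ?_, ?_, ?_⟩
      · rw [h.1 _ (by decide), h2]
      · rw [h.1 _ (by decide)]; exact h3
      · rw [h.1 _ (by decide), h.2.1]; exact h4
    · rintro j st - hj
      refine ⟨?_, by change max (max 0 1) 0 ≤ n * m; omega⟩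
      change st.nat rA 0 < m ↔ j < m
      rw [hj]
    · have : (BExpr.ltN (.var rA : NExpr 8) .numActions).cost = 4 := rfl
      rw [this]
  have h := Runs.seq ((runs_scan_init (ω := ω) b hnm hm s hs hidx).imp hloop)
  exact h.weaken (by omega) rfl fun _ h => h

end Solver

namespace Solver

open State

variable {n m : ℕ} {I : Input n m} {ω : Game.Samples n m}

/-- The outcome of an update step at one state, with the estimates `q`, the old bound `v` and
action `o`, the new bound `v'` and action `o'`, and the horizon `H`. -/
def RowDone (isMax : Prop) (q : ℕ → ℝ) (m : ℕ) (H v v' : ℝ) (o o' : ℕ) : Prop :=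
  v ≤ v' ∧
  (isMax → (∀ a < m, q a ≤ v') ∧ ((v' = v ∧ o' = o) ∨ ∃ a < m, o' = a ∧ v' = q a)) ∧
  (¬ isMax → o' = o ∧ (v' = v ∨ ∀ a < m, v' ≤ q a) ∧ ((∃ a < m, q a ≤ v') ∨ H ≤ v'))

theorem RowInv.rowDone {isMax : Prop} {q : ℕ → ℝ} {m : ℕ} {H v best : ℝ} {o o' : ℕ}
    (h : RowInv isMax q v H o m best o') (hv : v < best) : RowDone isMax q m H v best o o' := by
  refine ⟨hv.le, fun hM => ⟨(h.1 hM).2.1, (h.1 hM).2.2⟩, fun hM => ?_⟩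
  obtain ⟨h1, h2, h3⟩ := h.2 hM
  refine ⟨h1, Or.inr h2, ?_⟩
  rcases h3 with rfl | ⟨a, ha, rfl⟩
  · exact Or.inr le_rfl
  · exact Or.inl ⟨a, ha, le_rfl⟩

theorem RowInv.rowDone_of_not_lt {isMax : Prop} {q : ℕ → ℝ} {m : ℕ} {H v best : ℝ} {o o' : ℕ}
    (h : RowInv isMax q v H o m best o') (hv : ¬ v < best) : RowDone isMax q m H v v o o' := by
  refine ⟨le_rfl, fun hM => ?_, fun hM => ?_⟩
  · obtain ⟨h1, h2, h3⟩ := h.1 hM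
    obtain rfl : best = v := le_antisymm (not_lt.1 hv) h1
    exact ⟨h2, h3⟩
  · obtain ⟨h1, h2, h3⟩ := h.2 hM
    refine ⟨h1, Or.inl rfl, ?_⟩
    rcases h3 with rfl | ⟨a, ha, rfl⟩
    · exact Or.inr (not_lt.1 hv)
    · exact Or.inl ⟨a, ha, not_lt.1 hv⟩

/-- The invariant of an update step, before the state number `i`. -/
def UpdateInv (b : Bool) (I : Input n m) (st₀ : State 8) (i : ℕ) (st : State 8) : Prop :=
  SameExcept {rS, rA, rIdx, rOut} {rBest, rV} st₀ st ∧ st.nat rIdx 0 = i * m ∧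
  (∀ s : Fin n, s < i → RowDone ((sideGame b I.game).owner s = Player.max)
    (fun a => qAt I st₀ (s * m + a)) m I.game.horizon (st₀.real rV s) (st.real rV s)
    (st₀.nat rOut s) (st.nat rOut s)) ∧
  ∀ s : Fin n, i ≤ s → st.real rV s = st₀.real rV s ∧ st.nat rOut s = st₀.nat rOut s

theorem runs_update_row (b : Bool) (hnm : 0 < n * m) (hm : 0 < m) {st₀ st : State 8} (i : Fin n)
    (h : UpdateInv b I st₀ i st) (hi : st.nat rS 0 = i) :
    Runs I ω (.seq (scanRow b)
        (.ite (.ltR (.get rV (.var rS)) (.var rBest)) (.setR rV (.var rS) (.var rBest)) .skip))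
      st (m * 99 + 34) 0 fun st' => st'.nat rS 0 = i ∧ UpdateInv b I st₀ (i + 1) st' := by
  obtain ⟨h1, h2, h3, h4⟩ := h
  have hin : (i : ℕ) < n * m := lt_addr_bound hm i.2
  have hq : qAt I st = qAt I st₀ := qAt_congr h1 (by decide) (by decide) (by decide)
  refine (Runs.seq (T' := 12) (q' := 0) ((runs_scanRow b hnm hm i hi h2).imp ?_)).weaken
    (by omega) rfl fun _ h => h
  rintro st₁ ⟨k1, k2, k3, k4⟩
  rw [hq, (h4 i le_rfl).1, (h4 i le_rfl).2] at k4
  have hi1 : st₁.nat rS 0 = i := by rw [k1.nat rS (by decide), hi]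
  have hv1 : ∀ p, st₁.real rV p = st.real rV p := fun p => by rw [k1.real rV (by decide)]
  have hframe : SameExcept {rS, rA, rIdx, rOut} {rBest, rV} st₀ st₁ :=
    h1.trans k1
  have hlow : ∀ s : Fin n, (s : ℕ) < i + 1 → (s : ℕ) < i ∨ s = i := fun s hs => by
    rcases Nat.lt_succ_iff_lt_or_eq.1 hs with h | h
    · exact Or.inl h
    · exact Or.inr (Fin.ext h)
  -- The new state differs from `st₁` at most in the bound at the state `i`.
  have fin : ∀ st₂ : State 8, SameExcept {rS, rA, rIdx, rOut} {rBest, rV} st₀ st₂ →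
      st₂.nat = st₁.nat → (∀ p : ℕ, p ≠ i → st₂.real rV p = st₁.real rV p) →
      RowDone ((sideGame b I.game).owner i = Player.max) (fun a => qAt I st₀ (i * m + a)) m
        I.game.horizon (st₀.real rV i) (st₂.real rV i) (st₀.nat rOut i) (st₂.nat rOut i) →
      st₂.nat rS 0 = i ∧ UpdateInv b I st₀ (i + 1) st₂ := by
    intro st₂ e1 e2 e3 e4
    refine ⟨by rw [e2, hi1], e1, ?_, fun s hs => ?_, fun s hs => ?_⟩
    · rw [e2, k2, Nat.succ_mul]
    · rcases hlow s hs with h | rfl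
      · rw [e3 s (by omega), e2, hv1, k3 s (by omega)]
        exact h3 s h
      · exact e4
    · rw [e3 s (by omega), e2, hv1, k3 s (by omega)]
      exact h4 s (by omega)
  have hvi : st₁.real rV i = st₀.real rV i := by rw [hv1, (h4 i le_rfl).1]
  refine (Runs.ite (T := 5) ?_ (fun h' t l => ?_) (fun h' t l => ?_)).weaken (by decide) rfl
    fun _ h => h
  · change max (max (max 0 1) (st₁.nat rS 0 + 1)) (max 0 1) ≤ n * m
    omega
  · replace h' : st₁.real rV (st₁.nat rS 0) < st₁.real rBest 0 := h'
    rw [hi1, hvi] at h'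
    refine Runs.setR ?_ ?_ ?_ (fun t' l' => ?_) (by decide)
    · change st₁.nat rS 0 < n * m
      omega
    · change max 0 1 ≤ n * m
      omega
    · change max 0 1 ≤ n * m
      omega
    · have hw : ∀ p, (((st₁.charge t l).charge t' l').writeR rV
          (NExpr.eval n m (st₁.charge t l) (.var rS))
          (RExpr.eval I (st₁.charge t l) (.var rBest))).real rV p
          = if p = i then st₁.real rBest 0 else st₁.real rV p := fun p => by
        rw [writeR_real]
        change (if rV = rV ∧ p = st₁.nat rS 0 then _ else _) = _
        rw [hi1]
        simp only [true_and]
        rfl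
      refine fin _ hframe.charge.charge.writeR rfl (fun p hp => ?_) ?_
      · rw [hw, if_neg hp]
      · rw [hw, if_pos rfl]
        exact k4.rowDone h'
  · replace h' : ¬ st₁.real rV (st₁.nat rS 0) < st₁.real rBest 0 := h'
    rw [hi1, hvi] at h'
    refine (Runs.skip ?_).weaken (by decide : 1 ≤ 5) rfl fun _ h => h
    refine fin _ hframe.charge.charge rfl (fun p hp => rfl) ?_
    change RowDone _ _ _ _ _ (st₁.real rV i) _ _
    rw [hvi]
    exact k4.rowDone_of_not_lt h'

theorem UpdateInv.improves {b : Bool} {st₀ st : State 8} (h : UpdateInv b I st₀ n st)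
    {τ : Fin n → Fin m} (hτ : ∀ s : Fin n, st₀.nat rOut s = τ s) :
    ∃ τ' : Fin n → Fin m, (∀ s : Fin n, st.nat rOut s = τ' s) ∧
      (sideGame b I.game).Improves (fun s a => qAt I st₀ (s * m + a)) τ (fun s => st₀.real rV s)
        τ' (fun s => st.real rV s) ∧
      ∀ s, (sideGame b I.game).owner s = Player.min → τ' s = τ s := by
  obtain ⟨-, -, h3, -⟩ := h
  have hnot : ∀ s, (sideGame b I.game).owner s = Player.min →
      ¬ (sideGame b I.game).owner s = Player.max := fun s h h' => by
    rw [h] at h'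
    cases h'
  have hlt : ∀ s : Fin n, st.nat rOut s < m := fun s => by
    obtain ⟨-, d2, d3⟩ := h3 s s.2
    by_cases hM : (sideGame b I.game).owner s = Player.max
    · rcases (d2 hM).2 with ⟨-, e⟩ | ⟨a, ha, e, -⟩
      · rw [e, hτ]; exact (τ s).2
      · rw [e]; exact ha
    · rw [(d3 hM).1, hτ]; exact (τ s).2
  refine ⟨fun s => ⟨st.nat rOut s, hlt s⟩, fun s => rfl, ⟨fun s => (h3 s s.2).1, fun s hM => ?_,
    fun s hM => ?_⟩, fun s hM => ?_⟩
  · obtain ⟨d1, d2⟩ := (h3 s s.2).2.1 hM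
    refine ⟨fun a => d1 a a.2, ?_⟩
    rcases d2 with ⟨e1, e2⟩ | ⟨a, ha, e1, e2⟩
    · exact Or.inl ⟨e1, Fin.ext (e2.trans (hτ s))⟩
    · right
      rw [← e1] at e2
      exact e2
  · obtain ⟨d1, d2, d3⟩ := (h3 s s.2).2.2 (hnot s hM)
    refine ⟨d2.imp id fun h a => h a a.2,
      d3.imp (fun h => ?_) fun h => (sideGame_horizon b I.game).le.trans h⟩
    obtain ⟨a, ha, h⟩ := h
    exact ⟨⟨a, ha⟩, h⟩
  · exact Fin.ext (((h3 s s.2).2.2 (hnot s hM)).1.trans (hτ s))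

theorem runs_update (b : Bool) (hn : 0 < n) (hm : 0 < m) (st₀ : State 8) :
    Runs I ω (update b) st₀ (n * m * 200) 0 (UpdateInv b I st₀ n) := by
  have hnm : 0 < n * m := Nat.mul_pos hn hm
  have hloop : ∀ t l, Runs I ω (.count rS (.ltN (.var rS) .numStates) (.seq (scanRow b)
        (.ite (.ltR (.get rV (.var rS)) (.var rBest)) (.setR rV (.var rS) (.var rBest)) .skip)))
      ((st₀.charge t l).writeN rIdx 0 0) (n * (m * 99 + 44) + 8) 0 (UpdateInv b I st₀ n) := by
    intro t l
    refine (Runs.count (N := n) (T := m * 99 + 34) (q := 0) (J := UpdateInv b I st₀) hnm ?_ ?_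
      (fun i hi st h hs => runs_update_row b hnm hm ⟨i, hi⟩ h hs) ?_).weaken ?_ (Nat.mul_zero n)
      fun _ h => h.2
    · rintro i st st' h ⟨h1, h2, h3, h4⟩
      refine ⟨h.sameExcept h1, ?_, ?_, ?_⟩
      · rw [h.1 _ (by decide), h2]
      · rw [h.1 _ (by decide), h.2.1]; exact h3
      · rw [h.1 _ (by decide), h.2.1]; exact h4
    · rintro j st - hj
      refine ⟨?_, by change max (max 0 1) 0 ≤ n * m; omega⟩
      change st.nat rS 0 < n ↔ j < n
      rw [hj]
    · refine ⟨(SameExcept.refl _ _ st₀).charge.writeN, ?_, fun s h => absurd h (by simp), ?_⟩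
      · simp [writeN_nat]
      · exact fun s _ => ⟨rfl, by rw [writeN_nat, if_neg (fun h => absurd h.1 (by decide))]; rfl⟩
    · have : (BExpr.ltN (.var rS : NExpr 8) .numStates).cost = 4 := rfl
      rw [this]
      exact le_of_eq (by ring)
  have h := Runs.seq (c := .setN rIdx (.lit 0) (.lit 0)) (st := st₀) (T := 3) (q := 0)
    (Runs.setN hnm (Nat.zero_le _) (Nat.zero_le _) hloop (by decide))
  refine h.weaken ?_ rfl fun _ h => h
  have h1 : n ≤ n * m := Nat.le_mul_of_pos_right n hm
  nlinarith

/-! ### The sampled quantities -/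

/-- The penalized one-step return at `(s, a)` with the next state `s'`. -/
noncomputable def penalized (G : Game n m) (ε : ℝ) (v₀ : Fin n → ℝ) (s : Fin n) (a : Fin m)
    (s' : Fin n) : ℝ :=
  (G.reward s a + G.discount * v₀ s') -
    4 * G.stepSize ε * (G.reward s a + G.discount * v₀ s' - v₀ s) ^ 2

theorem represents_penalizedE (b : Bool) (hm : 0 < m) (st₀ : State 8) :
    Represents I st₀ rX (penalizedE b)
      (penalized (sideGame b I.game) I.eps fun s => st₀.real rV₀ s) := by
  intro st hst s a s' hs ha hs'
  have hv : st.real rV₀ = st₀.real rV₀ := hst rV₀ (by decide) (by decide)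
  have h1 := rewardE_eval (I := I) b hs ha
  have h2 := horizonE_eval (I := I) st
  have hret : (returnE b).eval I st =
      (sideGame b I.game).reward s a + I.game.discount * st₀.real rV₀ s' := by
    change (rewardE b (.var rS) (.var rA)).eval I st + I.game.discount *
      st.real rV₀ (st.nat rSmp 0) = _
    rw [h1, hv, hs']
  have hdiff : (diffE b).eval I st =
      (sideGame b I.game).reward s a + I.game.discount * st₀.real rV₀ s' - st₀.real rV₀ s := by
    change (returnE b).eval I st - st.real rV₀ (st.nat rS 0) = _
    rw [hret, hv, hs]
  constructor
  · change (returnE b).eval I st - ((4 : ℕ) : ℝ) * (I.eps / (((1024 : ℕ) : ℝ) *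
      (horizonE.eval I st * horizonE.eval I st))) *
      ((diffE b).eval I st * (diffE b).eval I st) = _
    rw [hret, hdiff, h2]
    simp only [penalized, Game.stepSize, sideGame_discount, sideGame_horizon]
    push_cast
    ring
  · have r1 := rewardE_reach (n := n) (m := m) b st
    have hsn := lt_addr_bound hm s.2
    have hsn' := lt_addr_bound hm s'.2
    simp only [penalizedE, diffE, returnE, RExpr.reach, NExpr.reach, NExpr.eval, hs, hs']
    omega

/-- The correction of the value of `(s, a)` for the next state `s'`. -/
noncomputable def correction (G : Game n m) (v₀ v : Fin n → ℝ) (s' : Fin n) : ℝ :=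
  G.discount * (v s' - v₀ s')

theorem represents_correctionE (hm : 0 < m) (st₀ : State 8) :
    Represents I st₀ rY correctionE fun _ _ =>
      correction I.game (fun s => st₀.real rV₀ s) fun s => st₀.real rV s := by
  intro st hst s a s' hs ha hs'
  have hv : st.real rV₀ = st₀.real rV₀ := hst rV₀ (by decide) (by decide)
  have hv' : st.real rV = st₀.real rV := hst rV (by decide) (by decide)
  have hsn' := lt_addr_bound hm s'.2
  constructor
  · change I.game.discount * (st.real rV (st.nat rSmp 0) - st.real rV₀ (st.nat rSmp 0)) = _
    rw [hs', hv, hv']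
    rfl
  · simp only [correctionE, RExpr.reach, NExpr.reach, NExpr.eval, hs']
    omega

/-- The number of samples for the estimates at the start of a phase, before rounding up. -/
noncomputable def _root_.Game.bound₁ (G : Game n m) (ε L : ℝ) : ℝ :=
  65536 * L * G.horizon ^ 3 / ε ^ 2

/-- The number of samples for the estimates of a correction, before rounding up. -/
noncomputable def _root_.Game.bound₂ (G : Game n m) (L : ℝ) : ℝ := 4096 * L * G.horizon ^ 2

theorem evaluates_bound₁E (hnm : 0 < n * m) {st₀ : State 8} {x : Fin 8} (hx : x ≠ rL) :
    Evaluates I st₀ x bound₁E (I.game.bound₁ I.eps (st₀.real rL 0)) := by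
  intro st hst
  have h2 := horizonE_eval (I := I) st
  have hL : st.real rL = st₀.real rL := hst rL hx.symm (by decide)
  constructor
  · change ((65536 : ℕ) : ℝ) * st.real rL 0 * (horizonE.eval I st * (horizonE.eval I st *
      horizonE.eval I st)) / (I.eps * I.eps) = _
    rw [h2, hL, Game.bound₁]
    push_cast
    ring
  · simp only [bound₁E, RExpr.reach, NExpr.reach, NExpr.eval]
    omega

theorem evaluates_bound₂E (hnm : 0 < n * m) {st₀ : State 8} {x : Fin 8} (hx : x ≠ rL) :
    Evaluates I st₀ x bound₂E (I.game.bound₂ (st₀.real rL 0)) := by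
  intro st hst
  have h2 := horizonE_eval (I := I) st
  have hL : st.real rL = st₀.real rL := hst rL hx.symm (by decide)
  constructor
  · change ((4096 : ℕ) : ℝ) * st.real rL 0 * (horizonE.eval I st * horizonE.eval I st) = _
    rw [h2, hL, Game.bound₂]
    push_cast
    ring
  · simp only [bound₂E, RExpr.reach, NExpr.reach, NExpr.eval]
    omega

end Solver

namespace Game

variable {n m : ℕ} (G : Game n m)

theorem concentrates_penalizedReturn {ε : ℝ} (hε : 0 < ε) (hε1 : ε < 1) {v₀ : Fin n → ℝ}
    (h0 : ∀ s, 0 ≤ v₀ s) (h1 : ∀ s, v₀ s ≤ G.horizon) (s : Fin n) (a : Fin m) :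
    G.Concentrates s a (G.stepSize ε) (G.qvalue v₀ s a - 8 * G.stepSize ε * G.sqDiff v₀ s a)
      (G.qvalue v₀ s a) (Solver.penalized G ε v₀ s a) := by
  have hB := G.one_lt_horizon
  have hB0 : 0 < G.horizon := by linarith
  have hq : G.expect s a (fun x => G.reward s a + G.discount * v₀ x) = G.qvalue v₀ s a := by
    rw [expect_add, expect_const, expect_mul, qvalue]
  have hr := G.reward_mem s a
  have h := G.concentrates_penalized (s := s) (a := a)
    (X := fun x => G.reward s a + G.discount * v₀ x) (B := G.horizon) (c := v₀ s)
    (η := G.stepSize ε) (fun x => ?_) ⟨h0 s, h1 s⟩ (by unfold stepSize; positivity) ?_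
  · rw [hq] at h
    exact h
  · have e1 := mul_nonneg G.discount_pos.le (h0 x)
    have e2 := mul_le_mul_of_nonneg_left (h1 x) G.discount_pos.le
    have e3 := G.horizon_eq
    exact ⟨by linarith [hr.1], by linarith [hr.2]⟩
  · have : G.stepSize ε * G.horizon = ε / (1024 * G.horizon) := by
      unfold stepSize
      field_simp
    rw [this, div_le_iff₀ (by positivity)]
    linarith

/-- The step size of the exponential moment bounds for the corrections at scale `u`. -/
noncomputable def stepSize₂ (u : ℝ) : ℝ := 1 / (64 * G.horizon * u)

theorem concentrates_correction {u : ℝ} (hu : 0 < u) {v₀ v : Fin n → ℝ}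
    (h0 : ∀ s, v₀ s ≤ v s) (h1 : ∀ s, v s ≤ v₀ s + u) (s : Fin n) (a : Fin m) :
    G.Concentrates s a (G.stepSize₂ u)
      (G.discount * G.expect s a (fun x => v x - v₀ x) - G.slack₂ u / 2)
      (G.discount * G.expect s a (fun x => v x - v₀ x) + G.slack₂ u / 2)
      (Solver.correction G v₀ v) := by
  have hB := G.one_lt_horizon
  have hB0 : 0 < G.horizon := by linarith
  have h := G.concentrates_bounded (s := s) (a := a) (X := Solver.correction G v₀ v) (u := u)
    (θ := G.stepSize₂ u) (fun x => ?_) (by unfold stepSize₂; positivity) ?_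
  · have e1 : G.expect s a (Solver.correction G v₀ v) =
        G.discount * G.expect s a (fun x => v x - v₀ x) := G.expect_mul s a _ _
    have e2 : G.stepSize₂ u * u ^ 2 = G.slack₂ u / 2 := by
      unfold stepSize₂ slack₂
      field_simp
      norm_num
    rw [e1, e2] at h
    exact h
  · have e1 : 0 ≤ v x - v₀ x := by linarith [h0 x]
    have e2 : v x - v₀ x ≤ u := by linarith [h1 x]
    refine ⟨mul_nonneg G.discount_pos.le e1, ?_⟩
    calc G.discount * (v x - v₀ x) ≤ 1 * (v x - v₀ x) :=
          mul_le_mul_of_nonneg_right G.discount_lt_one.le e1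
      _ ≤ u := by linarith
  · have : G.stepSize₂ u * u = 1 / (64 * G.horizon) := by
      unfold stepSize₂
      field_simp
    rw [this, div_le_one (by positivity)]
    linarith

/-- The number of samples suffices for the Chernoff bound with confidence `L`. -/
theorem le_of_bound₁ {ε L : ℝ} {N : ℕ} (hε : 0 < ε) (hN : G.bound₁ ε L ≤ N) :
    L ≤ G.slack₁ ε * (G.stepSize ε * N) := by
  have hB := G.one_lt_horizon
  have hB0 : 0 < G.horizon := by linarith
  have h : G.slack₁ ε * (G.stepSize ε * G.bound₁ ε L) = L := by
    unfold slack₁ stepSize bound₁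
    field_simp
    norm_num
  calc L = G.slack₁ ε * (G.stepSize ε * G.bound₁ ε L) := h.symm
    _ ≤ _ := by
      unfold slack₁ stepSize
      gcongr

/-- The number of samples suffices for the Chernoff bound with confidence `L`. It does not depend
on the scale `u`, as the corrections and the admitted error are both proportional to `u`. -/
theorem le_of_bound₂ {u L : ℝ} {N : ℕ} (hu : 0 < u) (hN : G.bound₂ L ≤ N) :
    L ≤ G.slack₂ u / 2 * (G.stepSize₂ u * N) := by
  have hB := G.one_lt_horizon
  have hB0 : 0 < G.horizon := by linarith
  have h : G.slack₂ u / 2 * (G.stepSize₂ u * G.bound₂ L) = L := by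
    unfold slack₂ stepSize₂ bound₂
    field_simp
    norm_num
  calc L = G.slack₂ u / 2 * (G.stepSize₂ u * G.bound₂ L) := h.symm
    _ ≤ _ := by
      unfold slack₂ stepSize₂
      gcongr

theorem bound₁_pos {ε L : ℝ} (hε : 0 < ε) (hL : 0 < L) : 0 < G.bound₁ ε L := by
  have hB := G.one_lt_horizon
  have hB0 : 0 < G.horizon := by linarith
  unfold bound₁
  positivity

theorem bound₂_pos {L : ℝ} (hL : 0 < L) : 0 < G.bound₂ L := by
  have hB := G.one_lt_horizon
  have hB0 : 0 < G.horizon := by linarith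
  unfold bound₂
  positivity

/-- The number of queries in a phase. -/
noncomputable def phaseQueries (G : Game n m) (ε L : ℝ) : ℕ :=
  n * m * ⌈G.bound₁ ε L⌉₊ + ⌈3 * G.horizon⌉₊ * (n * m * ⌈G.bound₂ L⌉₊)

end Game

namespace Solver

open State

variable {n m : ℕ} {I : Input n m} {ω : Game.Samples n m}

/-! ### A phase -/

theorem runs_estimate_penalized (b : Bool) (hn : 0 < n) (hm : 0 < m) (hε : 0 < I.eps)
    (st₀ : State 8) (hL : 0 < st₀.real rL 0) :
    Runs I ω (estimate rX (penalizedE b) bound₁E) st₀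
      (n * m * ⌈I.game.bound₁ I.eps (st₀.real rL 0)⌉₊ * 400)
      (n * m * ⌈I.game.bound₁ I.eps (st₀.real rL 0)⌉₊)
      fun st' => SameExcept {rS, rA, rJ, rIdx, rSmp} {rX, rAcc} st₀ st' ∧
        ∀ (s : Fin n) (a : Fin m), st'.real rX (s * m + a) =
          Game.sampleMean (penalized (sideGame b I.game) I.eps (fun s => st₀.real rV₀ s) s a) ω
            (st₀.queries + (s * m + a) * ⌈I.game.bound₁ I.eps (st₀.real rL 0)⌉₊)
            ⌈I.game.bound₁ I.eps (st₀.real rL 0)⌉₊ s a :=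
  (runs_estimate hn hm (by decide) (represents_penalizedE b hm st₀)
    (evaluates_bound₁E (Nat.mul_pos hn hm) (by decide))
    (Nat.ceil_pos.2 (I.game.bound₁_pos hε hL))).weaken
    (Nat.mul_le_mul_left _ (by cases b <;> decide)) rfl fun _ h => h

theorem runs_estimate_correction (hn : 0 < n) (hm : 0 < m)
    (st₀ : State 8) (hL : 0 < st₀.real rL 0) :
    Runs I ω (estimate rY correctionE bound₂E) st₀
      (n * m * ⌈I.game.bound₂ (st₀.real rL 0)⌉₊ * 400)
      (n * m * ⌈I.game.bound₂ (st₀.real rL 0)⌉₊)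
      fun st' => SameExcept {rS, rA, rJ, rIdx, rSmp} {rY, rAcc} st₀ st' ∧
        ∀ (s : Fin n) (a : Fin m), st'.real rY (s * m + a) =
          Game.sampleMean (correction I.game (fun s => st₀.real rV₀ s) fun s => st₀.real rV s) ω
            (st₀.queries + (s * m + a) * ⌈I.game.bound₂ (st₀.real rL 0)⌉₊)
            ⌈I.game.bound₂ (st₀.real rL 0)⌉₊ s a :=
  (runs_estimate hn hm (by decide) (represents_correctionE hm st₀)
    (evaluates_bound₂E (Nat.mul_pos hn hm) (by decide))
    (Nat.ceil_pos.2 (I.game.bound₂_pos hL))).weaken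
    (Nat.mul_le_mul_left _ (by decide)) rfl fun _ h => h

theorem runs_saveBound (hn : 0 < n) (hm : 0 < m) (st₀ : State 8) :
    Runs I ω (fill rV₀ (.get rV (.var rS))) st₀ (n * m * 33) 0 fun st' =>
      SameExcept {rS} {rV₀} st₀ st' ∧ ∀ s : Fin n, st'.real rV₀ s = st₀.real rV s := by
  refine runs_fill hn hm fun st s h hs => ⟨?_, ?_⟩
  · change st.real rV (st.nat rS 0) = _
    rw [h rV (by decide), hs]
  · change max (max 0 1) (st.nat rS 0 + 1) ≤ n * m
    have := lt_addr_bound hm s.2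
    omega

theorem runs_halve (hnm : 0 < n * m) (st₀ : State 8) :
    Runs I ω (.setR rU (.lit 0) (.div (.var rU) (num 2))) st₀ 7 0 fun st' =>
      SameExcept ∅ {rU} st₀ st' ∧ st'.real rU 0 = st₀.real rU 0 / 2 := by
  refine Runs.setR hnm (Nat.zero_le _) ?_ (fun t l => ⟨?_, ?_⟩) (by decide)
  · change max (max 0 1) 0 ≤ n * m
    omega
  · exact ((SameExcept.refl _ _ st₀).charge).writeR
  · rw [writeR_real, if_pos ⟨rfl, rfl⟩]
    simp [RExpr.eval, NExpr.eval]

theorem boundE_holds (st : State 8) {i : ℕ} (hi : st.nat rI 0 = i) :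
    (BExpr.ltR (.ofNat (.var rI)) boundE).holds I st ↔ i < ⌈3 * I.game.horizon⌉₊ := by
  change ((st.nat rI 0 : ℕ) : ℝ) < ((3 : ℕ) : ℝ) * horizonE.eval I st ↔ _
  rw [horizonE_eval, hi, Nat.lt_ceil]
  push_cast
  rfl

theorem runs_phase (b : Bool) (hn : 0 < n) (hm : 0 < m) (hε : 0 < I.eps) (st₀ : State 8)
    (hL : 0 < st₀.real rL 0) :
    Runs I ω (phase b) st₀ (700 * I.game.phaseQueries I.eps (st₀.real rL 0))
      (I.game.phaseQueries I.eps (st₀.real rL 0)) fun st' =>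
        st'.real rL = st₀.real rL ∧ st'.real rU 0 = st₀.real rU 0 / 2 := by
  have hnm : 0 < n * m := Nat.mul_pos hn hm
  obtain ⟨N₁, hN₁⟩ : ∃ N, N = ⌈I.game.bound₁ I.eps (st₀.real rL 0)⌉₊ := ⟨_, rfl⟩
  obtain ⟨N₂, hN₂⟩ : ∃ N, N = ⌈I.game.bound₂ (st₀.real rL 0)⌉₊ := ⟨_, rfl⟩
  obtain ⟨R, hR⟩ : ∃ N, N = ⌈3 * I.game.horizon⌉₊ := ⟨_, rfl⟩
  have h1 : 1 ≤ N₁ := by rw [hN₁]; exact Nat.ceil_pos.2 (I.game.bound₁_pos hε hL)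
  have h2 : 1 ≤ N₂ := by rw [hN₂]; exact Nat.ceil_pos.2 (I.game.bound₂_pos hL)
  have hrun : Runs I ω (phase b) st₀ (n * m * 33 + (n * m * N₁ * 400 +
      ((R * (14 + 6 + (n * m * N₂ * 400 + n * m * 200)) + (14 + 4)) + 7)))
      (0 + (n * m * N₁ + (R * (n * m * N₂ + 0) + 0))) fun st' =>
        st'.real rL = st₀.real rL ∧ st'.real rU 0 = st₀.real rU 0 / 2 := by
    refine Runs.seq ((runs_saveBound hn hm st₀).imp fun st₁ k1 => ?_)
    have l1 : st₁.real rL = st₀.real rL := k1.1.real rL (by decide)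
    have u1 : st₁.real rU = st₀.real rU := k1.1.real rU (by decide)
    have hest := runs_estimate_penalized (I := I) (ω := ω) b hn hm hε st₁ (by rw [l1]; exact hL)
    rw [l1, ← hN₁] at hest
    refine Runs.seq (hest.imp fun st₂ k2 => ?_)
    have l2 : st₂.real rL = st₀.real rL := by rw [k2.1.real rL (by decide), l1]
    have u2 : st₂.real rU = st₀.real rU := by rw [k2.1.real rU (by decide), u1]
    refine Runs.seq ((Runs.count (N := R) (T := n * m * N₂ * 400 + n * m * 200)
      (q := n * m * N₂ + 0)
      (J := fun _ st => st.real rL = st₀.real rL ∧ st.real rU = st₀.real rU) hnm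
      ?_ ?_ ?_ ⟨l2, u2⟩).imp ?_)
    · rintro i st st' h ⟨a1, a2⟩
      rw [h.2.1]
      exact ⟨a1, a2⟩
    · rintro i st - hi
      rw [hR]
      refine ⟨boundE_holds st hi, ?_⟩
      change max (max 0 1) 0 ≤ n * m
      omega
    · rintro i - st ⟨a1, a2⟩ hi
      have hest := runs_estimate_correction (I := I) (ω := ω) hn hm st (by rw [a1]; exact hL)
      rw [a1, ← hN₂] at hest
      refine Runs.seq (hest.imp fun st₃ k3 => (runs_update b hn hm st₃).imp fun st₄ k4 => ?_)
      refine ⟨?_, ?_, ?_⟩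
      · rw [k4.1.nat rI (by decide), k3.1.nat rI (by decide), hi]
      · rw [k4.1.real rL (by decide), k3.1.real rL (by decide), a1]
      · rw [k4.1.real rU (by decide), k3.1.real rU (by decide), a2]
    · rintro st₃ ⟨-, a1, a2⟩
      refine (runs_halve hnm st₃).imp fun st₄ k4 => ⟨?_, ?_⟩
      · rw [k4.1.real rL (by decide), a1]
      · rw [k4.2, a2]
  have hq : I.game.phaseQueries I.eps (st₀.real rL 0) = n * m * N₁ + R * (n * m * N₂) := by
    rw [Game.phaseQueries, ← hN₁, ← hN₂, ← hR]
  rw [hq]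
  refine hrun.weaken ?_ (by ring) fun _ h => h
  have e1 : n * m ≤ n * m * N₁ := Nat.le_mul_of_pos_right _ h1
  have e2 : n * m ≤ n * m * N₂ := Nat.le_mul_of_pos_right _ h2
  have e3 : R * (n * m) ≤ R * (n * m * N₂) := Nat.mul_le_mul_left _ e2
  have e4 : R * 1 ≤ R * (n * m * N₂) := Nat.mul_le_mul_left _ (hnm.trans_le e2)
  nlinarith

/-- The state before a phase at scale `u`: the array `rV` holds a bound that the stored strategy
guarantees, and it is `u`-close to the optimal value `w`. The strategy of the opponent is still
`τ₀`. -/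
structure Stage (b : Bool) (I : Input n m) (w : Fin n → ℝ) (τ₀ : Fin n → Fin m) (L u : ℝ)
    (st : State 8) : Prop where
  conf : st.real rL 0 = L
  scale : st.real rU 0 = u
  nonneg : ∀ s : Fin n, 0 ≤ st.real rV s
  close : ∀ s : Fin n, w s ≤ st.real rV s + u
  strategy : ∃ τ : Fin n → Fin m, (∀ s : Fin n, st.nat rOut s = τ s) ∧
    (sideGame b I.game).Guarantees τ (fun s : Fin n => st.real rV s) ∧
    ∀ s, (sideGame b I.game).owner s = Player.min → τ s = τ₀ s

/-- The state within a phase, after `i` update steps: `v₀` is the bound at the start of the phase,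
and the array `rX` holds good estimates of the values with respect to `v₀`. -/
structure MidStage (b : Bool) (I : Input n m) (w v₀ : Fin n → ℝ) (τ₀ : Fin n → Fin m) (L u : ℝ)
    (i : ℕ) (st : State 8) : Prop where
  conf : st.real rL 0 = L
  scale : st.real rU 0 = u
  start : ∀ s : Fin n, st.real rV₀ s = v₀ s
  table : ∀ (s : Fin n) (a : Fin m), st.real rX (s * m + a) ∈ Set.Icc
    ((sideGame b I.game).qvalue v₀ s a - 8 * I.game.stepSize I.eps *
      (sideGame b I.game).sqDiff v₀ s a - I.game.slack₁ I.eps)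
    ((sideGame b I.game).qvalue v₀ s a + I.game.slack₁ I.eps)
  strategy : ∃ τ : Fin n → Fin m, (∀ s : Fin n, st.nat rOut s = τ s) ∧
    (sideGame b I.game).PhaseInv w v₀ I.eps u i τ (fun s : Fin n => st.real rV s) ∧
    ∀ s, (sideGame b I.game).owner s = Player.min → τ s = τ₀ s

theorem stepSize_sideGame (b : Bool) (G : Game n m) : (sideGame b G).stepSize = G.stepSize := by
  funext; simp [Game.stepSize]

theorem stepSize₂_sideGame (b : Bool) (G : Game n m) : (sideGame b G).stepSize₂ = G.stepSize₂ := by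
  funext; simp [Game.stepSize₂]

theorem slack₁_sideGame (b : Bool) (G : Game n m) : (sideGame b G).slack₁ = G.slack₁ := by
  funext; simp [Game.slack₁]

theorem slack₂_sideGame (b : Bool) (G : Game n m) : (sideGame b G).slack₂ = G.slack₂ := by
  funext; simp [Game.slack₂]

/-- The failure probability of one round of estimates. -/
noncomputable def roundFailure (n m : ℕ) (L : ℝ) : ENNReal :=
  ENNReal.ofReal (n * m * (2 * Real.exp (-L)))

section

variable {b : Bool} {w : Fin n → ℝ} {τ₀ : Fin n → Fin m} {L u : ℝ}

theorem likely_start (hn : 0 < n) (hm : 0 < m) (hε : 0 < I.eps) (hε1 : I.eps < 1) (hL : 0 < L)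
    (hw : (sideGame b I.game).IsBellman w) (hu : I.eps < 2 * u) {v₀ : Fin n → ℝ}
    {st : State 8} (h : Stage b I w τ₀ L u st) (hv : ∀ s : Fin n, st.real rV s = v₀ s)
    (hv₀ : ∀ s : Fin n, st.real rV₀ s = v₀ s) :
    Likely I (estimate rX (penalizedE b) bound₁E) st (n * m * ⌈I.game.bound₁ I.eps L⌉₊)
      (roundFailure n m L) (MidStage b I w v₀ τ₀ L u 0) := by
  have hvw : (fun s : Fin n => st.real rV s) = v₀ := funext hv
  have hvw' : (fun s : Fin n => st.real rV₀ s) = v₀ := funext hv₀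
  obtain ⟨τ, t1, t2, t3⟩ := h.strategy
  have hrun := fun ω => runs_estimate_penalized (I := I) (ω := ω) b hn hm hε st
    (by rw [h.conf]; exact hL)
  rw [h.conf, hvw'] at hrun
  set N := ⌈I.game.bound₁ I.eps L⌉₊ with hN
  have hle : ∀ s, v₀ s ≤ w s := by
    rw [← hvw]
    exact t2.le_bellman hw
  have hbad := (sideGame b I.game).sampleLaw_exists_sampleMean_notMem_le
    (fun s a => (sideGame b I.game).concentrates_penalizedReturn hε hε1 (v₀ := v₀)
      (fun s => by rw [← hv]; exact h.nonneg s)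
      (fun s => (hle s).trans (hw.le_horizon s)) s a)
    (fun s a => st.queries + (s * m + a) * N) (N := N) (o := I.game.slack₁ I.eps) (L := L)
    (Nat.ceil_pos.2 (I.game.bound₁_pos hε hL))
    (fun s a => by
      have hB := (sideGame b I.game).one_lt_horizon
      have hB0 : 0 < (sideGame b I.game).horizon := by linarith
      unfold Game.stepSize
      positivity)
    (fun s a => by
      rw [stepSize_sideGame]
      exact I.game.le_of_bound₁ hε (Nat.le_ceil _))
  rw [sideGame_sampleLaw] at hbad
  refine Likely.of_runs hrun hbad ?_
  rintro ω hω st' ⟨k1, k2⟩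
  have hV : st'.real rV = st.real rV := k1.real rV (by decide)
  refine ⟨?_, ?_, ?_, ?_, τ, ?_, ?_, t3⟩
  · rw [k1.real rL (by decide), h.conf]
  · rw [k1.real rU (by decide), h.scale]
  · intro s
    rw [k1.real rV₀ (by decide), hv₀]
  · intro s a
    rw [k2, ← stepSize_sideGame b]
    by_contra hno
    exact hω ⟨s, a, hno⟩
  · intro s
    rw [k1.nat rOut (by decide), t1]
  · rw [hV, hvw]
    rw [hvw] at t2
    refine Game.PhaseInv.zero hw hε hε1 hu (fun s => ?_) t2
    rw [← hv]
    exact h.close s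

theorem likely_step (hn : 0 < n) (hm : 0 < m) (hε : 0 < I.eps) (hL : 0 < L)
    (hw : (sideGame b I.game).IsBellman w) (hu : I.eps < 2 * u) {v₀ : Fin n → ℝ}
    (h1 : ∀ s, v₀ s ≤ w s) (h2 : ∀ s, w s ≤ v₀ s + u) {i : ℕ} {st : State 8}
    (h : MidStage b I w v₀ τ₀ L u i st) (hi : st.nat rI 0 = i) :
    Likely I (.seq (estimate rY correctionE bound₂E) (update b)) st
      (n * m * ⌈I.game.bound₂ L⌉₊) (roundFailure n m L)
      fun st' => st'.nat rI 0 = i ∧ MidStage b I w v₀ τ₀ L u (i + 1) st' := by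
  have hvw' : (fun s : Fin n => st.real rV₀ s) = v₀ := funext h.start
  obtain ⟨τ, t1, t2, t3⟩ := h.strategy
  have hu0 : 0 < u := by linarith
  obtain ⟨v, hv⟩ : ∃ v : Fin n → ℝ, v = fun s : Fin n => st.real rV s := ⟨_, rfl⟩
  have hrun : ∀ ω, Runs I ω (.seq (estimate rY correctionE bound₂E) (update b)) st
      (n * m * ⌈I.game.bound₂ L⌉₊ * 400 + n * m * 200) (n * m * ⌈I.game.bound₂ L⌉₊ + 0)
      fun st' => ∃ st₁, (SameExcept {rS, rA, rJ, rIdx, rSmp} {rY, rAcc} st st₁ ∧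
        ∀ (s : Fin n) (a : Fin m), st₁.real rY (s * m + a) =
          Game.sampleMean (correction I.game v₀ v) ω
            (st.queries + (s * m + a) * ⌈I.game.bound₂ L⌉₊) ⌈I.game.bound₂ L⌉₊ s a) ∧
        UpdateInv b I st₁ n st' := fun ω => by
    have h5 := runs_estimate_correction (I := I) (ω := ω) hn hm st (by rw [h.conf]; exact hL)
    rw [h.conf, hvw', ← hv] at h5
    exact Runs.seq (h5.imp fun st₁ k => (runs_update b hn hm st₁).imp fun st' k' => ⟨st₁, k, k'⟩)
  rw [← hv] at t2
  have hvle := t2.guarantees.le_bellman hw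
  have hbad := (sideGame b I.game).sampleLaw_exists_sampleMean_notMem_le
    (fun s a => (sideGame b I.game).concentrates_correction hu0 (v₀ := v₀) (v := v)
      t2.mono (fun s => (hvle s).trans (h2 s)) s a)
    (fun s a => st.queries + (s * m + a) * ⌈I.game.bound₂ L⌉₊) (N := ⌈I.game.bound₂ L⌉₊)
    -- The other half of the slack is the bias of `concentrates_correction`.
    (o := I.game.slack₂ u / 2) (L := L)
    (Nat.ceil_pos.2 (I.game.bound₂_pos hL))
    (fun s a => by
      have hB := (sideGame b I.game).one_lt_horizon
      have hB0 : 0 < (sideGame b I.game).horizon := by linarith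
      unfold Game.stepSize₂
      positivity)
    (fun s a => by
      rw [stepSize₂_sideGame]
      exact I.game.le_of_bound₂ hu0 (Nat.le_ceil _))
  rw [sideGame_sampleLaw] at hbad
  refine Likely.of_runs hrun hbad ?_
  rintro ω hω st' ⟨st₁, ⟨k1, k2⟩, k3⟩
  have hY : ∀ (s : Fin n) (a : Fin m), st₁.real rY (s * m + a) ∈ Set.Icc
      (I.game.discount * I.game.expect s a (fun x => v x - v₀ x) - I.game.slack₂ u)
      (I.game.discount * I.game.expect s a (fun x => v x - v₀ x) + I.game.slack₂ u) := by
    intro s a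
    by_contra hno
    refine hω ⟨s, a, fun hin => hno ?_⟩
    have e : correction (sideGame b I.game) v₀ v = correction I.game v₀ v := by
      funext x; simp [correction]
    rw [e, slack₂_sideGame, sideGame_discount, sideGame_expect] at hin
    rw [k2]
    exact ⟨by linarith [hin.1], by linarith [hin.2]⟩
  have hX : st₁.real rX = st.real rX := k1.real rX (by decide)
  have hU : st₁.real rU 0 = u := by rw [k1.real rU (by decide), h.scale]
  have hq : ∀ (s : Fin n) (a : Fin m), (sideGame b I.game).qvalue v s a =
      (sideGame b I.game).qvalue v₀ s a
        + I.game.discount * I.game.expect s a (fun x => v x - v₀ x) := by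
    intro s a
    rw [Game.qvalue, Game.qvalue, sideGame_discount, sideGame_expect, Game.expect_sub]
    ring
  have hV1 : (fun s : Fin n => st₁.real rV s) = v := by
    rw [hv, k1.real rV (by decide)]
  obtain ⟨τ', o1, o2, o3⟩ := k3.improves (τ := τ) fun s => by
    rw [k1.nat rOut (by decide), t1]
  rw [hV1] at o2
  refine ⟨?_, ?_, ?_, ?_, ?_, τ', o1, ?_, fun s hs => (o3 s hs).trans (t3 s hs)⟩
  · rw [k3.1.nat rI (by decide), k1.nat rI (by decide), hi]
  · rw [k3.1.real rL (by decide), k1.real rL (by decide), h.conf]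
  · rw [k3.1.real rU (by decide), hU]
  · intro s
    rw [k3.1.real rV₀ (by decide), k1.real rV₀ (by decide), h.start]
  · intro s a
    rw [k3.1.real rX (by decide), hX]
    exact h.table s a
  · refine Game.PhaseInv.step hm hw hε.le h1 h2 t2 (fun s a => ?_) (fun s a => ?_) o2
    · have e1 := h.table s a
      have e2 := hY s a
      rw [hq, qAt, hX, hU]
      linarith [e1.2, e2.2]
    · have e1 := h.table s a
      have e2 := hY s a
      rw [hq, qAt, hX, hU, slack₁_sideGame, slack₂_sideGame, stepSize_sideGame]
      linarith [e1.1, e2.1]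

theorem likely_phase (hn : 0 < n) (hm : 0 < m) (hε : 0 < I.eps) (hε1 : I.eps < 1) (hL : 0 < L)
    (hw : (sideGame b I.game).IsBellman w) (hu : I.eps < 2 * u) (huB : u ≤ I.game.horizon)
    {st : State 8} (h : Stage b I w τ₀ L u st) :
    Likely I (phase b) st (I.game.phaseQueries I.eps L)
      ((1 + ⌈3 * I.game.horizon⌉₊ : ℕ) * roundFailure n m L) (Stage b I w τ₀ L (u / 2)) := by
  have hnm : 0 < n * m := Nat.mul_pos hn hm
  obtain ⟨v₀, hv₀⟩ : ∃ v : Fin n → ℝ, v = fun s : Fin n => st.real rV s := ⟨_, rfl⟩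
  set R := ⌈3 * I.game.horizon⌉₊ with hR
  have hstart : Likely I (fill rV₀ (.get rV (.var rS))) st 0 0 fun st₁ =>
      Stage b I w τ₀ L u st₁ ∧ (∀ s : Fin n, st₁.real rV s = v₀ s) ∧
        ∀ s : Fin n, st₁.real rV₀ s = v₀ s := by
    refine Likely.of_forall_runs fun ω => (runs_saveBound hn hm st).imp fun st₁ k => ?_
    have hV : st₁.real rV = st.real rV := k.1.real rV (by decide)
    refine ⟨⟨?_, ?_, ?_, ?_, ?_⟩, ?_, ?_⟩
    · rw [k.1.real rL (by decide), h.conf]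
    · rw [k.1.real rU (by decide), h.scale]
    · rw [hV]; exact h.nonneg
    · rw [hV]; exact h.close
    · rw [hV, k.1.nat rOut (by decide)]; exact h.strategy
    · rw [hV, hv₀]; exact fun _ => rfl
    · rw [hv₀]; exact k.2
  have hle : ∀ s, v₀ s ≤ w s := by
    obtain ⟨τ, -, t2, -⟩ := h.strategy
    rw [hv₀]
    exact t2.le_bellman hw
  have hclose : ∀ s, w s ≤ v₀ s + u := by
    rw [hv₀]; exact h.close
  have hnn : ∀ s, 0 ≤ v₀ s := by
    rw [hv₀]; exact h.nonneg
  have hsweep : ∀ st₁, MidStage b I w v₀ τ₀ L u 0 st₁ → Likely I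
      (.count rI (.ltR (.ofNat (.var rI)) boundE)
          (.seq (estimate rY correctionE bound₂E) (update b))) st₁
      (R * (n * m * ⌈I.game.bound₂ L⌉₊)) (R * roundFailure n m L)
      (MidStage b I w v₀ τ₀ L u R) := fun st₁ h₁ => by
    refine Likely.count hnm ?_ (fun i st _ hi => boundE_holds st hi)
      (fun i _ st h hi => likely_step hn hm hε hL hw hu hle hclose h hi) h₁
    rintro i st st' hb ⟨a1, a2, a3, a4, a5⟩
    refine ⟨?_, ?_, ?_, ?_, ?_⟩
    · rw [hb.2.1]; exact a1
    · rw [hb.2.1]; exact a2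
    · rw [hb.2.1]; exact a3
    · rw [hb.2.1]; exact a4
    · rw [hb.2.1, hb.1 _ (by decide)]; exact a5
  have hend : ∀ st₁, MidStage b I w v₀ τ₀ L u R st₁ → Likely I
      (.setR rU (.lit 0) (.div (.var rU) (num 2))) st₁ 0 0 (Stage b I w τ₀ L (u / 2)) := by
    intro st₁ h₁
    refine Likely.of_forall_runs fun ω => (runs_halve hnm st₁).imp fun st₂ k => ?_
    have hV : st₂.real rV = st₁.real rV := k.1.real rV (by decide)
    obtain ⟨τ, t1, t2, t3⟩ := h₁.strategy
    refine ⟨?_, ?_, ?_, ?_, τ, ?_, ?_, t3⟩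
    · rw [k.1.real rL (by decide), h₁.conf]
    · rw [k.2, h₁.scale]
    · intro s
      rw [hV]
      exact (hnn s).trans (t2.mono s)
    · intro s
      rw [hV]
      refine t2.final hε hε1 hu ?_ ?_ s
      · rw [sideGame_horizon]; exact huB
      · rw [sideGame_horizon]; exact Nat.le_ceil _
    · intro s
      rw [k.1.nat rOut (by decide), t1]
    · rw [hV]
      exact t2.guarantees
  have hall := hstart.seq fun st₁ h₁ =>
    (likely_start hn hm hε hε1 hL hw hu h₁.1 h₁.2.1 h₁.2.2).seq fun st₂ h₂ =>
      (hsweep st₂ h₂).seq hend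
  have hq : I.game.phaseQueries I.eps L =
      0 + (n * m * ⌈I.game.bound₁ I.eps L⌉₊ + (R * (n * m * ⌈I.game.bound₂ L⌉₊) + 0)) := by
    rw [Game.phaseQueries, ← hR]; ring
  rw [hq]
  refine hall.weaken (le_of_eq ?_) fun _ h => h
  push_cast
  ring

end

end Solver

theorem Game.Guarantees.congr {n m : ℕ} {G : Game n m} {τ τ' : Fin n → Fin m} {v : Fin n → ℝ}
    (h : G.Guarantees τ v) (hτ : ∀ s, G.owner s = Player.max → τ' s = τ s) : G.Guarantees τ' v :=
  ⟨fun s hs => by rw [hτ s hs]; exact h.of_max s hs, h.of_min⟩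

namespace Solver

open State

variable {n m : ℕ} {I : Input n m} {ω : Game.Samples n m}

/-! ### The whole program -/

/-- `K` is the number of phases: the number of halvings that take `u` from the horizon to at most
`ε / 2`. -/
def IsPhaseCount (I : Input n m) (K : ℕ) : Prop :=
  0 < K ∧ (∀ k < K, I.eps < 2 * (I.game.horizon / 2 ^ k)) ∧
    ¬ I.eps < 2 * (I.game.horizon / 2 ^ K)

theorem loopTest_holds (st : State 8) :
    (BExpr.ltR (.eps) (.add (.var rU) (.var rU)) : BExpr 8).holds I st ↔
      I.eps < 2 * st.real rU 0 := by
  rw [two_mul]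
  rfl

theorem runs_setScale (hnm : 0 < n * m) (st₀ : State 8) :
    Runs I ω (.setR rU (.lit 0) horizonE) st₀ 9 0 fun st' =>
      SameExcept ∅ {rU} st₀ st' ∧ st'.real rU 0 = I.game.horizon := by
  refine Runs.setR hnm (Nat.zero_le _) (Nat.zero_le _) (fun t l => ⟨?_, ?_⟩) (by decide)
  · exact ((SameExcept.refl _ _ st₀).charge).writeR
  · rw [writeR_real, if_pos ⟨rfl, rfl⟩, horizonE_eval]

theorem runs_clear (hn : 0 < n) (hm : 0 < m) (st₀ : State 8) :
    Runs I ω (fill rV (num 0)) st₀ (n * m * 32) 0 fun st' =>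
      SameExcept {rS} {rV} st₀ st' ∧ ∀ s : Fin n, st'.real rV s = 0 :=
  runs_fill hn hm (f := fun _ => 0) fun _ _ _ _ => ⟨Nat.cast_zero, Nat.zero_le _⟩

theorem runs_side (b : Bool) (hn : 0 < n) (hm : 0 < m) (hε : 0 < I.eps) {K : ℕ}
    (hK : IsPhaseCount I K) (st₀ : State 8) (hL : 0 < st₀.real rL 0) :
    Runs I ω (side b) st₀ (800 * (K * I.game.phaseQueries I.eps (st₀.real rL 0)))
      (K * I.game.phaseQueries I.eps (st₀.real rL 0)) fun st' => st'.real rL = st₀.real rL := by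
  have hnm : 0 < n * m := Nat.mul_pos hn hm
  obtain ⟨Z, hZ⟩ : ∃ Z, Z = I.game.phaseQueries I.eps (st₀.real rL 0) := ⟨_, rfl⟩
  have hrun : Runs I ω (side b) st₀ (9 + (n * m * 32 + (K * (7 + 1 + 700 * Z) + (7 + 1))))
      (0 + (0 + K * Z)) fun st' => st'.real rL = st₀.real rL := by
    refine Runs.seq ((runs_setScale hnm st₀).imp fun st₁ k₁ => ?_)
    refine Runs.seq ((runs_clear hn hm st₁).imp fun st₂ k₂ => ?_)
    refine (Runs.loop (N := K) (T := 700 * Z) (q := Z) (J := fun i st =>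
      st.real rL = st₀.real rL ∧ st.real rU 0 = I.game.horizon / 2 ^ i) ?_ ?_ ?_ ?_).imp ?_
    · intro i st _
      change max 0 (max (max 0 1) (max 0 1)) ≤ n * m
      omega
    · rintro i hi st ⟨a1, a2⟩
      refine ⟨?_, fun t l => ?_⟩
      · rw [loopTest_holds, a2]
        exact hK.2.1 i hi
      · have h := runs_phase (I := I) (ω := ω) b hn hm hε (st.charge t l)
          (by change 0 < st.real rL 0; rw [a1]; exact hL)
        rw [charge_real, a1, ← hZ] at h
        refine h.imp fun st' k => ⟨k.1, ?_⟩
        rw [k.2, a2, pow_succ, div_div]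
    · rintro st ⟨a1, a2⟩
      rw [loopTest_holds, a2]
      exact hK.2.2
    · refine ⟨?_, ?_⟩
      · rw [k₂.1.real rL (by decide), k₁.1.real rL (by decide)]
      · rw [k₂.1.real rU (by decide), k₁.2]
        simp
    · rintro st' ⟨st'', t, l, h, rfl⟩
      exact h.1
  rw [← hZ]
  refine hrun.weaken ?_ (by ring) fun _ h => h
  have h1 : 1 ≤ ⌈I.game.bound₁ I.eps (st₀.real rL 0)⌉₊ :=
    Nat.ceil_pos.2 (I.game.bound₁_pos hε hL)
  have h2 : n * m ≤ Z := by
    rw [hZ, Game.phaseQueries]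
    exact (Nat.le_mul_of_pos_right _ h1).trans (Nat.le_add_right _ _)
  have h3 : Z ≤ K * Z := Nat.le_mul_of_pos_left _ hK.1
  have h4 : K * 1 ≤ K * Z := Nat.mul_le_mul_left _ (hnm.trans_le h2)
  nlinarith

theorem likely_side (b : Bool) (hn : 0 < n) (hm : 0 < m) (hε : 0 < I.eps) (hε1 : I.eps < 1)
    {K : ℕ} (hK : IsPhaseCount I K) {L : ℝ} (hL : 0 < L) {w : Fin n → ℝ}
    (hw : (sideGame b I.game).IsBellman w) {τ₀ : Fin n → Fin m} {st₀ : State 8}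
    (hL₀ : st₀.real rL 0 = L) (hτ₀ : ∀ s : Fin n, st₀.nat rOut s = τ₀ s) :
    Likely I (side b) st₀ (K * I.game.phaseQueries I.eps L)
      (K * ((1 + ⌈3 * I.game.horizon⌉₊ : ℕ) * roundFailure n m L)) fun st' =>
        ∃ u ≤ I.eps / 2, Stage b I w τ₀ L u st' := by
  have hnm : 0 < n * m := Nat.mul_pos hn hm
  have hB := I.game.one_lt_horizon
  have h1 : Likely I (.setR rU (.lit 0) horizonE) st₀ 0 0 fun st' =>
      SameExcept ∅ {rU} st₀ st' ∧ st'.real rU 0 = I.game.horizon :=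
    Likely.of_forall_runs fun ω => runs_setScale hnm st₀
  have h2 : ∀ st₁, (SameExcept ∅ {rU} st₀ st₁ ∧ st₁.real rU 0 = I.game.horizon) →
      Likely I (fill rV (num 0)) st₁ 0 0 (Stage b I w τ₀ L (I.game.horizon / 2 ^ 0)) := by
    rintro st₁ ⟨k1, k2⟩
    refine Likely.of_forall_runs fun ω => (runs_clear hn hm st₁).imp fun st₂ k => ?_
    refine ⟨?_, ?_, fun s => (k.2 s).ge, fun s => ?_, τ₀, ?_, ?_, fun _ _ => rfl⟩
    · rw [k.1.real rL (by decide), k1.real rL (by decide), hL₀]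
    · rw [k.1.real rU (by decide), k2]
      simp
    · rw [k.2]
      have := hw.le_horizon s
      rw [sideGame_horizon] at this
      simpa using this
    · intro s
      rw [k.1.nat rOut (by decide), k1.nat rOut (by decide), hτ₀]
    · have hq : ∀ s a, 0 ≤ (sideGame b I.game).qvalue (fun _ => 0) s a := fun s a => by
        rw [Game.qvalue, Game.expect_const, mul_zero, add_zero]
        exact ((sideGame b I.game).reward_mem s a).1
      have e : (fun s : Fin n => st₂.real rV s) = fun _ => 0 := funext k.2
      rw [e]
      exact ⟨fun s _ => hq _ _, fun s _ a => hq _ _⟩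
  have h3 : ∀ st₂, Stage b I w τ₀ L (I.game.horizon / 2 ^ 0) st₂ →
      Likely I (.loop (.ltR .eps (.add (.var rU) (.var rU))) (phase b)) st₂
        (K * I.game.phaseQueries I.eps L)
        (K * ((1 + ⌈3 * I.game.horizon⌉₊ : ℕ) * roundFailure n m L)) fun st' =>
          ∃ u ≤ I.eps / 2, Stage b I w τ₀ L u st' := by
    intro st₂ h
    have hcharge : ∀ (st : State 8) u t l, Stage b I w τ₀ L u st →
        Stage b I w τ₀ L u (st.charge t l) :=
      fun st u t l h => ⟨h.conf, h.scale, h.nonneg, h.close, h.strategy⟩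
    refine (Likely.loop (J := fun i => Stage b I w τ₀ L (I.game.horizon / 2 ^ i))
      ?_ ?_ h).weaken le_rfl ?_
    · intro i hi st h
      refine ⟨?_, fun t l => ?_⟩
      · rw [loopTest_holds, h.scale]
        exact hK.2.1 i hi
      · have h4 := likely_phase hn hm hε hε1 hL hw (hK.2.1 i hi)
          (div_le_self (by linarith) (one_le_pow₀ one_le_two)) (hcharge st _ t l h)
        rw [pow_succ, ← div_div]
        exact h4
    · intro st h
      rw [loopTest_holds, h.scale]
      exact hK.2.2
    · rintro st' ⟨st'', t, l, h, rfl⟩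
      exact ⟨_, by linarith [hK.2.2], hcharge _ _ _ _ h⟩
  have h := h1.seq fun st₁ k₁ => (h2 st₁ k₁).seq h3
  simp only [zero_add] at h
  exact h

/-- The quantity under the logarithm in the bound on the number of queries. -/
noncomputable def logArg (I : Input n m) : ℝ :=
  (n : ℝ) * m / ((1 - I.game.discount) * I.eps * I.delta)

theorem runs_calibrate (hnm : 0 < n * m) {l : ℕ} (hl : ∀ k < l, (2 : ℝ) ^ k < logArg I)
    (hl' : logArg I ≤ 2 ^ l) (st₀ : State 8) :
    Runs I ω calibrate st₀ (32 * l + 26) 0 fun st' =>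
      SameExcept ∅ {rAcc, rL} st₀ st' ∧ st'.real rL 0 = 2 * l + 5 := by
  have htest : ∀ st : State 8, (BExpr.ltR (.var rAcc) (.div (.mul (.ofNat .numStates)
      (.ofNat .numActions)) (.mul (.mul (.sub (num 1) .discount) .eps) .delta))).holds I st ↔
      st.real rAcc 0 < logArg I := fun st => by
    simp only [BExpr.holds, RExpr.eval, NExpr.eval, logArg, Nat.cast_one]
  have h0 : Runs I ω calibrate st₀ (4 + (4 + (l * (17 + 1 + (7 + 7)) + (17 + 1))))
      (0 + (0 + l * (0 + 0))) fun st' =>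
      SameExcept ∅ {rAcc, rL} st₀ st' ∧ st'.real rL 0 = 2 * l + 5 := by
    refine Runs.seq (Runs.setR hnm (Nat.zero_le _) (Nat.zero_le _) (fun t₁ l₁ => ?_) le_rfl)
    refine Runs.seq (Runs.setR hnm (Nat.zero_le _) (Nat.zero_le _) (fun t₂ l₂ => ?_) le_rfl)
    refine (Runs.loop (N := l) (T := 7 + 7) (q := 0 + 0) (J := fun i st =>
      SameExcept ∅ {rAcc, rL} st₀ st ∧ st.real rAcc 0 = 2 ^ i ∧ st.real rL 0 = 2 * i + 5)
      ?_ ?_ ?_ ?_).imp ?_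
    · intro i st _
      change max (max 0 1) 0 ≤ n * m
      omega
    · rintro i hi st ⟨a1, a2, a3⟩
      refine ⟨by rw [htest, a2]; exact hl i hi, fun t l => ?_⟩
      refine Runs.seq (Runs.setR hnm (Nat.zero_le _) ?_ (fun t₃ l₃ => ?_) le_rfl)
      · change max (max 0 1) (max 0 1) ≤ n * m
        omega
      refine Runs.setR hnm (Nat.zero_le _) ?_ (fun t₄ l₄ => ?_) le_rfl
      · change max (max 0 1) 0 ≤ n * m
        omega
      refine ⟨a1.charge.charge.writeR.charge.writeR, ?_, ?_⟩
      · rw [writeR_real, if_neg fun e => absurd e.1 (by decide), charge_real, writeR_real,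
          if_pos ⟨rfl, rfl⟩]
        change st.real rAcc 0 + st.real rAcc 0 = _
        rw [a2, pow_succ]
        ring
      · rw [writeR_real, if_pos ⟨rfl, rfl⟩]
        change (((st.charge t l).charge t₃ l₃).writeR rAcc 0 _).real rL 0 + ((2 : ℕ) : ℝ) = _
        rw [writeR_real, if_neg fun e => absurd e.1 (by decide)]
        change st.real rL 0 + _ = _
        rw [a3]
        push_cast
        ring
    · rintro st ⟨a1, a2, a3⟩
      rw [htest, a2]
      exact not_lt.2 hl'
    · refine ⟨(SameExcept.refl _ _ st₀).charge.writeR.charge.writeR, ?_, ?_⟩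
      · rw [writeR_real, if_neg fun e => absurd e.1 (by decide), charge_real, writeR_real,
          if_pos ⟨rfl, rfl⟩]
        simp [RExpr.eval, NExpr.eval]
      · rw [writeR_real, if_pos ⟨rfl, rfl⟩]
        simp [RExpr.eval, NExpr.eval]
    · rintro st' ⟨st'', t, l, ⟨h1, -, h2⟩, rfl⟩
      exact ⟨h1.charge, h2⟩
  exact h0.weaken (by omega) (by simp) fun _ h => h

/-- The number of doublings from `1` to `y` is at most `y`, and at most logarithmic. -/
theorem exists_pow_two_ge {y : ℝ} (hy : 1 < y) : ∃ K : ℕ, 0 < K ∧ (∀ k < K, (2 : ℝ) ^ k < y) ∧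
    y ≤ 2 ^ K ∧ (K : ℝ) ≤ y ∧ (K : ℝ) ≤ 1 + 2 * Real.log y := by
  classical
  have hex : ∃ K : ℕ, y ≤ 2 ^ K := (pow_unbounded_of_one_lt y one_lt_two).imp fun _ h => h.le
  obtain ⟨j, hj⟩ : ∃ j, Nat.find hex = j + 1 := Nat.exists_eq_succ_of_ne_zero fun h => by
    have := Nat.find_spec hex
    rw [h, pow_zero] at this
    linarith
  have hmin : ∀ k < j + 1, (2 : ℝ) ^ k < y := fun k hk => by
    rw [← hj] at hk
    exact not_le.1 (Nat.find_min hex hk)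
  have h1 := hmin j (Nat.lt_succ_self j)
  refine ⟨j + 1, Nat.succ_pos j, hmin, ?_, ?_, ?_⟩
  · rw [← hj]
    exact Nat.find_spec hex
  · refine le_trans ?_ h1.le
    exact_mod_cast (Nat.lt_two_pow_self (n := j))
  · have h2 := Real.log_lt_log (by positivity) h1
    rw [Real.log_pow] at h2
    have h3 := Real.log_two_gt_d9
    push_cast
    nlinarith [(Nat.cast_nonneg j : (0 : ℝ) ≤ j)]

end Solver

namespace Game

variable {n m : ℕ} (G : Game n m)

theorem combine_restrict (σ : Fin n → Fin m) : G.combine (fun s => σ s) (fun s => σ s) = σ := by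
  funext s
  unfold combine
  split <;> rfl

theorem le_bound₁ {ε L : ℝ} (hε : 0 < ε) (hε1 : ε < 1) (hL : 0 ≤ L) : L ≤ G.bound₁ ε L := by
  have hH : 1 ≤ G.horizon ^ 3 := one_le_pow₀ G.one_lt_horizon.le
  rw [bound₁, le_div_iff₀ (by positivity)]
  calc L * ε ^ 2 ≤ L * 1 := by
        gcongr
        exact pow_le_one₀ hε.le hε1.le
    _ ≤ 65536 * L * 1 := by linarith
    _ ≤ 65536 * L * G.horizon ^ 3 := by gcongr

/-- A phase takes `O(n m L H³ / ε²)` queries, for the horizon `H`. -/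
theorem phaseQueries_le {ε L : ℝ} (hε : 0 < ε) (hε1 : ε < 1) (hL : 1 ≤ L) :
    (G.phaseQueries ε L : ℝ) ≤ 163840 * (n * m * (L * G.horizon ^ 3 / ε ^ 2)) := by
  have hH := G.one_lt_horizon
  obtain ⟨H, hHdef⟩ : ∃ H, H = G.horizon := ⟨_, rfl⟩
  rw [← hHdef] at hH ⊢
  obtain ⟨y, hy⟩ : ∃ y, y = L * H ^ 3 / ε ^ 2 := ⟨_, rfl⟩
  have hL0 : 0 < L := by linarith
  have hε2 : ε ^ 2 ≤ 1 := pow_le_one₀ hε.le hε1.le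
  have hLH : 1 ≤ L * H ^ 2 := one_le_mul_of_one_le_of_one_le hL (one_le_pow₀ hH.le)
  have hy1 : L * H ^ 2 * H ≤ y := by
    rw [hy, le_div_iff₀ (by positivity)]
    calc L * H ^ 2 * H * ε ^ 2 ≤ L * H ^ 2 * H * 1 := by gcongr
      _ = L * H ^ 3 := by ring
  have hy2 : 1 ≤ y := le_trans (one_le_mul_of_one_le_of_one_le hLH hH.le) hy1
  have e1 : (⌈G.bound₁ ε L⌉₊ : ℝ) ≤ 131072 * y := by
    have h := Nat.ceil_lt_add_one (G.bound₁_pos hε hL0).le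
    have e : G.bound₁ ε L = 65536 * y := by
      rw [bound₁, ← hHdef, hy]
      ring
    rw [e] at h ⊢
    linarith
  have e2 : (⌈G.bound₂ L⌉₊ : ℝ) ≤ 8192 * (L * H ^ 2) := by
    have e : G.bound₂ L = 4096 * (L * H ^ 2) := by
      rw [bound₂, ← hHdef]
      ring
    have h := Nat.ceil_lt_add_one (a := G.bound₂ L) (by rw [e]; positivity)
    rw [e] at h ⊢
    linarith
  have e3 : (⌈3 * H⌉₊ : ℝ) ≤ 4 * H := by
    have h := Nat.ceil_lt_add_one (a := 3 * H) (by linarith)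
    linarith
  have e4 : (⌈3 * H⌉₊ : ℝ) * ⌈G.bound₂ L⌉₊ ≤ 32768 * y := by
    calc (⌈3 * H⌉₊ : ℝ) * ⌈G.bound₂ L⌉₊ ≤ 4 * H * (8192 * (L * H ^ 2)) := by gcongr
      _ = 32768 * (L * H ^ 2 * H) := by ring
      _ ≤ 32768 * y := by linarith
  have hnm' : (0 : ℝ) ≤ n * m := by positivity
  rw [phaseQueries, ← hHdef, ← hy]
  push_cast
  nlinarith [mul_le_mul_of_nonneg_left (add_le_add e1 e4) hnm']

end Game

namespace Solver

variable {n m : ℕ} {I : Input n m}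

theorem logArg_eq : logArg I = n * m * I.game.horizon / (I.eps * I.delta) := by
  rw [logArg, Game.horizon, div_mul_eq_div_div, div_mul_eq_div_div, div_mul_eq_div_div,
    ← div_eq_mul_inv]

theorem horizon_div_le_logArg (hnm : 0 < n * m) (hε : 0 < I.eps) (hδ : 0 < I.delta)
    (hδ1 : I.delta < 1) : I.game.horizon / I.eps ≤ logArg I := by
  have hH := I.game.one_lt_horizon
  have h1 : (1 : ℝ) ≤ n * m := by exact_mod_cast hnm
  rw [logArg_eq, div_le_div_iff₀ hε (mul_pos hε hδ)]
  calc I.game.horizon * (I.eps * I.delta) ≤ I.game.horizon * (I.eps * 1) := by gcongr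
    _ = 1 * I.game.horizon * I.eps := by ring
    _ ≤ n * m * I.game.horizon * I.eps := by gcongr

theorem one_lt_horizon_div (hε : 0 < I.eps) (hε1 : I.eps < 1) :
    1 < I.game.horizon / I.eps := by
  rw [one_lt_div hε]
  exact hε1.trans I.game.one_lt_horizon

/-- The number of phases is logarithmic, and small enough for the union bound. -/
theorem exists_isPhaseCount (hnm : 0 < n * m) (hε : 0 < I.eps) (hε1 : I.eps < 1)
    (hδ : 0 < I.delta) (hδ1 : I.delta < 1) : ∃ K, IsPhaseCount I K ∧
      (K : ℝ) ≤ 2 * (I.game.horizon / I.eps) ∧ (K : ℝ) ≤ 3 * (1 + Real.log (logArg I)) := by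
  have h1 := one_lt_horizon_div (I := I) hε hε1
  obtain ⟨K, hK, hlt, hle, hK1, hK2⟩ :=
    exists_pow_two_ge (y := 2 * (I.game.horizon / I.eps)) (by linarith)
  refine ⟨K, ⟨hK, fun k hk => ?_, not_lt.2 ?_⟩, hK1, ?_⟩
  · have := hlt k hk
    rw [← mul_div_assoc, lt_div_iff₀ hε] at this
    rw [← mul_div_assoc, lt_div_iff₀ (by positivity)]
    linarith
  · rw [← mul_div_assoc, div_le_iff₀ hε] at hle
    rw [← mul_div_assoc, div_le_iff₀ (by positivity)]
    linarith
  · rw [Real.log_mul two_ne_zero (by linarith)] at hK2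
    have h2 := Real.log_le_log (by linarith) (horizon_div_le_logArg hnm hε hδ hδ1)
    have h3 := Real.log_nonneg (h1.le.trans (horizon_div_le_logArg hnm hε hδ hδ1))
    have h4 := Real.log_two_lt_d9
    linarith

/-- The confidence parameter is large enough for a union bound over all estimates. -/
theorem failure_le (hnm : 0 < n * m) (hε : 0 < I.eps) (hε1 : I.eps < 1)
    (hδ : 0 < I.delta) (hδ1 : I.delta < 1) {K l : ℕ}
    (hK : (K : ℝ) ≤ 2 * (I.game.horizon / I.eps)) (hl : logArg I ≤ 2 ^ l) :
    (2 * (K * ((1 + ⌈3 * I.game.horizon⌉₊ : ℕ) * roundFailure n m (2 * l + 5))) : ENNReal) ≤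
      ENNReal.ofReal I.delta := by
  have hH := I.game.one_lt_horizon
  have hX : 0 < logArg I := by
    linarith [one_lt_horizon_div (I := I) hε hε1, horizon_div_le_logArg hnm hε hδ hδ1]
  have e : (2 * (K * ((1 + ⌈3 * I.game.horizon⌉₊ : ℕ) * roundFailure n m (2 * l + 5))) : ENNReal) =
      ENNReal.ofReal (2 * (K * ((1 + ⌈3 * I.game.horizon⌉₊ : ℕ) *
        (n * m * (2 * Real.exp (-(2 * l + 5))))))) := by
    rw [ENNReal.ofReal_mul zero_le_two, ENNReal.ofReal_mul (Nat.cast_nonneg _),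
      ENNReal.ofReal_mul (Nat.cast_nonneg _), ENNReal.ofReal_natCast, ENNReal.ofReal_natCast,
      ENNReal.ofReal_ofNat, roundFailure]
  rw [e]
  refine ENNReal.ofReal_le_ofReal ?_
  have h1 : ((1 + ⌈3 * I.game.horizon⌉₊ : ℕ) : ℝ) ≤ 5 * I.game.horizon := by
    have h := Nat.ceil_lt_add_one (a := 3 * I.game.horizon) (by linarith)
    push_cast
    linarith
  have h2 : 40 * logArg I ^ 2 ≤ Real.exp (2 * l + 5) := by
    have e1 : (40 : ℝ) ≤ Real.exp 5 := by
      calc (40 : ℝ) ≤ 2.7 ^ 5 := by norm_num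
        _ ≤ Real.exp 1 ^ 5 := by
          gcongr
          linarith [Real.exp_one_gt_d9]
        _ = Real.exp 5 := by rw [← Real.exp_nat_mul]; norm_num
    have e2 : (2 : ℝ) ^ l ≤ Real.exp l := by
      calc (2 : ℝ) ^ l ≤ Real.exp 1 ^ l := by
            gcongr
            linarith [Real.exp_one_gt_d9]
        _ = Real.exp l := by rw [← Real.exp_nat_mul, mul_one]
    calc 40 * logArg I ^ 2 ≤ Real.exp 5 * Real.exp l ^ 2 := by
          gcongr
          exact hl.trans e2
      _ = Real.exp (2 * l + 5) := by
          rw [← Real.exp_nat_mul, ← Real.exp_add]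
          congr 1
          push_cast
          ring
  have h3 : (1 : ℝ) ≤ n * m := by exact_mod_cast hnm
  rw [Real.exp_neg]
  calc (2 : ℝ) * (K * ((1 + ⌈3 * I.game.horizon⌉₊ : ℕ) *
        (n * m * (2 * (Real.exp (2 * l + 5))⁻¹)))) ≤
      2 * (2 * (I.game.horizon / I.eps) * (5 * I.game.horizon *
        (n * m * (2 * (40 * logArg I ^ 2)⁻¹)))) := by gcongr
    _ = I.eps * I.delta ^ 2 / (n * m) := by
      rw [logArg_eq]
      field_simp
      ring
    _ ≤ 1 * (I.delta * 1) / 1 := by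
      rw [pow_two]
      gcongr
    _ = I.delta := by ring

/-- The program always halts, within the claimed bounds on queries, time and space. -/
theorem runs_program (hn : 0 < n) (hm : 0 < m) (hε : 0 < I.eps) (hε1 : I.eps < 1) {K l : ℕ}
    (hK : IsPhaseCount I K) (hl : ∀ k < l, (2 : ℝ) ^ k < logArg I) (hl' : logArg I ≤ 2 ^ l)
    (ω : Game.Samples n m) :
    Runs I ω program.body (State.init 8)
      (2000 * (2 * (K * I.game.phaseQueries I.eps (2 * l + 5))))
      (2 * (K * I.game.phaseQueries I.eps (2 * l + 5))) fun _ => True := by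
  have hnm : 0 < n * m := Nat.mul_pos hn hm
  have hL : (0 : ℝ) < 2 * l + 5 := by positivity
  obtain ⟨Z, hZ⟩ : ∃ Z, Z = I.game.phaseQueries I.eps (2 * l + 5) := ⟨_, rfl⟩
  have hrun : Runs I ω program.body (State.init 8)
      ((32 * l + 26) + (800 * (K * Z) + 800 * (K * Z))) (0 + (K * Z + K * Z)) fun _ => True := by
    refine Runs.seq ((runs_calibrate hnm hl hl' _).imp fun st₁ k₁ => ?_)
    have h1 := runs_side (ω := ω) false hn hm hε hK st₁ (by rw [k₁.2]; exact hL)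
    rw [k₁.2, ← hZ] at h1
    refine Runs.seq (h1.imp fun st₂ k₂ => ?_)
    have h2 := runs_side (ω := ω) true hn hm hε hK st₂ (by rw [k₂, k₁.2]; exact hL)
    rw [k₂, k₁.2, ← hZ] at h2
    exact h2.imp fun _ _ => trivial
  have h1 : 2 * l + 5 ≤ Z := by
    have h2 : (2 * l + 5 : ℝ) ≤ ⌈I.game.bound₁ I.eps (2 * l + 5)⌉₊ := by
      have h3 := I.game.le_bound₁ hε hε1 hL.le
      exact h3.trans (Nat.le_ceil _)
    have h3 : 2 * l + 5 ≤ ⌈I.game.bound₁ I.eps (2 * l + 5)⌉₊ := by exact_mod_cast h2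
    rw [hZ, Game.phaseQueries]
    exact (h3.trans (Nat.le_mul_of_pos_left _ hnm)).trans (Nat.le_add_right _ _)
  have h2 : Z ≤ K * Z := Nat.le_mul_of_pos_left _ hK.1
  rw [← hZ]
  exact hrun.weaken (by omega) (by omega) fun _ h => h

/-- With probability at least `1 - δ`, both sides of the program end with near-optimal guarantees,
which certify the optimality of the combined strategy. -/
theorem likely_program (hn : 0 < n) (hm : 0 < m) (hε : 0 < I.eps) (hε1 : I.eps < 1) {K l : ℕ}
    (hK : IsPhaseCount I K) (hl : ∀ k < l, (2 : ℝ) ^ k < logArg I) (hl' : logArg I ≤ 2 ^ l) :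
    Likely I program.body (State.init 8)
      (2 * (K * I.game.phaseQueries I.eps (2 * l + 5)))
      (2 * (K * ((1 + ⌈3 * I.game.horizon⌉₊ : ℕ) * roundFailure n m (2 * l + 5)))) fun st =>
        ∃ τ : Fin n → Fin m, (∀ s : Fin n, st.nat rOut s = τ s) ∧
          I.game.IsEpsOptimal I.eps (fun s => τ s) (fun s => τ s) := by
  have hnm : 0 < n * m := Nat.mul_pos hn hm
  have hL : (0 : ℝ) < 2 * l + 5 := by positivity
  obtain ⟨w, hw⟩ := I.game.exists_isBellman hm
  have h0 : Likely I calibrate (State.init 8) 0 0 fun st =>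
      st.real rL 0 = 2 * l + 5 ∧ ∀ s : Fin n, st.nat rOut s = (⟨0, hm⟩ : Fin m) :=
    Likely.of_forall_runs fun ω => (runs_calibrate hnm hl hl' _).imp fun st k =>
      ⟨k.2, fun s => by rw [k.1.nat rOut (by decide)]; rfl⟩
  have h := h0.seq fun st₁ k₁ => (likely_side false hn hm hε hε1 hK hL (w := w) hw
    (τ₀ := fun _ => ⟨0, hm⟩) k₁.1 k₁.2).seq
    (d := side true) (q' := K * I.game.phaseQueries I.eps (2 * l + 5))
    (p' := K * ((1 + ⌈3 * I.game.horizon⌉₊ : ℕ) * roundFailure n m (2 * l + 5)))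
    (E' := fun st => ∃ τ : Fin n → Fin m, (∀ s : Fin n, st.nat rOut s = τ s) ∧
          I.game.IsEpsOptimal I.eps (fun s => τ s) (fun s => τ s)) fun st₂ ⟨u, hu, k₂⟩ => ?_
  · rw [zero_add, zero_add, ← two_mul, ← two_mul] at h
    exact h
  obtain ⟨τ, t1, t2, -⟩ := k₂.strategy
  refine (likely_side true hn hm hε hε1 hK hL (w := fun s => I.game.horizon - w s) hw.reflect
    k₂.conf t1).weaken le_rfl ?_
  rintro st₃ ⟨u', hu', k₃⟩
  obtain ⟨τ', t1', t2', t3'⟩ := k₃.strategy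
  refine ⟨τ', t1', I.game.isEpsOptimal_of_guarantees (w := w)
    (Game.Guarantees.congr (G := I.game) t2 fun s hs => t3' s ?_) t2'
    (fun s => by linarith [k₂.close s]) (fun s => by linarith [k₃.close s])⟩
  change (I.game.owner s).other = _
  rw [hs]
  rfl

end Solver

theorem theorem1 :
    ∃ (p : Program) (C : ℝ) (κ : ℕ),
      ∀ (n m : ℕ), 0 < n → 0 < m →
      ∀ (G : Game n m) (ε δ : ℝ), ε ∈ Set.Ioo (0 : ℝ) 1 → δ ∈ Set.Ioo (0 : ℝ) 1 →
        (∀ ω : Game.Samples n m, ∃ st : State p.k, p.HaltsIn ⟨G, ε, δ⟩ ω st ∧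
          (st.queries : ℝ) ≤ C * ((n : ℝ) * m * ((1 - G.discount) ^ 3)⁻¹ * (ε ^ 2)⁻¹) *
            (1 + Real.log ((n : ℝ) * m / ((1 - G.discount) * ε * δ))) ^ κ ∧
          (st.time : ℝ) ≤ C * st.queries ∧
          (st.space : ℝ) ≤ C * ((n : ℝ) * m)) ∧
        ENNReal.ofReal (1 - δ) ≤ G.sampleLaw {ω : Game.Samples n m |
          ∃ (st : State p.k) (π : G.MinStrategy) (τ : G.MaxStrategy),
            p.HaltsIn ⟨G, ε, δ⟩ ω st ∧ p.Outputs G st π τ ∧ G.IsEpsOptimal ε π τ} := by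
  refine ⟨Solver.program, 10 ^ 7, 2, fun n m hn hm G ε δ hε hδ => ?_⟩
  obtain ⟨I, hI⟩ : ∃ I : Input n m, I = ⟨G, ε, δ⟩ := ⟨_, rfl⟩
  have hnm : 0 < n * m := Nat.mul_pos hn hm
  have hIG : I.game = G := by rw [hI]
  have hIε : I.eps = ε := by rw [hI]
  have hIδ : I.delta = δ := by rw [hI]
  have hε0 : 0 < I.eps := by rw [hIε]; exact hε.1
  have hε1 : I.eps < 1 := by rw [hIε]; exact hε.2
  have hδ0 : 0 < I.delta := by rw [hIδ]; exact hδ.1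
  have hδ1 : I.delta < 1 := by rw [hIδ]; exact hδ.2
  have hX : 1 < Solver.logArg I := (Solver.one_lt_horizon_div hε0 hε1).trans_le
    (Solver.horizon_div_le_logArg hnm hε0 hδ0 hδ1)
  obtain ⟨K, hK, hK1, hK2⟩ := Solver.exists_isPhaseCount hnm hε0 hε1 hδ0 hδ1
  obtain ⟨l, -, hl, hl', -, hl2⟩ := Solver.exists_pow_two_ge hX
  rw [← hI]
  constructor
  · intro ω
    obtain ⟨st, h1, h2, h3, h4, -⟩ := Solver.runs_program hn hm hε0 hε1 hK hl hl' ω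
    change st.time ≤ 0 + _ at h2
    change st.queries = 0 + _ at h3
    change st.length ≤ max 0 (n * m) at h4
    rw [zero_add] at h2 h3
    rw [← h3] at h2
    have hlog : 0 ≤ Real.log (Solver.logArg I) := Real.log_nonneg hX.le
    have hL : (1 : ℝ) ≤ 2 * l + 5 := by linarith [(Nat.cast_nonneg l : (0 : ℝ) ≤ l)]
    have hlogArg : (n : ℝ) * m / ((1 - G.discount) * ε * δ) = Solver.logArg I := by
      rw [Solver.logArg, hIG, hIε, hIδ]
    refine ⟨st, h1, ?_, ?_, ?_⟩
    · have hZ := I.game.phaseQueries_le hε0 hε1 hL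
      rw [hlogArg]
      set g := 1 + Real.log (Solver.logArg I) with hg
      obtain ⟨y, hy⟩ : ∃ y, y = (n : ℝ) * m * ((1 - G.discount) ^ 3)⁻¹ * (ε ^ 2)⁻¹ := ⟨_, rfl⟩
      have hy0 : 0 ≤ y := by
        have := G.discount_lt_one
        have : 0 ≤ 1 - G.discount := by linarith
        rw [hy]
        positivity
      have e : (n : ℝ) * m * ((2 * l + 5) * I.game.horizon ^ 3 / I.eps ^ 2) = (2 * l + 5) * y := by
        rw [hy, Game.horizon, hIG, hIε, inv_pow]
        ring
      rw [e] at hZ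
      have hl3 : (2 * l + 5 : ℝ) ≤ 7 * g := by linarith
      rw [← hy, h3]
      push_cast
      calc (2 : ℝ) * (K * I.game.phaseQueries I.eps (2 * l + 5)) ≤
          2 * (3 * g * (163840 * (7 * g * y))) := by
            gcongr
            exact hZ.trans (by gcongr)
        _ = 6881280 * (y * g ^ 2) := by ring
        _ ≤ 10 ^ 7 * (y * g ^ 2) := by
            gcongr
            norm_num
        _ = 10 ^ 7 * y * g ^ 2 := by ring
    · calc (st.time : ℝ) ≤ ((2000 * st.queries : ℕ) : ℝ) := by exact_mod_cast h2
        _ = 2000 * st.queries := by push_cast; ring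
        _ ≤ 10 ^ 7 * st.queries := by
            gcongr
            norm_num
    · have h5 : st.space ≤ 16 * (n * m) := Nat.mul_le_mul_left 16 (by omega)
      calc (st.space : ℝ) ≤ ((16 * (n * m) : ℕ) : ℝ) := by exact_mod_cast h5
        _ = 16 * (n * m) := by push_cast; ring
        _ ≤ 10 ^ 7 * (n * m) := by
            gcongr
            norm_num
  · subst hI
    have h : G.sampleLaw {ω | ¬ ∃ st', Exec ⟨G, ε, δ⟩ ω Solver.program.body (State.init 8) st' ∧
        st'.queries = 0 + 2 * (K * G.phaseQueries ε (2 * l + 5)) ∧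
        ∃ τ : Fin n → Fin m, (∀ s : Fin n, st'.nat Solver.rOut s = τ s) ∧
          G.IsEpsOptimal ε (fun s => τ s) (fun s => τ s)} ≤ ENNReal.ofReal δ :=
      (Solver.likely_program hn hm hε0 hε1 hK hl hl').trans
        (Solver.failure_le hnm hε0 hε1 hδ0 hδ1 hK1 hl')
    rw [ENNReal.ofReal_sub _ hδ.1.le, ENNReal.ofReal_one, tsub_le_iff_right]
    have : IsProbabilityMeasure G.sampleLaw := by
      unfold Game.sampleLaw
      infer_instance
    -- The good event need not be measurable: subadditivity of the outer measure suffices.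
    rw [← measure_univ (μ := G.sampleLaw)]
    refine ((measure_mono fun ω _ => ?_).trans (measure_union_le _ _)).trans (add_le_add le_rfl h)
    by_cases hω : ∃ st', Exec ⟨G, ε, δ⟩ ω Solver.program.body (State.init 8) st' ∧
        st'.queries = 0 + 2 * (K * G.phaseQueries ε (2 * l + 5)) ∧
        ∃ τ : Fin n → Fin m, (∀ s : Fin n, st'.nat Solver.rOut s = τ s) ∧
          G.IsEpsOptimal ε (fun s => τ s) (fun s => τ s)
    · left
      obtain ⟨st, h1, -, τ, h2, h3⟩ := hω
      exact ⟨st, fun s => τ s, fun s => τ s, h1, fun s => by rw [G.combine_restrict]; exact h2 s,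
        h3⟩
    · exact Or.inr hω
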